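/- **Conventions.** $\log x$ means $\max(1,\log_2 x)$, and $\log\log x=\log(\log x)$. The bitlength of an integer is $\lg 0=1$ and $\lg a=1+\lfloor\log_2|a|\rfloor$ for $a\ne0$. $\mathrm{Rem}$ denotes the nonnegative remainder. Bit operations are counted in the naive bit complexity model: programs for a random access integer machine (memory cells addressed by an array name and two integer indices, initially zero except for the input; assignment, sequencing, branching, loops), in which adding, subtracting, comparing, copying and shifting integers cost linearly many bit operations, a product $ab$ costs $(\lg a)(\lg b)$, a quotient or remainder of $a$ by $b$ costs $(\lg\lfloor a/b\rfloor)(\lg b)$, and each memory access costs the bitlengths of the indices and of the integer transferred. The *Hermite form* of a nonsingular $A\in\mathbb Z^{n\times n}$ is the matrix $H=QA$ with $Q$ unimodular such that $H$ is upper triangular with positive diagonal and $0\le H_{ij}<H_{jj}$ for $i<j$. Its *Smith form* is $S=\mathrm{diag}(s_1,\dots,s_n)$ with $s_i>0$, $s_i\mid s_{i+1}$ and $AV=WS$ for some unimodular $V,W$; put $s=s_n$, $S^*=sS^{-1}$. A *reduced Smith massager* of $A$ is an $M\in\mathbb Z^{n\times n}$ with $0\le M_{ij}<s_j$, such that $AM\equiv0$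 and $\hat WM\equiv I_n$ for some $\hat W\in\mathbb Z^{n\times n}$, where column $j$ is taken modulo $s_j$ in both congruences. A *Howell form* over $\mathbb Z/(s)$ of an integer matrix $B\in\mathbb Z^{n\times n}$ is an upper triangular integer matrix $T$ whose diagonal entries are positive divisors of $s$ (with $s$ standing for a diagonal entry that is zero modulo $s$), that is right equivalent to $B$ over $\mathbb Z/(s)$, and such that for all $0\le k\le n$ the vectors in the $\mathbb Z/(s)$-column span of $B$ whose last $k$ entries are zero are exactly the $\mathbb Z/(s)$-linear combinations of those columns of $T$ whose last $k$ entries are zero (a pivot $s$ counting as a nonzero entry of $T$). **Theorem.** There is a (deterministic) program such that for every $c$ there is a constant $C$, depending only on $c$, with the following property. Let $n\ge1$ and let the input consist of 1. a nonsingular $A\in\mathbb Z^{n\times n}$, 2. the Smith form $S=\mathrm{diag}(s_1,\dots,s_n)$ of $A$, 3. a reduced Smith massager $M$ of $A$, 4. a matrix $U\in\mathbb Z^{n\times n}$ with $0\le U_{ij}<s_i$ such that $MS^*U$ is congruent modulo $s$ to a Howell form of $MS^*$ over $\mathbb Z/(s)$, 5. the diagonal entries $h_1,\dots,h_n$ of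 the Hermite form of $A$, 6. a prime $p$ not dividing $s$ with $\log p\le c\,\log\log\det S$. On this input the program halts with the Hermite form $H$ of $A$ as output, after at most $$C\left(n(\log\det S)^2+n^2(\log\det S)(\log\log\det S)\right)$$ bit operations. -/

import Mathlib

/-! ### Matrix notions: Hermite form, Smith form, Smith massager, Howell form -/

/-- `H` is the (row) Hermite normal form of the integer matrix `A`: it is left equivalent to `A`
over the integers, upper triangular with positive diagonal, and the entries above a diagonal entry
are nonnegative and strictly smaller than that diagonal entry. -/
structure IsHermiteForm {n : ℕ} (A H : Matrix (Fin n) (Fin n) ℤ) : Prop where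
  equiv : ∃ Q : Matrix (Fin n) (Fin n) ℤ, IsUnit Q.det ∧ H = Q * A
  upper : ∀ i j, j < i → H i j = 0
  diag_pos : ∀ j, 0 < H j j
  reduced : ∀ i j, i < j → 0 ≤ H i j ∧ H i j < H j j

/-- `h` lists the diagonal entries of the Hermite form of `A`. -/
def IsHermiteDiagonal {n : ℕ} (A : Matrix (Fin n) (Fin n) ℤ) (h : Fin n → ℤ) : Prop :=
  ∃ H : Matrix (Fin n) (Fin n) ℤ, IsHermiteForm A H ∧ ∀ j, h j = H j j

/-- `S = diag(s₁, …, sₙ)` is the Smith normal form of the nonsingular integer matrix `A`. -/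
structure IsSmithForm {n : ℕ} (A S : Matrix (Fin n) (Fin n) ℤ) : Prop where
  equiv : ∃ V W : Matrix (Fin n) (Fin n) ℤ, IsUnit V.det ∧ IsUnit W.det ∧ A * V = W * S
  diagonal : ∀ i j, i ≠ j → S i j = 0
  diag_pos : ∀ i, 0 < S i i
  diag_dvd : ∀ i j, i ≤ j → S i i ∣ S j j

/-- The last diagonal entry `s = sₙ` of `S`. -/
def lastInvariant {n : ℕ} (S : Matrix (Fin n) (Fin n) ℤ) : ℤ :=
  if h : 0 < n then S ⟨n - 1, by omega⟩ ⟨n - 1, by omega⟩ else 1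

/-- The matrix `S* = s S⁻¹` for a nonsingular Smith form `S` (all divisions are exact). -/
def smithDual {n : ℕ} (S : Matrix (Fin n) (Fin n) ℤ) : Matrix (Fin n) (Fin n) ℤ :=
  Matrix.diagonal fun i => lastInvariant S / S i i

/-- `M` is a reduced Smith massager of `A`, where `S` is the Smith form of `A`:
`A M ≡ 0` and `W M ≡ I` for some integer matrix `W`, where column `j` is taken modulo `s_j`,
and column `j` of `M` has its entries in `[0, s_j)`. -/
structure IsReducedSmithMassager {n : ℕ} (A S M : Matrix (Fin n) (Fin n) ℤ) : Prop where
  annihilates : ∀ i j, S j j ∣ (A * M) i j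
  left_inverse : ∃ W : Matrix (Fin n) (Fin n) ℤ, ∀ i j, S j j ∣ (W * M - 1) i j
  reduced : ∀ i j, 0 ≤ M i j ∧ M i j < S j j

/-- The integer matrix `T` represents a (column) Howell form of `B` over `ℤ/(m)`.
It is right equivalent to `B` over `ℤ/(m)`, upper triangular, its diagonal entries are positive
divisors of `m` (with `m` itself standing for a diagonal entry that is zero in `ℤ/(m)`), and
it has the Howell property: for all `0 ≤ k ≤ n`, the vectors in the column span of `B` over `ℤ/(m)`
whose last `k` entries are zero are exactly the `ℤ/(m)`-linear combinations of those columns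
of `T` whose last `k` entries are zero. (A pivot `m` counts as a nonzero entry of `T` here.) -/
structure IsHowellForm {n : ℕ} (m : ℕ) (B T : Matrix (Fin n) (Fin n) ℤ) : Prop where
  equiv : ∃ V : Matrix (Fin n) (Fin n) (ZMod m), IsUnit V ∧
    T.map (Int.cast : ℤ → ZMod m) = B.map (Int.cast : ℤ → ZMod m) * V
  upper : ∀ i j, j < i → T i j = 0
  diag_pos : ∀ i, 0 < T i i
  diag_dvd : ∀ i, T i i ∣ (m : ℤ)
  howell : ∀ k : ℕ, k ≤ n → ∀ w : Fin n → ZMod m,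
    ((∃ v : Fin n → ZMod m, w = (B.map (Int.cast : ℤ → ZMod m)).mulVec v) ∧
        ∀ i : Fin n, n ≤ (i : ℕ) + k → w i = 0) ↔
      w ∈ Submodule.span (ZMod m) {x : Fin n → ZMod m | ∃ j : Fin n,
        (∀ i : Fin n, n ≤ (i : ℕ) + k → T i j = 0) ∧ x = fun i => ((T i j : ℤ) : ZMod m)}

/-- `U` is a reduced Howell transform: row `i` of `U` has its entries in `[0, s_i)`, and
`M S* U` is, modulo `s`, a Howell form of `M S*` over `ℤ/(s)`. -/
structure IsHowellTransform {n : ℕ} (S M U : Matrix (Fin n) (Fin n) ℤ) : Prop where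
  reduced : ∀ i j, 0 ≤ U i j ∧ U i j < S i i
  howell : ∃ T : Matrix (Fin n) (Fin n) ℤ,
    IsHowellForm (lastInvariant S).natAbs (M * smithDual S) T ∧
      ∀ i j, T i j ≡ (M * smithDual S * U) i j [ZMOD lastInvariant S]

/-! ### Naive bit complexity

A random access machine on integers, programmed in a small imperative language. Every operation is
charged the number of bit operations of standard (schoolbook) integer arithmetic, and every memory
access is charged the bitlengths of the address and of the number that is transferred. -/

/-- The bitlength of an integer: `1` for `0`, and `1 + ⌊log₂ |a|⌋` for `a ≠ 0`. -/
def bitlen (a : ℤ) : ℕ := 1 + Nat.log 2 a.natAbs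

/-- The memory: cell `(i, j)` of array number `a` holds the integer `σ a i j`. -/
abbrev Store : Type := ℕ → ℤ → ℤ → ℤ

def Store.write (σ : Store) (a : ℕ) (i j v : ℤ) : Store :=
  fun a' i' j' => if a' = a ∧ i' = i ∧ j' = j then v else σ a' i' j'

/-- Integer expressions. Array names are fixed by the program; indices are computed. -/
inductive Expr : Type
  | const (z : ℤ)
  | cell (a : ℕ) (i j : Expr)
  | add (e f : Expr)
  | sub (e f : Expr)
  | mul (e f : Expr)
  | quo (e f : Expr)
  | rem (e f : Expr)
  | shl (e f : Expr)
  | shr (e f : Expr)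

/-- Division is division with nonnegative remainder; `shl` and `shr` multiply by a power of `2` and
divide by a power of `2` (rounding down). -/
def Expr.eval (σ : Store) : Expr → ℤ
  | .const z => z
  | .cell a i j => σ a (i.eval σ) (j.eval σ)
  | .add e f => e.eval σ + f.eval σ
  | .sub e f => e.eval σ - f.eval σ
  | .mul e f => e.eval σ * f.eval σ
  | .quo e f => e.eval σ / f.eval σ
  | .rem e f => e.eval σ % f.eval σ
  | .shl e f => e.eval σ * 2 ^ (f.eval σ).toNat
  | .shr e f => e.eval σ / 2 ^ (f.eval σ).toNat

/-- The number of bit operations charged for evaluating an expression: linear cost for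
reading, addition, subtraction and shifts, `lg a * lg b` for the product of `a` and `b`, and
`lg (a / b) * lg b` for the quotient and for the remainder of `a` by `b`. -/
def Expr.cost (σ : Store) : Expr → ℕ
  | .const z => bitlen z
  | .cell a i j => i.cost σ + j.cost σ +
      (bitlen (i.eval σ) + bitlen (j.eval σ) + bitlen (σ a (i.eval σ) (j.eval σ)))
  | .add e f => e.cost σ + f.cost σ + (bitlen (e.eval σ) + bitlen (f.eval σ))
  | .sub e f => e.cost σ + f.cost σ + (bitlen (e.eval σ) + bitlen (f.eval σ))
  | .mul e f => e.cost σ + f.cost σ + bitlen (e.eval σ) * bitlen (f.eval σ)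
  | .quo e f => e.cost σ + f.cost σ + bitlen (e.eval σ / f.eval σ) * bitlen (f.eval σ)
  | .rem e f => e.cost σ + f.cost σ + bitlen (e.eval σ / f.eval σ) * bitlen (f.eval σ)
  | .shl e f => e.cost σ + f.cost σ + (bitlen (e.eval σ) + (f.eval σ).toNat)
  | .shr e f => e.cost σ + f.cost σ + (bitlen (e.eval σ) + bitlen (f.eval σ))

/-- Programs: a write into a memory cell, sequencing, branching, and loops. -/
inductive Prog : Type
  | skip
  | assign (a : ℕ) (i j e : Expr)
  | seq (P Q : Prog)
  | branch (e : Expr) (P Q : Prog)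
  | loop (e : Expr) (P : Prog)

/-- `Prog.Exec P σ t τ`: started on the memory `σ`, the program `P` halts with memory `τ`
after `t` bit operations. A branch takes its first alternative, and a loop goes on, when the value
of the tested expression is positive. -/
inductive Prog.Exec : Prog → Store → ℕ → Store → Prop
  | skip (σ : Store) : Prog.Exec .skip σ 1 σ
  | assign (σ : Store) (a : ℕ) (i j e : Expr) :
      Prog.Exec (.assign a i j e) σ
        (i.cost σ + j.cost σ + e.cost σ +
          (bitlen (i.eval σ) + bitlen (j.eval σ) + bitlen (e.eval σ)))
        (σ.write a (i.eval σ) (j.eval σ) (e.eval σ))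
  | seq {P Q : Prog} {σ τ υ : Store} {t u : ℕ} :
      Prog.Exec P σ t τ → Prog.Exec Q τ u υ → Prog.Exec (.seq P Q) σ (t + u) υ
  | branch_pos {e : Expr} {P Q : Prog} {σ τ : Store} {t : ℕ} :
      0 < e.eval σ → Prog.Exec P σ t τ → Prog.Exec (.branch e P Q) σ (e.cost σ + 1 + t) τ
  | branch_neg {e : Expr} {P Q : Prog} {σ τ : Store} {t : ℕ} :
      ¬ 0 < e.eval σ → Prog.Exec Q σ t τ → Prog.Exec (.branch e P Q) σ (e.cost σ + 1 + t) τ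
  | loop_stop {e : Expr} {P : Prog} {σ : Store} :
      ¬ 0 < e.eval σ → Prog.Exec (.loop e P) σ (e.cost σ + 1) σ
  | loop_step {e : Expr} {P : Prog} {σ τ υ : Store} {t u : ℕ} :
      0 < e.eval σ → Prog.Exec P σ t τ → Prog.Exec (.loop e P) τ u υ →
        Prog.Exec (.loop e P) σ (e.cost σ + 1 + t + u) υ

/-! ### Input and output -/

/-- The array that holds a matrix, with rows and columns numbered from `0`, and zeros elsewhere. -/
def matrixCells {n k : ℕ} (A : Matrix (Fin n) (Fin k) ℤ) (i j : ℤ) : ℤ :=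
  if h : (0 ≤ i ∧ i < n) ∧ (0 ≤ j ∧ j < k) then
    A ⟨i.toNat, by omega⟩ ⟨j.toNat, by omega⟩
  else 0

/-- The initial memory: array `0` holds `n`, arrays `1` to `4` hold `A`, `M`, `S`, `U`,
array `5` holds `h₁, …, hₙ` as a column, array `6` holds `p`; every other cell is zero. -/
def inputStore {n : ℕ} (A M S U : Matrix (Fin n) (Fin n) ℤ) (h : Fin n → ℤ) (p : ℕ) : Store
  | 0 => matrixCells (Matrix.of fun _ _ : Fin 1 => (n : ℤ))
  | 1 => matrixCells A
  | 2 => matrixCells M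
  | 3 => matrixCells S
  | 4 => matrixCells U
  | 5 => matrixCells (Matrix.of fun (i : Fin n) (_ : Fin 1) => h i)
  | 6 => matrixCells (Matrix.of fun _ _ : Fin 1 => (p : ℤ))
  | _ => fun _ _ => 0

/-- The output is the `n × n` matrix in array `7`. -/
def outputMatrix (n : ℕ) (σ : Store) : Matrix (Fin n) (Fin n) ℤ :=
  Matrix.of fun i j => σ 7 ((i : ℕ) : ℤ) ((j : ℕ) : ℤ)

/-- The logarithm of the cost bounds: base `2`, and at least `1`. -/
noncomputable def plog (x : ℝ) : ℝ := max 1 (Real.logb 2 x)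

/-! ### Bitlengths -/

/-! Put `F = M S⁻¹ U`. Since `H = Q A` and column `k` of `A M` vanishes modulo `s_k`, the matrix `H
M S⁻¹` is integral, and so is `H F`. On the other hand `F` agrees modulo 1 with `T / s`, where `T`
is the Howell form, and its pivots satisfy `H_jj T_jj = s` (`IsHowellForm.diag_mul_hermite`, a
counting argument). So modulo 1 the matrix `F` is upper triangular with diagonal entries `1 / H_jj`.
For `i < j`, entry `(i, j)` of `H F` says that `H_ii F_ij + ∑ H_im F_mj + H_ij / H_jj`, summed over
`i < m < j`, is an integer (`IsHowellTransform.relation`). As `0 ≤ H_ij < H_jj`, this determines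
`H_ij` from the entries to its left, and the program computes `H` column by column.

Only approximations of `F` modulo 1 are needed. Let `e_m` be the number of bits of residues modulo
`H_mm`; then `e_m + e_j + g` binary digits of `F_mj` suffice, with a number `g` of guard bits
logarithmic in the total length of the data (`Approx.recover`). A scalar product `∑ x_k z_k` modulo
1 is computed from the concatenated bits of the `x_k`: bit `t` of `x_k` selects the window of digits
of `z_k` that represents `2^t z_k` modulo 1 (`approx_windows`). A modulus 1 contributes no bits, so
the concatenation has length `O(log det S)` however large `n` is, and a scalar product with `L`
digits costs that length times `L` plus the address length.

The entries `F_ij = ∑ M_ik U_kj / s_k` come from the same device, with the quotients taken on the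
side of the index, `i` or `j`, whose length `e` is larger (`runs_stage`, `runs_fractions`). The
precision used is then proportional to the length of that one index plus the guard bits, and the sum
of all `e_r` is `O(log det S)`.

Let `X = O(log det S)` bound the total lengths, let `Q - 1` be the number of `r` with `H_rr ≠ 1`,
and let `W` bound the address lengths. The total cost is `O(n X² + n X Q W)` (`hermite_cost_le`),
and `Q W = O(n log log det S)`. The delicate part is a factor `log n` in `W`: either `n` is at most
the square of the logarithm of the determinant and `log n` is harmless, or `Q` is so small that `Q
log n = O(n)` (`mul_bitlen_le`). -/

theorem one_le_bitlen (a : ℤ) : 1 ≤ bitlen a := Nat.le_add_right 1 _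

@[simp] theorem bitlen_zero : bitlen 0 = 1 := by simp [bitlen]

@[simp] theorem bitlen_one : bitlen 1 = 1 := by simp [bitlen]

@[simp] theorem bitlen_two : bitlen 2 = 2 := by
  have : Nat.log 2 2 = 1 := by decide +kernel
  simp [bitlen, this]

theorem bitlen_le {a : ℤ} {b : ℕ} (hb : 1 ≤ b) (h : a.natAbs < 2 ^ b) : bitlen a ≤ b := by
  unfold bitlen
  have : Nat.log 2 a.natAbs < b := Nat.log_lt_of_lt_pow' (by omega) h
  omega

theorem bitlen_cast_le {x b : ℕ} (hb : 1 ≤ b) (h : x < 2 ^ b) : bitlen (x : ℤ) ≤ b :=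
  bitlen_le hb (by simpa using h)

theorem bitlen_cast_mono {x y : ℕ} (h : x ≤ y) : bitlen (x : ℤ) ≤ bitlen (y : ℤ) := by
  unfold bitlen
  have := Nat.log_mono_right (b := 2) h
  simpa using this

theorem lt_two_pow_bitlen (x : ℕ) : x < 2 ^ bitlen (x : ℤ) := by
  have := Nat.lt_pow_succ_log_self (b := 2) (by norm_num) x
  simpa [bitlen, add_comm] using this

/-! ### Running programs within a given number of bit operations -/

/-- Started on `σ`, the program halts after at most `c` bit operations on a memory with `Q`. -/
def Runs (P : Prog) (σ : Store) (c : ℕ) (Q : Store → Prop) : Prop :=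
  ∃ t τ, P.Exec σ t τ ∧ t ≤ c ∧ Q τ

theorem Runs.mono {P : Prog} {σ : Store} {c c' : ℕ} {Q Q' : Store → Prop} (h : Runs P σ c Q)
    (hc : c ≤ c') (hQ : ∀ τ, Q τ → Q' τ) : Runs P σ c' Q' := by
  obtain ⟨t, τ, h1, h2, h3⟩ := h
  exact ⟨t, τ, h1, h2.trans hc, hQ τ h3⟩

theorem Runs.skip {σ : Store} {c : ℕ} {Q : Store → Prop} (hc : 1 ≤ c) (h : Q σ) :
    Runs .skip σ c Q :=
  ⟨1, σ, .skip σ, hc, h⟩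

theorem Runs.assign {a : ℕ} {i j e : Expr} {σ : Store} {c : ℕ} {Q : Store → Prop}
    (hc : i.cost σ + j.cost σ + e.cost σ +
      (bitlen (i.eval σ) + bitlen (j.eval σ) + bitlen (e.eval σ)) ≤ c)
    (h : Q (σ.write a (i.eval σ) (j.eval σ) (e.eval σ))) :
    Runs (.assign a i j e) σ c Q :=
  ⟨_, _, .assign σ a i j e, hc, h⟩

theorem Runs.seq {P P' : Prog} {σ : Store} {c c' : ℕ} {Q Q' : Store → Prop}
    (h : Runs P σ c Q) (h' : ∀ τ, Q τ → Runs P' τ c' Q') : Runs (.seq P P') σ (c + c') Q' := by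
  obtain ⟨t, τ, h1, h2, h3⟩ := h
  obtain ⟨t', τ', h1', h2', h3'⟩ := h' τ h3
  exact ⟨t + t', τ', .seq h1 h1', Nat.add_le_add h2 h2', h3'⟩

theorem Runs.branch {e : Expr} {P P' : Prog} {σ : Store} {c d : ℕ} {Q : Store → Prop}
    (hc : e.cost σ + 1 ≤ c) (hpos : 0 < e.eval σ → Runs P σ d Q)
    (hneg : ¬ 0 < e.eval σ → Runs P' σ d Q) : Runs (.branch e P P') σ (c + d) Q := by
  by_cases h : 0 < e.eval σ
  · obtain ⟨t, τ, h1, h2, h3⟩ := hpos h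
    exact ⟨_, τ, .branch_pos h h1, Nat.add_le_add hc h2, h3⟩
  · obtain ⟨t, τ, h1, h2, h3⟩ := hneg h
    exact ⟨_, τ, .branch_neg h h1, Nat.add_le_add hc h2, h3⟩

/-- `f k` pays for the test and the body of round `k`, and `c0` for the final failing test. Costs
that vary from round to round are essential later, where they are summed over blocks of different
lengths. -/
theorem Runs.loop {e : Expr} {P : Prog} {I : ℕ → Store → Prop} {N c0 : ℕ} {f : ℕ → ℕ}
    (hstep : ∀ k < N, ∀ σ, I k σ → 0 < e.eval σ ∧
      ∃ c, e.cost σ + 1 + c ≤ f k ∧ Runs P σ c (I (k + 1)))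
    (hexit : ∀ σ, I N σ → ¬ 0 < e.eval σ ∧ e.cost σ + 1 ≤ c0)
    {σ : Store} (h0 : I 0 σ) :
    Runs (.loop e P) σ (∑ k ∈ Finset.range N, f k + c0) (I N) := by
  -- Here `m` counts the rounds still to come, so the execution is built from the last round
  -- backwards.
  have key : ∀ m ≤ N, ∀ σ, I (N - m) σ →
      Runs (.loop e P) σ (∑ k ∈ Finset.Ico (N - m) N, f k + c0) (I N) := by
    intro m
    induction m with
    | zero =>
      intro _ σ h
      obtain ⟨h1, h2⟩ := hexit σ h
      exact ⟨e.cost σ + 1, σ, by constructor; exact h1, by simpa using h2, h⟩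
    | succ m ih =>
      intro hm σ h
      obtain ⟨h1, c, h2, t, τ, h3, h4, h5⟩ := hstep (N - (m + 1)) (by omega) σ h
      rw [show N - (m + 1) + 1 = N - m by omega] at h5
      obtain ⟨u, υ, h6, h7, h8⟩ := ih (by omega) τ h5
      refine ⟨_, υ, .loop_step h1 h3 h6, ?_, h8⟩
      rw [Finset.sum_eq_sum_Ico_succ_bot (by omega), show N - (m + 1) + 1 = N - m by omega]
      omega
  have h := key N le_rfl σ (by rwa [Nat.sub_self])
  rwa [Nat.sub_self, ← Finset.range_eq_Ico] at h

/-! ### Memory -/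

@[simp] theorem Store.write_of_ne (σ : Store) {a b : ℕ} (h : b ≠ a) (i j v : ℤ) :
    σ.write a i j v b = σ b := by
  funext i' j'
  simp [Store.write, h]

theorem Store.write_same (σ : Store) (a : ℕ) (i j v i' j' : ℤ) :
    σ.write a i j v a i' j' = if i' = i ∧ j' = j then v else σ a i' j' := by
  simp [Store.write]

@[simp] theorem Store.write_self (σ : Store) (a : ℕ) (i j v : ℤ) :
    σ.write a i j v a i j = v := by
  simp [Store.write]

/-- The memories `σ` and `τ` agree outside the arrays in the list `m`. -/
def Agree (m : List ℕ) (σ τ : Store) : Prop := ∀ a, a ∉ m → τ a = σ a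

theorem Agree.refl (m : List ℕ) (σ : Store) : Agree m σ σ := fun _ _ => rfl

theorem Agree.write {m : List ℕ} {σ τ : Store} (h : Agree m σ τ) {a : ℕ} (ha : a ∈ m)
    (i j v : ℤ) : Agree m σ (τ.write a i j v) := by
  intro b hb
  rw [Store.write_of_ne _ (by rintro rfl; exact hb ha), h b hb]

theorem Agree.trans {m m' : List ℕ} {σ τ υ : Store} (h : Agree m σ τ) (h' : Agree m' τ υ)
    (hm : ∀ a ∈ m', a ∈ m) : Agree m σ υ := by
  intro b hb
  rw [h' b (fun hb' => hb (hm b hb')), h b hb]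

/-- An array used as a single register. -/
abbrev Expr.reg (a : ℕ) : Expr := .cell a (.const 0) (.const 0)

/-- `for v = 0, …, b - 1 do P`, with the registers `v` and `b`. -/
def Prog.forTo (v b : ℕ) (P : Prog) : Prog :=
  .seq (.assign v (.const 0) (.const 0) (.const 0))
    (.loop (.sub (.reg b) (.reg v))
      (.seq P (.assign v (.const 0) (.const 0) (.add (.reg v) (.const 1)))))

/-- The invariant has to be insensitive to writes into the counter (`hw`), and the body has to
preserve the counter. As `W` bounds the bitlength of `N`, hence of every counter value, the
bookkeeping costs a constant multiple of `W` per round. -/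
theorem Runs.forTo {v b N W : ℕ} {P : Prog} {I : ℕ → Store → Prop} {f : ℕ → ℕ}
    (hw : ∀ k σ x, I k σ → I k (σ.write v 0 0 x))
    (hb : ∀ k σ, I k σ → σ b 0 0 = (N : ℤ)) (hN : bitlen (N : ℤ) ≤ W)
    (hbody : ∀ k < N, ∀ σ, I k σ → σ v 0 0 = (k : ℤ) →
      Runs P σ (f k) (fun τ => I (k + 1) τ ∧ τ v 0 0 = (k : ℤ)))
    {σ : Store} (h0 : I 0 σ) :
    Runs (.forTo v b P) σ (∑ k ∈ Finset.range N, (f k + 30 * W) + 30 * W) (I N) := by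
  have hW : 1 ≤ W := (one_le_bitlen _).trans hN
  have hkW : ∀ k ≤ N, bitlen (k : ℤ) ≤ W := fun k hk => (bitlen_cast_mono hk).trans hN
  have key : Runs (.forTo v b P) σ
      (6 + (∑ k ∈ Finset.range N, (f k + 30 * W) + 20 * W))
      (fun τ => I N τ ∧ τ v 0 0 = ((N : ℕ) : ℤ)) := by
    refine Runs.seq (Q := fun τ => I 0 τ ∧ τ v 0 0 = ((0 : ℕ) : ℤ))
      (Runs.assign (by simp [Expr.cost, Expr.eval]) ?_) ?_
    · simpa [Expr.eval] using hw 0 σ 0 h0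
    · intro τ hτ
      refine Runs.loop (I := fun k τ => I k τ ∧ τ v 0 0 = (k : ℤ)) ?_ ?_ hτ
      · rintro k hk σ ⟨h1, h2⟩
        have hb' := hb k σ h1
        have e1 := hkW k hk.le
        have e2 := hkW (k + 1) hk
        push_cast at e2
        refine ⟨by simp [Expr.eval, h2, hb']; omega, f k + (10 + 3 * W), ?_, ?_⟩
        · simp only [Expr.cost, Expr.eval, h2, hb', bitlen_zero]
          omega
        · refine Runs.seq (hbody k hk σ h1 h2) ?_
          rintro τ ⟨h3, h4⟩
          refine Runs.assign ?_ ⟨?_, ?_⟩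
          · simp only [Expr.cost, Expr.eval, h4, bitlen_zero, bitlen_one]
            omega
          · exact hw _ _ _ h3
          · simp [Expr.eval, h4]
      · rintro σ ⟨h1, h2⟩
        have hb' := hb N σ h1
        refine ⟨by simp [Expr.eval, h2, hb'], ?_⟩
        simp only [Expr.cost, Expr.eval, h2, hb', bitlen_zero]
        omega
  exact key.mono (by omega) (fun τ h => h.1)

/-! ### The Howell form determines the diagonal of the inverse of the Hermite form -/

section Howell

variable {n : ℕ} {A S M T H : Matrix (Fin n) (Fin n) ℤ}

theorem IsSmithForm.lastInvariant_pos (hS : IsSmithForm A S) : 0 < lastInvariant S := by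
  unfold lastInvariant
  split_ifs
  · exact hS.diag_pos _
  · exact one_pos

theorem IsSmithForm.dvd_lastInvariant (hS : IsSmithForm A S) (i : Fin n) :
    S i i ∣ lastInvariant S := by
  have hn : 0 < n := i.pos
  unfold lastInvariant
  rw [dif_pos hn]
  exact hS.diag_dvd _ _ (by rw [Fin.le_def]; have := i.isLt; simp only; omega)

theorem IsSmithForm.natAbs_det (hS : IsSmithForm A S) : A.det.natAbs = S.det.natAbs := by
  obtain ⟨V, W, hV, hW, h⟩ := hS.equiv
  have := congrArg (fun X => X.det.natAbs) h
  simpa [Matrix.det_mul, Int.natAbs_mul, Int.isUnit_iff_natAbs_eq.1 hV,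
    Int.isUnit_iff_natAbs_eq.1 hW] using this

theorem IsSmithForm.det_eq (hS : IsSmithForm A S) : S.det = ∏ i, S i i := by
  have : S = Matrix.diagonal fun i => S i i := by
    ext i j
    by_cases h : i = j
    · subst h; simp
    · simp [h, hS.diagonal i j h]
  rw [this, Matrix.det_diagonal]
  simp

theorem IsHermiteForm.natAbs_det (hH : IsHermiteForm A H) : H.det.natAbs = A.det.natAbs := by
  obtain ⟨Q, hQ, rfl⟩ := hH.equiv
  simp [Matrix.det_mul, Int.natAbs_mul, Int.isUnit_iff_natAbs_eq.1 hQ]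

theorem IsHermiteForm.det_eq (hH : IsHermiteForm A H) : H.det = ∏ i, H i i :=
  Matrix.det_of_isUpperTriangular (fun i j h => hH.upper i j h)

theorem IsHermiteForm.prod_diag (hH : IsHermiteForm A H) (hS : IsSmithForm A S) :
    ∏ i, H i i = ∏ i, S i i := by
  have h1 : 0 < ∏ i, H i i := Finset.prod_pos fun i _ => hH.diag_pos i
  have h2 : 0 < ∏ i, S i i := Finset.prod_pos fun i _ => hS.diag_pos i
  have h3 := hH.natAbs_det.trans hS.natAbs_det
  rw [hH.det_eq, hS.det_eq] at h3
  omega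

/-- `H M = Q (A M)`, and multiplication from the left preserves congruences taken column by column.
-/
theorem IsHermiteForm.dvd_mul_massager (hH : IsHermiteForm A H)
    (hM : IsReducedSmithMassager A S M) (i k : Fin n) : S k k ∣ (H * M) i k := by
  obtain ⟨Q, -, rfl⟩ := hH.equiv
  rw [Matrix.mul_assoc, Matrix.mul_apply]
  exact Finset.dvd_sum fun j _ => (hM.annihilates j k).mul_left _

theorem mul_smithDual_apply (B : Matrix (Fin n) (Fin n) ℤ) (i k : Fin n) :
    (B * smithDual S) i k = B i k * (lastInvariant S / S k k) := by
  simp [smithDual, Matrix.mul_diagonal]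

theorem IsHermiteForm.dvd_mul_massager_dual (hH : IsHermiteForm A H) (hS : IsSmithForm A S)
    (hM : IsReducedSmithMassager A S M) (i k : Fin n) :
    lastInvariant S ∣ (H * (M * smithDual S)) i k := by
  rw [← Matrix.mul_assoc, mul_smithDual_apply]
  obtain ⟨c, hc⟩ := hS.dvd_lastInvariant k
  rw [hc, Int.mul_ediv_cancel_left _ (hS.diag_pos k).ne', mul_comm (S k k)]
  rw [mul_comm c]
  exact mul_dvd_mul_right (hH.dvd_mul_massager hM i k) c

/-- `T` is `M S*` times a matrix modulo `s`, so `H T` vanishes modulo `s`; as `H` and `T` are upper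
triangular, the diagonal of `H T` is the product of their diagonals. -/
theorem IsHermiteForm.dvd_diag_mul_howell (hH : IsHermiteForm A H) (hS : IsSmithForm A S)
    (hM : IsReducedSmithMassager A S M)
    (hT : IsHowellForm (lastInvariant S).natAbs (M * smithDual S) T) (j : Fin n) :
    lastInvariant S ∣ H j j * T j j := by
  obtain ⟨V, -, hV⟩ := hT.equiv
  have h0 : (H.map (Int.cast : ℤ → ZMod (lastInvariant S).natAbs)) *
      (M * smithDual S).map (Int.cast : ℤ → ZMod (lastInvariant S).natAbs) = 0 := by
    ext i k
    have h1 := hH.dvd_mul_massager_dual hS hM i k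
    have h2 := (Matrix.map_mul (L := H) (M := M * smithDual S)
      (f := Int.castRingHom (ZMod (lastInvariant S).natAbs)))
    have h3 := congrFun (congrFun h2 i) k
    simp only [Matrix.map_apply, Int.coe_castRingHom] at h3
    rw [← h3, Matrix.zero_apply, ZMod.intCast_zmod_eq_zero_iff_dvd]
    simpa using h1
  have h1 : (H * T).map (Int.cast : ℤ → ZMod (lastInvariant S).natAbs) = 0 := by
    have h2 := (Matrix.map_mul (L := H) (M := T)
      (f := Int.castRingHom (ZMod (lastInvariant S).natAbs)))
    simp only [Int.coe_castRingHom] at h2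
    rw [h2, hV, ← Matrix.mul_assoc, h0, Matrix.zero_mul]
  have h2 := congrFun (congrFun h1 j) j
  rw [Matrix.map_apply, Matrix.zero_apply, ZMod.intCast_zmod_eq_zero_iff_dvd] at h2
  have h3 : (H * T) j j = H j j * T j j := by
    rw [Matrix.mul_apply]
    refine Finset.sum_eq_single j (fun k _ hk => ?_) (by simp)
    rcases lt_or_gt_of_ne hk with h | h
    · rw [hH.upper _ _ h, zero_mul]
    · rw [hT.upper _ _ h, mul_zero]
  rw [h3] at h2
  simpa using h2

/-- Every vector in the column span of a Howell form is a combination of its columns, with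
the coefficient of column `j` in `[0, m / T j j)`. -/
theorem IsHowellForm.exists_coeff {m : ℕ} (hm : 0 < m) {B T : Matrix (Fin n) (Fin n) ℤ}
    (hT : IsHowellForm m B T) (l : ℕ) (hl : l ≤ n) (v w : Fin n → ZMod m)
    (hw : w = (B.map (Int.cast : ℤ → ZMod m)).mulVec v)
    (h0 : ∀ i : Fin n, l ≤ (i : ℕ) → w i = 0) :
    ∃ c : (j : Fin n) → Fin (m / (T j j).natAbs), (∀ j : Fin n, l ≤ (j : ℕ) → (c j : ℕ) = 0) ∧
      w = fun i => ∑ j, ((c j : ℕ) : ZMod m) * (T i j : ZMod m) := by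
  have : NeZero m := ⟨hm.ne'⟩
  have hd : ∀ j, 0 < m / (T j j).natAbs := fun j =>
    Nat.div_pos (Nat.le_of_dvd hm (Int.natAbs_dvd_natAbs.2 (hT.diag_dvd j)))
      (Int.natAbs_pos.2 (hT.diag_pos j).ne')
  induction l generalizing v w with
  | zero =>
    refine ⟨fun j => ⟨0, hd j⟩, fun _ _ => rfl, ?_⟩
    funext i
    simp [h0 i (Nat.zero_le _)]
  | succ l ih =>
    let j : Fin n := ⟨l, hl⟩
    obtain ⟨V, -, hV⟩ := hT.equiv
    have hspan := (hT.howell (n - (l + 1)) (by omega) w).1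
      ⟨⟨v, hw⟩, fun i hi => h0 i (by omega)⟩
    -- By the Howell property `w` is a combination of columns of `T` that vanish below row `l`. None
    -- of them has index beyond `l`, since integer pivots are positive even when they are zero
    -- modulo `m`. In row `l` only column `l` contributes.
    have hcoef : ∃ a : ZMod m, w j = a * (T j j : ZMod m) := by
      refine Submodule.span_induction (p := fun x _ => ∃ a : ZMod m, x j = a * (T j j : ZMod m))
        ?_ ⟨0, by simp⟩ ?_ ?_ hspan
      · rintro x ⟨j', hj', rfl⟩
        have : j' ≤ j := by
          by_contra hlt
          have h1 : l < (j' : ℕ) := by simpa [j, Fin.lt_def] using hlt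
          exact (hT.diag_pos j').ne' (hj' j' (by omega))
        rcases this.eq_or_lt with rfl | hlt
        · exact ⟨1, by simp⟩
        · exact ⟨0, by simp [hT.upper _ _ hlt]⟩
      · rintro x y _ _ ⟨a, ha⟩ ⟨b, hb⟩
        exact ⟨a + b, by simp [ha, hb, add_mul]⟩
      · rintro a x _ ⟨b, hb⟩
        exact ⟨a * b, by simp [hb, mul_assoc]⟩
    obtain ⟨a, ha⟩ := hcoef
    set d := m / (T j j).natAbs with hdj
    have hdT : (d : ZMod m) * (T j j : ZMod m) = 0 := by
      have h1 : d * (T j j).natAbs = m :=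
        Nat.div_mul_cancel (Int.natAbs_dvd_natAbs.2 (hT.diag_dvd j))
      have h2 : (d : ℤ) * T j j = (m : ℤ) := by
        have h3 : ((T j j).natAbs : ℤ) = T j j := Int.natAbs_of_nonneg (hT.diag_pos j).le
        rw [← h3]
        exact_mod_cast h1
      have h4 := congrArg (Int.cast : ℤ → ZMod m) h2
      simpa using h4
    -- The coefficient matters only modulo `d = m / T j j`, because `d` times the pivot vanishes
    -- modulo `m`. This is what bounds the number of combinations.
    have hc : ((a.val % d : ℕ) : ZMod m) * (T j j : ZMod m) = w j := by
      have h1 : ((d * (a.val / d) + a.val % d : ℕ) : ZMod m) = a := by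
        rw [Nat.div_add_mod, ZMod.natCast_zmod_val]
      rw [ha]
      refine Eq.trans ?_ (congrArg (· * (T j j : ZMod m)) h1)
      push_cast
      rw [add_mul, mul_right_comm, hdT]
      simp
    set b : ZMod m := ((a.val % d : ℕ) : ZMod m) with hb
    -- Subtracting `b` times column `j` of `T` stays in the column span of `B` and clears row `l`,
    -- so the induction hypothesis applies.
    obtain ⟨c, hc0, hc'⟩ := ih (by omega) (v - fun k => b * V k j)
      (fun i => w i - b * (T i j : ZMod m)) (by
        rw [Matrix.mulVec_sub, ← hw]
        funext i
        have h1 := congrFun (congrFun hV i) j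
        rw [Matrix.map_apply, Matrix.mul_apply] at h1
        simp only [Pi.sub_apply, h1, Matrix.mulVec, dotProduct, Finset.mul_sum]
        congr 1
        exact Finset.sum_congr rfl fun k _ => by ring) (by
        intro i hi
        rcases Nat.lt_or_ge l i with h | h
        · simp [h0 i h, hT.upper i j (by simpa [j, Fin.lt_def] using h)]
        · have : i = j := Fin.ext (le_antisymm h hi)
          rw [this, hc, sub_self])
    refine ⟨Function.update c j ⟨a.val % d, Nat.mod_lt _ (hd j)⟩, fun k hk => ?_, ?_⟩
    · rw [Function.update_of_ne (by rintro rfl; simp [j] at hk)]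
      exact hc0 k (by omega)
    · funext i
      have h1 : w i - b * (T i j : ZMod m) =
        ∑ k, ((c k : ℕ) : ZMod m) * (T i k : ZMod m) := congrFun hc' i
      rw [sub_eq_iff_eq_add] at h1
      have h2 : ∀ k ∈ Finset.univ.erase j, ((c k : ℕ) : ZMod m) * (T i k : ZMod m) =
          ((Function.update c j ⟨a.val % d, Nat.mod_lt _ (hd j)⟩ k : ℕ) : ZMod m) *
            (T i k : ZMod m) := by
        intro k hk
        rw [Function.update_of_ne (Finset.ne_of_mem_erase hk)]
      rw [h1, ← Finset.add_sum_erase _ _ (Finset.mem_univ j),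
        ← Finset.add_sum_erase _ _ (Finset.mem_univ j), hc0 j le_rfl, Function.update_self,
        Finset.sum_congr rfl h2]
      simp [hb, add_comm]

/-- Counting vectors modulo `s`: the products `M S* x` with `0 ≤ x_k < s_k` are pairwise distinct,
and all are combinations of the columns of `T` with coefficients in `[0, s / T_jj)`. Hence `∏ s_k ≤
∏ s / T_jj`. Conversely `s / T_jj` divides `H_jj`, and `∏ H_jj = ∏ s_k`, so every inequality is an
equality. -/
theorem IsHowellForm.diag_mul_hermite (hA : IsSmithForm A S) (hM : IsReducedSmithMassager A S M)
    (hH : IsHermiteForm A H)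
    (hT : IsHowellForm (lastInvariant S).natAbs (M * smithDual S) T) (j : Fin n) :
    H j j * T j j = lastInvariant S := by
  classical
  set s := lastInvariant S with hs
  have hspos : 0 < s := hA.lastInvariant_pos
  have hm : 0 < s.natAbs := Int.natAbs_pos.2 hspos.ne'
  have hsabs : (s.natAbs : ℤ) = s := Int.natAbs_of_nonneg hspos.le
  have hle : ∏ k, (S k k).natAbs ≤ ∏ j, s.natAbs / (T j j).natAbs := by
    let f : ((k : Fin n) → Fin (S k k).natAbs) → Fin n → ZMod s.natAbs := fun x =>
      ((M * smithDual S).map (Int.cast : ℤ → ZMod s.natAbs)).mulVec fun k => ((x k : ℕ) : ZMod _)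
    have hf : ∀ x, ∃ c : (j : Fin n) → Fin (s.natAbs / (T j j).natAbs),
        f x = fun i => ∑ j, ((c j : ℕ) : ZMod s.natAbs) * (T i j : ZMod s.natAbs) := by
      intro x
      obtain ⟨c, -, hc⟩ := hT.exists_coeff hm n le_rfl _ (f x) rfl
        (fun i hi => absurd i.isLt (by omega))
      exact ⟨c, hc⟩
    choose φ hφ using hf
    have hinj : Function.Injective φ := by
      intro x y hxy
      have hfxy : f x = f y := by rw [hφ x, hφ y, hxy]
      obtain ⟨W, hW⟩ := hM.left_inverse
      have h1 : ∀ i, s ∣ ∑ k, (M * smithDual S) i k * ((x k : ℤ) - (y k : ℤ)) := by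
        intro i
        have h2 := congrFun hfxy i
        rw [← sub_eq_zero] at h2
        rw [← hsabs, ← ZMod.intCast_zmod_eq_zero_iff_dvd, ← h2]
        simp [f, Matrix.mulVec, dotProduct, mul_sub]
      funext i
      -- Injectivity comes from the left inverse `W`: modulo `s` the product `W M S*` is `S*`,
      -- because column `k` of `W M - 1` is a multiple of `s_k` and `s_k (s / s_k) = s`. Cancelling
      -- `s / s_i` leaves `s_i ∣ x_i - y_i`.
      have h3 : s ∣ ∑ l, W i l * ∑ k, (M * smithDual S) l k * ((x k : ℤ) - (y k : ℤ)) :=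
        Finset.dvd_sum fun l _ => (h1 l).mul_left _
      have h4 : ∑ l, W i l * ∑ k, (M * smithDual S) l k * ((x k : ℤ) - (y k : ℤ)) =
          ∑ k, (W * M) i k * (s / S k k) * ((x k : ℤ) - (y k : ℤ)) := by
        simp only [mul_smithDual_apply]
        simp only [Finset.mul_sum, Matrix.mul_apply, Finset.sum_mul]
        rw [Finset.sum_comm]
        refine Finset.sum_congr rfl fun k _ => Finset.sum_congr rfl fun l _ => ?_
        ring
      have h5 : s ∣ ∑ k, (W * M - 1) i k * (s / S k k) * ((x k : ℤ) - (y k : ℤ)) := by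
        refine Finset.dvd_sum fun k _ => Dvd.dvd.mul_right ?_ _
        obtain ⟨c, hc⟩ := hW i k
        rw [hc, mul_right_comm, Int.mul_ediv_cancel' (hA.dvd_lastInvariant k)]
        exact dvd_mul_right _ _
      rw [h4] at h3
      have h6 := dvd_sub h3 h5
      rw [← Finset.sum_sub_distrib] at h6
      rw [Finset.sum_congr rfl (g := fun k => (1 : Matrix (Fin n) (Fin n) ℤ) i k * (s / S k k) *
        ((x k : ℤ) - (y k : ℤ))) (fun k _ => by rw [Matrix.sub_apply]; ring),
        Finset.sum_eq_single i (fun k _ hk => by rw [Matrix.one_apply_ne hk.symm]; ring)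
        (by simp), Matrix.one_apply_eq, one_mul] at h6
      obtain ⟨c, hc⟩ := hA.dvd_lastInvariant i
      have hcpos : c ≠ 0 := by
        rintro rfl
        rw [mul_zero] at hc
        exact hspos.ne' hc
      rw [← hs] at hc
      rw [hc, Int.mul_ediv_cancel_left _ (hA.diag_pos i).ne', mul_comm (S i i)] at h6
      have h7 : S i i ∣ (x i : ℤ) - (y i : ℤ) := (mul_dvd_mul_iff_left hcpos).1 h6
      have hx := (x i).isLt
      have hy := (y i).isLt
      have h8 : ((x i : ℕ) : ℤ) - (y i : ℤ) = 0 := by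
        refine Int.eq_zero_of_abs_lt_dvd h7 ?_
        have := hA.diag_pos i
        rw [abs_lt]
        omega
      exact Fin.ext (by omega)
    have := Fintype.card_le_of_injective φ hinj
    simpa [Fintype.card_pi] using this
  have hd : ∀ j, ((s.natAbs / (T j j).natAbs : ℕ) : ℤ) * T j j = s := by
    intro j
    have h1 := Nat.div_mul_cancel (Int.natAbs_dvd_natAbs.2 (hsabs ▸ hT.diag_dvd j))
    have h2 : ((T j j).natAbs : ℤ) = T j j := Int.natAbs_of_nonneg (hT.diag_pos j).le
    rw [← h2, ← hsabs]
    simpa using congrArg (Nat.cast : ℕ → ℤ) h1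
  have hdle : ∀ j, ((s.natAbs / (T j j).natAbs : ℕ) : ℤ) ≤ H j j := by
    intro j
    refine Int.le_of_dvd (hH.diag_pos j) ?_
    have h1 := hH.dvd_diag_mul_howell hA hM hT j
    rw [← hs] at h1
    rw [← hd j] at h1
    exact (mul_dvd_mul_iff_right (hT.diag_pos j).ne').1 (by simpa [hd j] using h1)
  -- A single strict inequality would push the product of the `s / T_jj` below `∏ s_k`, against
  -- `hle`.
  have heq : ((s.natAbs / (T j j).natAbs : ℕ) : ℤ) = H j j := by
    by_contra hne
    have hlt : ∏ j, ((s.natAbs / (T j j).natAbs : ℕ) : ℤ) < ∏ j, H j j := by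
      refine Finset.prod_lt_prod (fun i _ => ?_) (fun i _ => hdle i)
        ⟨j, Finset.mem_univ _, lt_of_le_of_ne (hdle j) hne⟩
      have h1 := hd i
      have h2 := hT.diag_pos i
      refine lt_of_le_of_ne (Nat.cast_nonneg _) fun h3 => ?_
      rw [← h3, zero_mul] at h1
      exact hspos.ne h1
    rw [hH.prod_diag hA] at hlt
    have h9 : (∏ k, S k k) = ((∏ k, (S k k).natAbs : ℕ) : ℤ) := by
      push_cast
      exact Finset.prod_congr rfl fun k _ => (abs_of_pos (hA.diag_pos k)).symm
    rw [h9] at hlt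
    have h10 : ((∏ j, s.natAbs / (T j j).natAbs : ℕ) : ℤ) < ((∏ k, (S k k).natAbs : ℕ) : ℤ) := by
      rw [Nat.cast_prod]
      exact hlt
    omega
  rw [← heq, hd j]

/-- The product `M S⁻¹ U`, in which `M` and `U` are a Smith massager and a Howell transform. -/
def massagerFraction (S M U : Matrix (Fin n) (Fin n) ℤ) (i j : Fin n) : ℚ :=
  ∑ k, (M i k : ℚ) * U k j / S k k

theorem massagerFraction_eq (hA : IsSmithForm A S) (U : Matrix (Fin n) (Fin n) ℤ) (i j : Fin n) :
    massagerFraction S M U i j = ((M * smithDual S * U) i j : ℚ) / lastInvariant S := by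
  unfold massagerFraction
  rw [Matrix.mul_apply, Int.cast_sum, Finset.sum_div]
  refine Finset.sum_congr rfl fun k _ => ?_
  rw [mul_smithDual_apply]
  obtain ⟨c, hc⟩ := hA.dvd_lastInvariant k
  have h1 : (S k k : ℚ) ≠ 0 := by exact_mod_cast (hA.diag_pos k).ne'
  have h2 : (c : ℚ) ≠ 0 := by
    rintro h
    have : c = 0 := by exact_mod_cast h
    rw [this, mul_zero] at hc
    exact hA.lastInvariant_pos.ne' hc
  rw [hc, Int.mul_ediv_cancel_left _ (hA.diag_pos k).ne']
  push_cast
  field_simp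

/-- This is entry `(i, j)` of the integral matrix `H F`, read modulo 1. The terms `m < i` vanish as
`H` is triangular, the terms `m > j` are integers as `T` is triangular, and `m = j` contributes
`H_ij / H_jj` by the pivot identity. -/
theorem IsHowellTransform.relation (hA : IsSmithForm A S) (hM : IsReducedSmithMassager A S M)
    {U : Matrix (Fin n) (Fin n) ℤ} (hU : IsHowellTransform S M U) (hH : IsHermiteForm A H)
    {i j : Fin n} (hij : i < j) :
    ∃ z : ℤ, (H i i : ℚ) * massagerFraction S M U i j +
      (∑ m, (if i < m ∧ m < j then (H i m : ℚ) else 0) * massagerFraction S M U m j) +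
      (H i j : ℚ) / H j j = z := by
  obtain ⟨T, hT, hTU⟩ := hU.howell
  have hs0 : (lastInvariant S : ℚ) ≠ 0 := by exact_mod_cast hA.lastInvariant_pos.ne'
  have hfrac : ∀ m, ∃ z : ℤ, massagerFraction S M U m j = (T m j : ℚ) / lastInvariant S + z := by
    intro m
    obtain ⟨c, hc⟩ := (Int.modEq_iff_dvd.1 (hTU m j))
    refine ⟨c, ?_⟩
    rw [massagerFraction_eq hA, eq_add_of_sub_eq hc]
    push_cast
    field_simp
    ring
  have hlow : ∀ m, j < m → ∃ z : ℤ, massagerFraction S M U m j = z := by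
    intro m hm
    obtain ⟨z, hz⟩ := hfrac m
    exact ⟨z, by rw [hz, hT.upper m j hm]; simp⟩
  have hdiag : ∃ z : ℤ, massagerFraction S M U j j = 1 / (H j j : ℚ) + z := by
    obtain ⟨z, hz⟩ := hfrac j
    refine ⟨z, ?_⟩
    rw [hz, ← IsHowellForm.diag_mul_hermite hA hM hH hT j]
    have h1 : (H j j : ℚ) ≠ 0 := by exact_mod_cast (hH.diag_pos j).ne'
    have h2 : (T j j : ℚ) ≠ 0 := by exact_mod_cast (hT.diag_pos j).ne'
    push_cast
    field_simp
  have htot : ∃ z : ℤ, ∑ m, (H i m : ℚ) * massagerFraction S M U m j = z := by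
    have h1 : ∀ k, ∃ z : ℤ, ((H * M) i k : ℚ) * U k j / S k k = z := by
      intro k
      obtain ⟨c, hc⟩ := hH.dvd_mul_massager hM i k
      have h1 : (S k k : ℚ) ≠ 0 := by exact_mod_cast (hA.diag_pos k).ne'
      refine ⟨c * U k j, ?_⟩
      rw [hc]
      push_cast
      field_simp
    choose z hz using h1
    refine ⟨∑ k, z k, ?_⟩
    push_cast
    rw [Finset.sum_congr rfl fun k _ => (hz k).symm]
    simp only [massagerFraction, Matrix.mul_apply, Finset.mul_sum, Int.cast_sum, Int.cast_mul,
      Finset.sum_mul, Finset.sum_div]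
    rw [Finset.sum_comm]
    exact Finset.sum_congr rfl fun k _ => Finset.sum_congr rfl fun l _ => by ring
  have hcorr : ∀ m, ∃ z : ℤ, (H i m : ℚ) * massagerFraction S M U m j =
      (if i = m then (H i i : ℚ) * massagerFraction S M U i j else 0) +
      (if i < m ∧ m < j then (H i m : ℚ) else 0) * massagerFraction S M U m j +
      (if m = j then (H i j : ℚ) / H j j else 0) + z := by
    intro m
    rcases lt_trichotomy m i with h | rfl | h
    · refine ⟨0, ?_⟩
      rw [hH.upper i m h]
      simp [h.ne', (h.trans hij).ne]
    · exact ⟨0, by simp [hij.ne]⟩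
    · rcases lt_trichotomy m j with h' | rfl | h'
      · exact ⟨0, by simp [h, h', h.ne, h'.ne]⟩
      · obtain ⟨z, hz⟩ := hdiag
        refine ⟨H i m * z, ?_⟩
        rw [hz]
        simp [h.ne]
        ring
      · obtain ⟨z, hz⟩ := hlow m h'
        refine ⟨H i m * z, ?_⟩
        rw [hz]
        simp [h.ne, h'.ne', h'.le]
  choose z hz using hcorr
  obtain ⟨y, hy⟩ := htot
  refine ⟨y - ∑ m, z m, ?_⟩
  rw [Finset.sum_congr rfl fun m _ => hz m] at hy
  simp only [Finset.sum_add_distrib, Finset.sum_ite_eq, Finset.sum_ite_eq', Finset.mem_univ,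
    if_true] at hy
  push_cast
  rw [← hy]
  ring

end Howell

/-! ### Concatenated bit strings -/

/-- The position of the first bit of the `k`-th block, for blocks of lengths `ℓ 0, ℓ 1, …`. -/
def bitOff (ℓ : ℕ → ℕ) (k : ℕ) : ℕ := ∑ i ∈ Finset.range k, ℓ i

/-- The block among the first `n` that contains position `p`. -/
def bitOwner (ℓ : ℕ → ℕ) (n p : ℕ) : ℕ := ((Finset.range n).filter fun k => bitOff ℓ (k + 1) ≤ p).card

theorem bitOff_succ (ℓ : ℕ → ℕ) (k : ℕ) : bitOff ℓ (k + 1) = bitOff ℓ k + ℓ k :=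
  Finset.sum_range_succ _ _

@[simp] theorem bitOff_zero (ℓ : ℕ → ℕ) : bitOff ℓ 0 = 0 := rfl

theorem bitOff_mono (ℓ : ℕ → ℕ) : Monotone (bitOff ℓ) :=
  monotone_nat_of_le_succ fun k => by rw [bitOff_succ]; omega

/-- The blocks that end at or before this position are exactly the ones preceding `k`; empty blocks
own no position. -/
theorem bitOwner_add (ℓ : ℕ → ℕ) {n k t : ℕ} (hk : k < n) (ht : t < ℓ k) :
    bitOwner ℓ n (bitOff ℓ k + t) = k := by
  have : (Finset.range n).filter (fun i => bitOff ℓ (i + 1) ≤ bitOff ℓ k + t) =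
      Finset.range k := by
    ext i
    simp only [Finset.mem_filter, Finset.mem_range]
    constructor
    · rintro ⟨-, h⟩
      by_contra hik
      have := bitOff_mono ℓ (show k + 1 ≤ i + 1 by omega)
      rw [bitOff_succ ℓ k] at this
      omega
    · intro h
      have := bitOff_mono ℓ (show i + 1 ≤ k by omega)
      exact ⟨by omega, by omega⟩
  rw [bitOwner, this, Finset.card_range]

theorem exists_of_lt_bitOff (ℓ : ℕ → ℕ) {n p : ℕ} (hp : p < bitOff ℓ n) :
    ∃ k < n, ∃ t < ℓ k, p = bitOff ℓ k + t := by
  induction n with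
  | zero => simp at hp
  | succ n ih =>
    by_cases h : p < bitOff ℓ n
    · obtain ⟨k, hk, h'⟩ := ih h
      exact ⟨k, by omega, h'⟩
    · rw [bitOff_succ] at hp
      exact ⟨n, by omega, p - bitOff ℓ n, by omega, by omega⟩

theorem bitOwner_spec (ℓ : ℕ → ℕ) {n p : ℕ} (hp : p < bitOff ℓ n) :
    bitOwner ℓ n p < n ∧ bitOff ℓ (bitOwner ℓ n p) ≤ p ∧
      p < bitOff ℓ (bitOwner ℓ n p) + ℓ (bitOwner ℓ n p) := by
  obtain ⟨k, hk, t, ht, rfl⟩ := exists_of_lt_bitOff ℓ hp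
  rw [bitOwner_add ℓ hk ht]
  omega

theorem sum_range_bitOff {α : Type*} [AddCommMonoid α] (ℓ : ℕ → ℕ) (f : ℕ → α) (n : ℕ) :
    ∑ p ∈ Finset.range (bitOff ℓ n), f p =
      ∑ k ∈ Finset.range n, ∑ t ∈ Finset.range (ℓ k), f (bitOff ℓ k + t) := by
  induction n with
  | zero => simp
  | succ n ih => rw [bitOff_succ, Finset.sum_range_add, ih, Finset.sum_range_succ]

theorem sum_bits {x l : ℕ} (hx : x < 2 ^ l) :
    ∑ t ∈ Finset.range l, (x / 2 ^ t % 2) * 2 ^ t = x := by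
  induction l generalizing x with
  | zero => simp at hx; simp [hx]
  | succ l ih =>
    rw [Finset.sum_range_succ']
    have h1 := ih (x := x / 2) (by rw [pow_succ] at hx; omega)
    have h2 : ∑ t ∈ Finset.range l, (x / 2 ^ (t + 1) % 2) * 2 ^ (t + 1) =
        2 * ∑ t ∈ Finset.range l, (x / 2 / 2 ^ t % 2) * 2 ^ t := by
      rw [Finset.mul_sum]
      refine Finset.sum_congr rfl fun t _ => ?_
      rw [Nat.div_div_eq_div_mul, pow_succ']
      ring
    rw [h2, h1]
    omega

/-- The bit at position `p` of the concatenation of the binary expansions of `x 0, x 1, …`. -/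
def bitAt (ℓ : ℕ → ℕ) (n : ℕ) (x : ℕ → ℕ) (p : ℕ) : ℕ :=
  x (bitOwner ℓ n p) / 2 ^ (p - bitOff ℓ (bitOwner ℓ n p)) % 2

/-- The window of `L` binary digits at position `p` of the expansions `v k / 2 ^ (L + ℓ k)`. -/
def windowAt (ℓ : ℕ → ℕ) (n : ℕ) (v : ℕ → ℕ) (L p : ℕ) : ℕ :=
  v (bitOwner ℓ n p) /
    2 ^ (ℓ (bitOwner ℓ n p) - (p - bitOff ℓ (bitOwner ℓ n p))) % 2 ^ L

theorem bitAt_le (ℓ : ℕ → ℕ) (n : ℕ) (x : ℕ → ℕ) (p : ℕ) : bitAt ℓ n x p ≤ 1 := by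
  unfold bitAt; omega

theorem windowAt_lt (ℓ : ℕ → ℕ) (n : ℕ) (v : ℕ → ℕ) (L p : ℕ) : windowAt ℓ n v L p < 2 ^ L :=
  Nat.mod_lt _ (by positivity)

/-! ### Approximation from below modulo one -/

/-- Modulo `1`, the number `z` exceeds `v / 2 ^ L` by at most `E / 2 ^ L`. -/
def Approx (E L : ℕ) (z : ℚ) (v : ℕ) : Prop :=
  ∃ c : ℤ, 0 ≤ z - c - v / 2 ^ L ∧ z - c - v / 2 ^ L ≤ E / 2 ^ L

theorem Approx.mono {E E' L : ℕ} {z : ℚ} {v : ℕ} (h : Approx E L z v) (hE : E ≤ E') :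
    Approx E' L z v := by
  obtain ⟨c, h1, h2⟩ := h
  exact ⟨c, h1, h2.trans (by gcongr)⟩

/-- Dropping `d` digits scales the old error to at most `F` new units, and the truncation lowers the
value by less than one further unit. The approximation therefore remains one from below. -/
theorem Approx.shift {E F L d : ℕ} {z : ℚ} {v : ℕ} (h : Approx E (L + d) z v)
    (hE : E ≤ F * 2 ^ d) : Approx (F + 1) L z (v / 2 ^ d) := by
  obtain ⟨c, h1, h2⟩ := h
  have h3 : (v : ℚ) = 2 ^ d * ((v / 2 ^ d : ℕ) : ℚ) + ((v % 2 ^ d : ℕ) : ℚ) := by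
    exact_mod_cast (Nat.div_add_mod v (2 ^ d)).symm
  have h4 : ((v % 2 ^ d : ℕ) : ℚ) ≤ 2 ^ d := by
    exact_mod_cast (Nat.mod_lt v (by positivity)).le
  have h5 : (E : ℚ) ≤ F * 2 ^ d := by exact_mod_cast hE
  have h6 : (v : ℚ) / 2 ^ (L + d) = ((v / 2 ^ d : ℕ) : ℚ) / 2 ^ L +
      ((v % 2 ^ d : ℕ) : ℚ) / 2 ^ (L + d) := by
    rw [h3, pow_add]
    field_simp
  have h7 : ((v % 2 ^ d : ℕ) : ℚ) / 2 ^ (L + d) ≤ 1 / 2 ^ L := by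
    rw [pow_add, div_le_div_iff₀ (by positivity) (by positivity)]
    nlinarith [pow_pos (two_pos : (0 : ℚ) < 2) L]
  have h8 : (E : ℚ) / 2 ^ (L + d) ≤ F / 2 ^ L := by
    rw [pow_add, div_le_div_iff₀ (by positivity) (by positivity)]
    nlinarith [pow_pos (two_pos : (0 : ℚ) < 2) L]
  have h9 : (0 : ℚ) ≤ ((v % 2 ^ d : ℕ) : ℚ) / 2 ^ (L + d) := by positivity
  refine ⟨c, by linarith, ?_⟩
  push_cast
  rw [add_div]
  linarith

theorem Approx.mod {E L : ℕ} {z : ℚ} {v : ℕ} (h : Approx E L z v) :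
    Approx E L z (v % 2 ^ L) := by
  obtain ⟨c, h1, h2⟩ := h
  have h3 : (v : ℚ) = 2 ^ L * ((v / 2 ^ L : ℕ) : ℚ) + ((v % 2 ^ L : ℕ) : ℚ) := by
    exact_mod_cast (Nat.div_add_mod v (2 ^ L)).symm
  have h4 : (v : ℚ) / 2 ^ L = ((v / 2 ^ L : ℕ) : ℚ) + ((v % 2 ^ L : ℕ) : ℚ) / 2 ^ L := by
    rw [h3]
    field_simp
  have h5 : ((c + ((v / 2 ^ L : ℕ) : ℤ) : ℤ) : ℚ) = c + ((v / 2 ^ L : ℕ) : ℚ) := by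
    rw [Int.cast_add, Int.cast_natCast]
  refine ⟨c + ((v / 2 ^ L : ℕ) : ℤ), ?_, ?_⟩ <;> rw [h5] <;> linarith

/-- The same digits are read with the binary point moved by `t` places; the `t` digits that pass the
point are lost as precision. -/
theorem Approx.two_pow_mul {E L t : ℕ} {z : ℚ} {v : ℕ} (h : Approx E (L + t) z v) :
    Approx E L (2 ^ t * z) v := by
  obtain ⟨c, h1, h2⟩ := h
  have h3 : (2 : ℚ) ^ t * z - ((2 ^ t * c : ℤ) : ℚ) - v / 2 ^ L =
      2 ^ t * (z - c - v / 2 ^ (L + t)) := by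
    push_cast
    rw [pow_add]
    field_simp
  refine ⟨2 ^ t * c, ?_, ?_⟩
  · rw [h3]; positivity
  · rw [h3]
    refine (mul_le_mul_of_nonneg_left h2 (by positivity)).trans (le_of_eq ?_)
    rw [pow_add]
    field_simp

theorem Approx.nat_mul {E L : ℕ} {z : ℚ} {v : ℕ} (h : Approx E L z v) (a : ℕ) :
    Approx (a * E) L (a * z) (a * v) := by
  obtain ⟨c, h1, h2⟩ := h
  have h3 : (a : ℚ) * z - ((a * c : ℤ) : ℚ) - (a * v : ℕ) / 2 ^ L =
      a * (z - c - v / 2 ^ L) := by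
    push_cast
    ring
  refine ⟨a * c, ?_, ?_⟩
  · rw [h3]; positivity
  · rw [h3]
    refine (mul_le_mul_of_nonneg_left h2 (by positivity)).trans (le_of_eq ?_)
    push_cast
    ring

theorem Approx.add {E E' L : ℕ} {z z' : ℚ} {v v' : ℕ} (h : Approx E L z v)
    (h' : Approx E' L z' v') : Approx (E + E') L (z + z') (v + v') := by
  obtain ⟨c, h1, h2⟩ := h
  obtain ⟨c', h1', h2'⟩ := h'
  refine ⟨c + c', ?_, ?_⟩ <;> push_cast <;> rw [add_div] <;> [skip; rw [add_div]] <;> linarith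

theorem Approx.zero (L : ℕ) : Approx 0 L 0 0 := ⟨0, by simp, by simp⟩

theorem Approx.sum {E L N : ℕ} {z : ℕ → ℚ} {v b : ℕ → ℕ} (hb : ∀ p < N, b p ≤ 1)
    (h : ∀ p < N, b p ≠ 0 → Approx E L (z p) (v p)) :
    Approx (N * E) L (∑ p ∈ Finset.range N, b p * z p) (∑ p ∈ Finset.range N, b p * v p) := by
  induction N with
  | zero => simpa using Approx.zero L
  | succ N ih =>
    rw [Finset.sum_range_succ, Finset.sum_range_succ, Nat.succ_mul]
    refine (ih (fun p hp => hb p (by omega)) fun p hp => h p (by omega)).add ?_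
    by_cases h0 : b N = 0
    · simpa [h0] using (Approx.zero L).mono (Nat.zero_le E)
    · exact ((h N (by omega) h0).nat_mul (b N)).mono
        (by nlinarith [hb N (by omega)])

theorem approx_div (L u s : ℕ) (hs : 0 < s) : Approx 1 L ((u : ℚ) / s) (u * 2 ^ L / s) := by
  have h3 : ((u * 2 ^ L : ℕ) : ℚ) = s * ((u * 2 ^ L / s : ℕ) : ℚ) + ((u * 2 ^ L % s : ℕ) : ℚ) := by
    exact_mod_cast (Nat.div_add_mod (u * 2 ^ L) s).symm
  have h4 : ((u * 2 ^ L % s : ℕ) : ℚ) ≤ s := by exact_mod_cast (Nat.mod_lt _ hs).le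
  have h5 : (u : ℚ) / s - ((0 : ℤ) : ℚ) - ((u * 2 ^ L / s : ℕ) : ℚ) / 2 ^ L =
      ((u * 2 ^ L % s : ℕ) : ℚ) / s / 2 ^ L := by
    have : (s : ℚ) ≠ 0 := by positivity
    have h6 : ((u * 2 ^ L % s : ℕ) : ℚ) = u * 2 ^ L - s * ((u * 2 ^ L / s : ℕ) : ℚ) := by
      rw [eq_sub_iff_add_eq', ← h3]
      push_cast
      ring
    rw [h6]
    field_simp
    simp
  refine ⟨0, ?_, ?_⟩
  · rw [h5]; positivity
  · rw [h5]
    have : ((u * 2 ^ L % s : ℕ) : ℚ) / s ≤ 1 := div_le_one_of_le₀ h4 (by positivity)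
    push_cast
    gcongr

/-- A scalar product modulo `1`, from bits of one factor and windows of the other. -/
theorem approx_windows {ℓ : ℕ → ℕ} {n E L : ℕ} {z : ℕ → ℚ} {v x : ℕ → ℕ}
    (hv : ∀ k < n, x k ≠ 0 → Approx E (L + ℓ k) (z k) (v k)) (hx : ∀ k < n, x k < 2 ^ ℓ k) :
    Approx (bitOff ℓ n * (E + 1)) L (∑ k ∈ Finset.range n, x k * z k)
      (∑ p ∈ Finset.range (bitOff ℓ n), bitAt ℓ n x p * windowAt ℓ n v L p) := by
  -- Expanding every `x k` in binary turns the scalar product into a sum over all bit positions, in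
  -- which bit `t` of block `k` carries the weight `2 ^ t * z k`.
  have h1 : ∑ k ∈ Finset.range n, (x k : ℚ) * z k =
      ∑ p ∈ Finset.range (bitOff ℓ n), (bitAt ℓ n x p : ℚ) *
        (2 ^ (p - bitOff ℓ (bitOwner ℓ n p)) * z (bitOwner ℓ n p)) := by
    rw [sum_range_bitOff]
    refine Finset.sum_congr rfl fun k hk => ?_
    rw [Finset.mem_range] at hk
    rw [← congrArg (Nat.cast : ℕ → ℚ) (sum_bits (hx k hk)), Nat.cast_sum, Finset.sum_mul]
    refine Finset.sum_congr rfl fun t ht => ?_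
    rw [Finset.mem_range] at ht
    rw [bitAt, bitOwner_add ℓ hk ht, Nat.add_sub_cancel_left]
    push_cast
    ring
  rw [h1]
  refine Approx.sum (fun p _ => bitAt_le ℓ n x p) fun p hp hb => ?_
  obtain ⟨h2, h3, h4⟩ := bitOwner_spec ℓ hp
  set k := bitOwner ℓ n p with hk
  have h5 : x k ≠ 0 := by
    rintro h
    apply hb
    simp [bitAt, ← hk, h]
  have h6 := hv k h2 h5
  -- With `t` the offset of `p` in its block, `v k` represents `2 ^ t * z k` to `L + (ℓ k - t)`
  -- digits. Dropping the last `ℓ k - t` digits and the integer part leaves exactly the window, at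
  -- the price of one unit of error.
  rw [show L + ℓ k = L + (ℓ k - (p - bitOff ℓ k)) + (p - bitOff ℓ k) by omega] at h6
  have h7 := (h6.two_pow_mul.shift (F := E) (Nat.le_mul_of_pos_right _ (by positivity))).mod
  simpa [windowAt, ← hk] using h7

/-- A residue modulo `h` is recovered from an approximation of its negative divided by `h`. -/
theorem Approx.recover {E L : ℕ} {z : ℚ} {v h e : ℕ} (hz : Approx E L z v)
    (hE : E * h < 2 ^ L) (he : e < h) (hint : ∃ y : ℤ, z + (e : ℚ) / h = y) :
    (-(v : ℤ) * h) / 2 ^ L % h = e := by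
  obtain ⟨c, h1, h2⟩ := hz
  obtain ⟨y, hy⟩ := hint
  have hh : (0 : ℚ) < h := by exact_mod_cast (Nat.zero_le e).trans_lt he
  have hEq : (E : ℚ) * h < 2 ^ L := by exact_mod_cast hE
  have hp : (0 : ℚ) < 2 ^ L := by positivity
  -- Since `z = y - e / h`, the number `-v h / 2 ^ L` exceeds the integer `(c - y) h + e` by the
  -- error times `h`, which lies in `[0, 1)`. One-sided errors make the floor exact.
  have hfl : (-(v : ℤ) * h) / 2 ^ L = (c - y) * h + e := by
    have key : (-(v : ℚ) * h) = 2 ^ L * ((c - y) * h + e + (z - c - v / 2 ^ L) * h) := by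
      have hz' : z = y - e / h := by linarith
      rw [hz']
      field_simp
      ring
    have h3 : (z - c - v / 2 ^ L) * h * 2 ^ L < 2 ^ L := by
      calc (z - c - v / 2 ^ L) * h * 2 ^ L ≤ (E / 2 ^ L) * h * 2 ^ L := by gcongr
        _ = E * h := by field_simp
        _ < 2 ^ L := hEq
    have h4 : 0 ≤ (z - c - v / 2 ^ L) * h * 2 ^ L := by positivity
    rw [Int.ediv_eq_iff_of_pos (by positivity)]
    constructor
    · have : (((c - y) * h + e : ℤ) : ℚ) * 2 ^ L ≤ (-(v : ℚ) * h) := by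
        rw [key]; push_cast; linarith
      exact_mod_cast this
    · have : (-(v : ℚ) * h) < (((c - y) * h + e : ℤ) : ℚ) * 2 ^ L + 2 ^ L := by
        rw [key]; push_cast; linarith
      have h5 : (-(v : ℤ) * h) < ((c - y) * h + e) * 2 ^ L + 2 ^ L := by exact_mod_cast this
      linarith
  rw [hfl, add_comm, Int.add_mul_emod_self_right]
  exact Int.emod_eq_of_lt (by positivity) (by exact_mod_cast he)

/-! ### Evaluation of expressions within a given number of bit operations -/

/-- The expression `e` has the value `v` of bitlength at most `b`, and evaluating it takes at most
`c` bit operations. -/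
structure Evals (σ : Store) (e : Expr) (v : ℤ) (b c : ℕ) : Prop where
  eval_eq : e.eval σ = v
  bits : bitlen v ≤ b
  cost_le : e.cost σ ≤ c

namespace Evals

variable {σ : Store} {e f : Expr} {v w : ℤ} {x y b b' b'' c c' : ℕ}

theorem mono (h : Evals σ e v b c) (hc : c ≤ c') : Evals σ e v b c' :=
  ⟨h.1, h.2, h.3.trans hc⟩

theorem zero : Evals σ (.const 0) 0 1 1 := ⟨rfl, by simp, by simp [Expr.cost]⟩

theorem one : Evals σ (.const 1) (1 : ℕ) 1 1 := ⟨rfl, by simp, by simp [Expr.cost]⟩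

theorem two : Evals σ (.const 2) (2 : ℕ) 2 2 := ⟨rfl, by simp, by simp [Expr.cost]⟩

theorem cell {a : ℕ} {i j : Expr} {vi vj : ℤ} {bi bj ci cj : ℕ} (hi : Evals σ i vi bi ci)
    (hj : Evals σ j vj bj cj) (hv : σ a vi vj = v) (hb : bitlen v ≤ b) :
    Evals σ (.cell a i j) v b (ci + cj + (bi + bj + b)) := by
  refine ⟨by simp [Expr.eval, hi.1, hj.1, hv], hb, ?_⟩
  have := hi.2; have := hj.2; have := hi.3; have := hj.3
  simp only [Expr.cost, hi.1, hj.1, hv]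
  omega

theorem reg {a : ℕ} (hv : σ a 0 0 = v) (hb : bitlen v ≤ b) : Evals σ (.reg a) v b (4 + b) :=
  (cell zero zero hv hb).mono (by omega)

theorem sub (he : Evals σ e v b c) (hf : Evals σ f w b' c') (hb : bitlen (v - w) ≤ b'') :
    Evals σ (.sub e f) (v - w) b'' (c + c' + (b + b')) := by
  refine ⟨by simp [Expr.eval, he.1, hf.1], hb, ?_⟩
  have := he.2; have := hf.2; have := he.3; have := hf.3
  simp only [Expr.cost, he.1, hf.1]
  omega

theorem mul (he : Evals σ e v b c) (hf : Evals σ f w b' c') (hb : bitlen (v * w) ≤ b'') :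
    Evals σ (.mul e f) (v * w) b'' (c + c' + b * b') := by
  refine ⟨by simp [Expr.eval, he.1, hf.1], hb, ?_⟩
  have := Nat.mul_le_mul he.2 hf.2; have := he.3; have := hf.3
  simp only [Expr.cost, he.1, hf.1]
  omega

theorem rem (he : Evals σ e v b c) (hf : Evals σ f w b' c') {bq : ℕ}
    (hq : bitlen (v / w) ≤ bq) (hb : bitlen (v % w) ≤ b'') :
    Evals σ (.rem e f) (v % w) b'' (c + c' + bq * b') := by
  refine ⟨by simp [Expr.eval, he.1, hf.1], hb, ?_⟩
  have := Nat.mul_le_mul hq hf.2; have := he.3; have := hf.3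
  simp only [Expr.cost, he.1, hf.1]
  omega

theorem quo (he : Evals σ e v b c) (hf : Evals σ f w b' c') (hb : bitlen (v / w) ≤ b'') :
    Evals σ (.quo e f) (v / w) b'' (c + c' + b'' * b') := by
  refine ⟨by simp [Expr.eval, he.1, hf.1], hb, ?_⟩
  have := Nat.mul_le_mul hb hf.2; have := he.3; have := hf.3
  simp only [Expr.cost, he.1, hf.1]
  omega

theorem shr (he : Evals σ e v b c) (hf : Evals σ f (y : ℤ) b' c')
    (hb : bitlen (v / 2 ^ y) ≤ b'') :
    Evals σ (.shr e f) (v / 2 ^ y) b'' (c + c' + (b + b')) := by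
  refine ⟨by simp [Expr.eval, he.1, hf.1], hb, ?_⟩
  have := he.2; have := hf.2; have := he.3; have := hf.3
  simp only [Expr.cost, he.1, hf.1]
  omega

theorem nat_add (he : Evals σ e (x : ℤ) b c) (hf : Evals σ f (y : ℤ) b' c')
    (hb : bitlen ((x + y : ℕ) : ℤ) ≤ b'') :
    Evals σ (.add e f) ((x + y : ℕ) : ℤ) b'' (c + c' + (b + b')) := by
  refine ⟨by simp [Expr.eval, he.1, hf.1], hb, ?_⟩
  have := he.2; have := hf.2; have := he.3; have := hf.3
  simp only [Expr.cost, he.1, hf.1]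
  omega

theorem nat_sub (he : Evals σ e (x : ℤ) b c) (hf : Evals σ f (y : ℤ) b' c') (hxy : y ≤ x) :
    Evals σ (.sub e f) ((x - y : ℕ) : ℤ) b (c + c' + (b + b')) := by
  have h : ((x - y : ℕ) : ℤ) = x - y := Int.ofNat_sub hxy
  have hb : bitlen ((x - y : ℕ) : ℤ) ≤ b := (bitlen_cast_mono (Nat.sub_le x y)).trans he.2
  rw [h] at hb ⊢
  exact he.sub hf hb

theorem nat_mul (he : Evals σ e (x : ℤ) b c) (hf : Evals σ f (y : ℤ) b' c')
    (hb : bitlen ((x * y : ℕ) : ℤ) ≤ b'') :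
    Evals σ (.mul e f) ((x * y : ℕ) : ℤ) b'' (c + c' + b * b') := by
  rw [Nat.cast_mul] at hb ⊢
  exact he.mul hf hb

theorem nat_quo (he : Evals σ e (x : ℤ) b c) (hf : Evals σ f (y : ℤ) b' c')
    (hb : bitlen ((x / y : ℕ) : ℤ) ≤ b'') :
    Evals σ (.quo e f) ((x / y : ℕ) : ℤ) b'' (c + c' + b'' * b') := by
  rw [Int.natCast_div] at hb ⊢
  exact he.quo hf hb

theorem nat_shl (he : Evals σ e (x : ℤ) b c) (hf : Evals σ f (y : ℤ) b' c')
    (hb : bitlen ((x * 2 ^ y : ℕ) : ℤ) ≤ b'') :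
    Evals σ (.shl e f) ((x * 2 ^ y : ℕ) : ℤ) b'' (c + c' + (b + y)) := by
  refine ⟨by simp [Expr.eval, he.1, hf.1], hb, ?_⟩
  have := he.2; have := hf.2; have := he.3; have := hf.3
  simp only [Expr.cost, he.1, hf.1, Int.toNat_natCast]
  omega

theorem nat_shr (he : Evals σ e (x : ℤ) b c) (hf : Evals σ f (y : ℤ) b' c') :
    Evals σ (.shr e f) ((x / 2 ^ y : ℕ) : ℤ) b (c + c' + (b + b')) := by
  have h : ((x / 2 ^ y : ℕ) : ℤ) = (x : ℤ) / 2 ^ y := by push_cast; rfl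
  have hb : bitlen ((x / 2 ^ y : ℕ) : ℤ) ≤ b := (bitlen_cast_mono (Nat.div_le_self _ _)).trans he.2
  rw [h] at hb ⊢
  exact he.shr hf hb

theorem nat_rem_two (he : Evals σ e (x : ℤ) b c) :
    Evals σ (.rem e (.const 2)) ((x % 2 : ℕ) : ℤ) 1 (c + 2 + b * 2) := by
  have h : ((x % 2 : ℕ) : ℤ) = (x : ℤ) % (2 : ℕ) := by push_cast; rfl
  have h1 : bitlen ((x % 2 : ℕ) : ℤ) ≤ 1 := bitlen_cast_le le_rfl (by omega)
  have h2 : bitlen ((x : ℤ) / (2 : ℕ)) ≤ b := by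
    have := (bitlen_cast_mono (Nat.div_le_self x 2)).trans he.2
    simpa using this
  rw [h] at h1 ⊢
  exact he.rem two h2 h1

end Evals

/-! ### Program steps from evaluated expressions -/

theorem Runs.assign_evals {a : ℕ} {i j e : Expr} {σ : Store} {vi vj v : ℤ}
    {bi ci bj cj b ce c : ℕ} {Q : Store → Prop} (hi : Evals σ i vi bi ci)
    (hj : Evals σ j vj bj cj) (he : Evals σ e v b ce)
    (hc : ci + cj + ce + (bi + bj + b) ≤ c) (h : Q (σ.write a vi vj v)) :
    Runs (.assign a i j e) σ c Q := by
  refine Runs.assign ?_ (by rwa [hi.1, hj.1, he.1])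
  have := hi.2; have := hi.3; have := hj.2; have := hj.3; have := he.2; have := he.3
  rw [hi.1, hj.1, he.1]
  omega

/-- Assignment to a register. -/
abbrev Prog.set (a : ℕ) (e : Expr) : Prog := .assign a (.const 0) (.const 0) e

theorem Runs.set_evals {a : ℕ} {e : Expr} {σ : Store} {v : ℤ} {b ce c : ℕ} {Q : Store → Prop}
    (he : Evals σ e v b ce) (hc : ce + b + 4 ≤ c) (h : Q (σ.write a 0 0 v)) :
    Runs (.set a e) σ c Q :=
  Runs.assign_evals .zero .zero he (by omega) h

theorem Runs.branch_evals {e : Expr} {P P' : Prog} {σ : Store} {v : ℤ} {b ce c d : ℕ}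
    {Q : Store → Prop} (he : Evals σ e v b ce) (hc : ce + 1 + d ≤ c)
    (hpos : 0 < v → Runs P σ d Q) (hneg : ¬ 0 < v → Runs P' σ d Q) :
    Runs (.branch e P P') σ c Q := by
  refine (Runs.branch (c := ce + 1) (d := d) ?_ ?_ ?_).mono hc fun _ h => h
  · have := he.3; omega
  · rw [he.1]; exact hpos
  · rw [he.1]; exact hneg

/-! ### The layout of the bit positions -/

/-- The register `35` is halved until it is zero; in every step the content of register `41` is
appended to the array `kk`, whose length is kept in the register `d`. -/
def Prog.halve (kk d : ℕ) : Prog :=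
  .loop (.reg 35)
    (.seq (.assign kk (.reg d) (.const 0) (.reg 41))
      (.seq (.set d (.add (.reg d) (.const 1)))
        (.set 35 (.shr (.reg 35) (.const 1)))))

/-- The number of halvings until zero is `x.size`, so one cell is appended per bit. Applied to a
largest residue, this records the owner of each position of its block; the final counter alone
serves to measure a bitlength. -/
theorem runs_halve {kk d W B x p k : ℕ} {σ : Store} (hk35 : kk ≠ 35) (hkd : kk ≠ d)
    (hk41 : kk ≠ 41) (hd35 : d ≠ 35) (hd41 : d ≠ 41)
    (hx : σ 35 0 0 = (x : ℤ)) (hp : σ d 0 0 = (p : ℤ)) (hk : σ 41 0 0 = (k : ℤ))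
    (hW : bitlen ((p + x.size : ℕ) : ℤ) ≤ W) (hkW : bitlen (k : ℤ) ≤ W)
    (hB : bitlen (x : ℤ) ≤ B) :
    Runs (.halve kk d) σ (x.size * (30 * (W + B)) + 10 * B) fun τ =>
      Agree [35, kk, d] σ τ ∧ τ d 0 0 = ((p + x.size : ℕ) : ℤ) ∧
      (∀ t < x.size, τ kk ((p + t : ℕ) : ℤ) 0 = (k : ℤ)) ∧
      ∀ q < p, τ kk ((q : ℕ) : ℤ) 0 = σ kk (q : ℤ) 0 := by
  have hB1 := (one_le_bitlen _).trans hB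
  have hW1 := (one_le_bitlen _).trans hW
  have key := Runs.loop (e := .reg 35)
    (P := (.seq (.assign kk (.reg d) (.const 0) (.reg 41))
      (.seq (.set d (.add (.reg d) (.const 1)))
        (.set 35 (.shr (.reg 35) (.const 1))))))
    (I := fun t τ => Agree [35, kk, d] σ τ ∧ τ 35 0 0 = ((x / 2 ^ t : ℕ) : ℤ) ∧
      τ d 0 0 = ((p + t : ℕ) : ℤ) ∧ (∀ u < t, τ kk ((p + u : ℕ) : ℤ) 0 = (k : ℤ)) ∧
      ∀ q < p, τ kk ((q : ℕ) : ℤ) 0 = σ kk (q : ℤ) 0)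
    (N := x.size) (f := fun _ => 30 * (W + B)) (c0 := 10 * B) ?_ ?_ (σ := σ)
    ⟨Agree.refl _ _, by simpa using hx, by simpa using hp, by simp, by simp⟩
  · refine key.mono (by simp) ?_
    rintro τ ⟨h1, -, h2, h3, h4⟩
    exact ⟨h1, h2, h3, h4⟩
  · rintro t ht τ ⟨h1, h2, h3, h4, h5⟩
    have hxt : bitlen ((x / 2 ^ t : ℕ) : ℤ) ≤ B :=
      (bitlen_cast_mono (Nat.div_le_self _ _)).trans hB
    have hpt : bitlen ((p + t : ℕ) : ℤ) ≤ W := (bitlen_cast_mono (by omega)).trans hW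
    have hpt' : bitlen ((p + t + 1 : ℕ) : ℤ) ≤ W := (bitlen_cast_mono (by omega)).trans hW
    have h41 : τ 41 0 0 = (k : ℤ) := by rw [h1 41 (by simp [hk41.symm, hd41.symm]), hk]
    have e35 : Evals τ (.reg 35) _ _ _ := .reg h2 hxt
    refine ⟨?_, 25 * (W + B), ?_, ?_⟩
    · rw [e35.1]
      exact_mod_cast Nat.div_pos (Nat.lt_size.1 ht) (by positivity)
    · have := e35.3
      omega
    · refine ((Runs.assign_evals (c := 8 + 4 * W + 5) (Q := fun υ => υ =
          τ.write kk ((p + t : ℕ) : ℤ) 0 k) (.reg h3 hpt) .zero (.reg h41 hkW)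
          (by omega) rfl).seq (c' := (4 * W + 10) + (2 * B + 10 + B)) ?_).mono (by omega) fun _ h => h
      rintro υ rfl
      refine (Runs.set_evals (c := 4 * W + 10) (Q := fun υ => υ =
          (τ.write kk ((p + t : ℕ) : ℤ) 0 k).write d 0 0 ((p + t + 1 : ℕ) : ℤ))
          (.nat_add (.reg (v := ((p + t : ℕ) : ℤ)) ?_ hpt) .one hpt') (by omega) rfl).seq ?_
      · rw [Store.write_of_ne _ hkd.symm, h3]
      rintro υ rfl
      refine Runs.set_evals (.nat_shr (y := 1) (.reg (v := ((x / 2 ^ t : ℕ) : ℤ)) ?_ hxt) .one)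
        (by omega) ⟨?_, ?_, ?_, ?_, ?_⟩
      · rw [Store.write_of_ne _ hd35.symm, Store.write_of_ne _ hk35.symm, h2]
      · exact ((h1.write (by simp) _ _ _).write (by simp) _ _ _).write (by simp) _ _ _
      · rw [Store.write_self, Nat.div_div_eq_div_mul, ← pow_add]
      · rw [Store.write_of_ne _ hd35, Store.write_self, add_assoc]
      · intro u hu
        rw [Store.write_of_ne _ hk35, Store.write_of_ne _ hkd, Store.write_same]
        split_ifs with h
        · rfl
        · exact h4 u (by
            rcases Nat.lt_succ_iff_lt_or_eq.1 hu with h' | rfl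
            · exact h'
            · exact absurd ⟨rfl, rfl⟩ h)
      · intro q hq
        rw [Store.write_of_ne _ hk35, Store.write_of_ne _ hkd, Store.write_same, if_neg, h5 q hq]
        rintro ⟨h, -⟩
        have : q = p + t := by exact_mod_cast h
        omega
  · rintro τ ⟨-, h2, -⟩
    have h0 : x / 2 ^ x.size = 0 := Nat.div_eq_of_lt (Nat.lt_size_self x)
    have e35 : Evals τ (.reg 35) _ _ _ := .reg (h2.trans (by rw [h0]; rfl)) (bitlen_zero.le)
    refine ⟨by rw [e35.1]; simp, ?_⟩
    have := e35.3
    omega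

/-- The registers and arrays `o, …, o + 3` describe blocks of bits of lengths `ℓ 0, …, ℓ (n - 1)`:
total length, block of a position, offsets and lengths of the blocks. -/
structure Layout (o : ℕ) (σ : Store) (n : ℕ) (ℓ : ℕ → ℕ) : Prop where
  total : σ o 0 0 = (bitOff ℓ n : ℤ)
  owner : ∀ p < bitOff ℓ n, σ (o + 1) (p : ℤ) 0 = (bitOwner ℓ n p : ℤ)
  off : ∀ k < n, σ (o + 2) (k : ℤ) 0 = (bitOff ℓ k : ℤ)
  len : ∀ k < n, σ (o + 3) (k : ℤ) 0 = (ℓ k : ℤ)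

theorem Layout.agree {o : ℕ} {σ τ : Store} {n : ℕ} {ℓ : ℕ → ℕ} (h : Layout o σ n ℓ) {m : List ℕ}
    (hm : Agree m σ τ) (ho : ∀ a ∈ m, a < o ∨ o + 3 < a) : Layout o τ n ℓ := by
  have key : ∀ a, o ≤ a → a ≤ o + 3 → τ a = σ a := fun a h1 h2 =>
    hm a fun h3 => by have := ho a h3; omega
  constructor
  · rw [key o (by omega) (by omega), h.total]
  · rw [key (o + 1) (by omega) (by omega)]; exact h.owner
  · rw [key (o + 2) (by omega) (by omega)]; exact h.off
  · rw [key (o + 3) (by omega) (by omega)]; exact h.len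

/-- Lays out blocks of the bits of residues modulo the values of `src`. -/
def Prog.layout (o : ℕ) (src : Expr) : Prog :=
  .forTo 41 0
    (.seq (.set 35 (.sub src (.const 1)))
      (.seq (.assign (o + 2) (.reg 41) (.const 0) (.reg o))
        (.seq (.halve (o + 1) o)
          (.assign (o + 3) (.reg 41) (.const 0)
            (.sub (.reg o) (.cell (o + 2) (.reg 41) (.const 0)))))))

/-- The number of bits of residues modulo `s k`. -/
def resBits (s : ℕ → ℕ) (k : ℕ) : ℕ := (s k - 1).size

theorem runs_layout {o : ℕ} (ho : 7 < o) (ho' : o < 30) {n W B cs : ℕ} {s : ℕ → ℕ} {src : Expr}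
    {σ : Store} (hn : σ 0 0 0 = (n : ℤ)) (h0 : σ o 0 0 = 0) (hs : ∀ k < n, 0 < s k)
    (hsrc : ∀ τ, Agree [35, 41, o, o + 1, o + 2, o + 3] σ τ → ∀ k < n, τ 41 0 0 = (k : ℤ) →
      Evals τ src (s k : ℤ) B cs)
    (hnW : bitlen (n : ℤ) ≤ W) (hDW : bitlen (bitOff (resBits s) n : ℤ) ≤ W) :
    Runs (.layout o src) σ
      (bitOff (resBits s) n * (30 * (W + B)) + n * (cs + 100 * (W + B)) + 30 * W) fun τ =>
      Agree [35, 41, o, o + 1, o + 2, o + 3] σ τ ∧ Layout o τ n (resBits s) := by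
  set ℓ := resBits s with hℓ
  have hW1 := (one_le_bitlen _).trans hnW
  have key := Runs.forTo (v := 41) (b := 0) (N := n) (W := W)
    (P := (.seq (.set 35 (.sub src (.const 1)))
      (.seq (.assign (o + 2) (.reg 41) (.const 0) (.reg o))
        (.seq (.halve (o + 1) o)
          (.assign (o + 3) (.reg 41) (.const 0)
            (.sub (.reg o) (.cell (o + 2) (.reg 41) (.const 0))))))))
    (I := fun k τ => Agree [35, 41, o, o + 1, o + 2, o + 3] σ τ ∧ τ o 0 0 = (bitOff ℓ k : ℤ) ∧
      (∀ p < bitOff ℓ k, τ (o + 1) (p : ℤ) 0 = (bitOwner ℓ n p : ℤ)) ∧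
      (∀ i < k, τ (o + 2) (i : ℤ) 0 = (bitOff ℓ i : ℤ)) ∧
      (∀ i < k, τ (o + 3) (i : ℤ) 0 = (ℓ i : ℤ)))
    (f := fun k => ℓ k * (30 * (W + B)) + (cs + 70 * (W + B))) (σ := σ) ?_ ?_ hnW ?_
    ⟨Agree.refl _ _, by simpa using h0, by simp, by simp, by simp⟩
  · refine key.mono ?_ ?_
    · simp only [Finset.sum_add_distrib, Finset.sum_const, Finset.card_range, smul_eq_mul,
        ← Finset.sum_mul]
      rw [← bitOff]
      nlinarith
    · rintro τ ⟨h1, h2, h3, h4, h5⟩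
      exact ⟨h1, h2, h3, h4, h5⟩
  · rintro k τ x ⟨h1, h2, h3, h4, h5⟩
    refine ⟨h1.write (by simp) _ _ _, ?_⟩
    simp only [Store.write_of_ne _ (show o ≠ 41 by omega),
      Store.write_of_ne _ (show o + 1 ≠ 41 by omega),
      Store.write_of_ne _ (show o + 2 ≠ 41 by omega),
      Store.write_of_ne _ (show o + 3 ≠ 41 by omega)]
    exact ⟨h2, h3, h4, h5⟩
  · rintro k τ ⟨h1, -⟩
    rw [h1 0 (by simp; omega), hn]
  · rintro k hk τ ⟨h1, h2, h3, h4, h5⟩ h41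
    have esrc := hsrc τ h1 k hk h41
    have hkW : bitlen (k : ℤ) ≤ W := (bitlen_cast_mono hk.le).trans hnW
    have hoW : bitlen (bitOff ℓ k : ℤ) ≤ W := (bitlen_cast_mono (bitOff_mono ℓ hk.le)).trans hDW
    have hoW' : bitlen (bitOff ℓ (k + 1) : ℤ) ≤ W :=
      (bitlen_cast_mono (bitOff_mono ℓ hk)).trans hDW
    have hB1 := (one_le_bitlen _).trans esrc.2
    have hxB : bitlen ((s k - 1 : ℕ) : ℤ) ≤ B := (bitlen_cast_mono (Nat.sub_le _ _)).trans esrc.2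
    have hℓk : (s k - 1).size = ℓ k := rfl
    have hoff := bitOff_succ ℓ k
    refine ((Runs.set_evals (c := cs + 2 * B + 10) (Q := fun υ => υ =
        τ.write 35 0 0 ((s k - 1 : ℕ) : ℤ)) (esrc.nat_sub .one (hs k hk)) (by omega) rfl).seq
        (c' := (4 * W + 20) + ((ℓ k * (30 * (W + B)) + 10 * B) + (20 * W + 20))) ?_).mono
        (by omega) fun _ h => h
    rintro υ rfl
    refine (Runs.assign_evals (c := 4 * W + 20) (vi := (k : ℤ)) (vj := 0)
      (v := (bitOff ℓ k : ℤ)) (Q := fun υ => υ =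
        (τ.write 35 0 0 ((s k - 1 : ℕ) : ℤ)).write (o + 2) k 0 (bitOff ℓ k : ℤ))
        (.reg (by rw [Store.write_of_ne _ (by omega), h41]) hkW) .zero
        (.reg (by rw [Store.write_of_ne _ (by omega), h2]) hoW)
        (by omega) rfl).seq ?_
    rintro υ rfl
    refine (runs_halve (W := W) (B := B) (x := s k - 1) (p := bitOff ℓ k) (k := k) (by omega)
      (by omega) (by omega) (by omega) (by omega) ?_ ?_ ?_ ?_ hkW hxB).seq ?_
    · rw [Store.write_of_ne _ (by omega), Store.write_self]
    · rw [Store.write_of_ne _ (by omega), Store.write_of_ne _ (by omega), h2]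
    · rw [Store.write_of_ne _ (by omega), Store.write_of_ne _ (by omega), h41]
    · rw [hℓk, ← hoff]; exact hoW'
    rintro υ ⟨g1, g2, g3, g4⟩
    rw [hℓk, ← hoff] at g2
    have g41 : υ 41 0 0 = (k : ℤ) := by
      rw [g1 41 (by simp; omega), Store.write_of_ne _ (by omega),
        Store.write_of_ne _ (by omega), h41]
    have go2 : υ (o + 2) = (τ.write (o + 2) k 0 (bitOff ℓ k : ℤ)) (o + 2) := by
      rw [g1 _ (by simp; omega)]
      funext i j
      rw [Store.write_same, Store.write_same, Store.write_of_ne _ (by omega)]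
    have go3 : υ (o + 3) = τ (o + 3) := by
      rw [g1 _ (by simp; omega), Store.write_of_ne _ (by omega), Store.write_of_ne _ (by omega)]
    -- The block length is the running total minus the stored offset, so no separate counter is
    -- needed.
    refine Runs.assign_evals (.reg g41 hkW) .zero (.nat_sub (.reg g2 hoW')
      (.cell (v := (bitOff ℓ k : ℤ)) (.reg g41 hkW) .zero (by rw [go2, Store.write_self]) hoW)
      (by omega)) (by omega)
      ⟨⟨?_, ?_, ?_, ?_, ?_⟩, by rw [Store.write_of_ne _ (by omega), g41]⟩
    · refine Agree.write (((h1.write (by simp) _ _ _).write (by simp) _ _ _).trans g1 ?_)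
        (by simp) _ _ _
      intro a ha
      simp only [List.mem_cons, List.not_mem_nil, or_false] at ha ⊢
      omega
    · rw [Store.write_of_ne _ (by omega), g2]
    · intro p hp
      rw [Store.write_of_ne _ (by omega)]
      by_cases hpk : p < bitOff ℓ k
      · rw [g4 p hpk, Store.write_of_ne _ (by omega), Store.write_of_ne _ (by omega), h3 p hpk]
      · obtain ⟨t, rfl⟩ : ∃ t, p = bitOff ℓ k + t := ⟨p - bitOff ℓ k, by omega⟩
        have ht : t < ℓ k := by omega
        rw [g3 t ht, bitOwner_add ℓ hk ht]
    · intro i hi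
      rw [Store.write_of_ne _ (by omega), go2, Store.write_same]
      split_ifs with h
      · have : i = k := by exact_mod_cast h.1
        rw [this]
      · exact h4 i (lt_of_le_of_ne (by omega) fun h' => h ⟨by rw [h'], rfl⟩)
    · intro i hi
      rw [Store.write_same, go3]
      split_ifs with h
      · have : i = k := by exact_mod_cast h.1
        rw [this]
        congr 1
        omega
      · exact h5 i (lt_of_le_of_ne (by omega) fun h' => h ⟨by rw [h'], rfl⟩)

/-! ### Bits, windows and scalar products -/

/-- Writes the binary digits of the values of `x` (which depends on the row in register `42` and
the block in register `41`) into the rows of the array `a`. -/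
def Prog.bits (a : ℕ) (x : Expr) : Prog :=
  .forTo 43 10 (.seq (.set 41 (.cell 11 (.reg 43) (.const 0)))
    (.forTo 42 0 (.assign a (.reg 42) (.reg 43)
      (.rem (.shr x (.sub (.reg 43) (.cell 12 (.reg 41) (.const 0)))) (.const 2)))))

/-- Bit positions form the outer loop: empty blocks cost nothing, and the owner of a position is
looked up once for all `n` rows. -/
theorem runs_bits {a : ℕ} (ha : 13 < a) (ha' : a < 30) {n W B cs : ℕ} {ℓ : ℕ → ℕ}
    {xs : ℕ → ℕ → ℕ} {x : Expr} {σ : Store} (hn : σ 0 0 0 = (n : ℤ)) (hl : Layout 10 σ n ℓ)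
    (hx : ∀ τ, Agree [41, 42, 43, a] σ τ → ∀ r < n, ∀ k < n, τ 41 0 0 = (k : ℤ) →
      τ 42 0 0 = (r : ℤ) → Evals τ x (xs r k : ℤ) B cs)
    (hnW : bitlen (n : ℤ) ≤ W) (hDW : bitlen (bitOff ℓ n : ℤ) ≤ W) :
    Runs (.bits a x) σ (bitOff ℓ n * ((n + 1) * (cs + 200 * (W + B))) + 30 * W) fun τ =>
      Agree [41, 42, 43, a] σ τ ∧
      ∀ r < n, ∀ p < bitOff ℓ n, τ a (r : ℤ) (p : ℤ) = (bitAt ℓ n (xs r) p : ℤ) := by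
  have hW1 := (one_le_bitlen _).trans hnW
  refine (Runs.forTo (v := 43) (b := 10) (N := bitOff ℓ n) (W := W)
    (I := fun p τ => Agree [41, 42, 43, a] σ τ ∧
      ∀ r < n, ∀ q < p, τ a (r : ℤ) (q : ℤ) = (bitAt ℓ n (xs r) q : ℤ))
    (f := fun _ => (n + 1) * (cs + 170 * (W + B))) ?_ ?_ hDW ?_
    ⟨Agree.refl _ _, by simp⟩).mono ?_ fun _ h => h
  · rintro k τ x ⟨h1, h2⟩
    refine ⟨h1.write (by simp) _ _ _, ?_⟩
    rwa [Store.write_of_ne _ (by omega)]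
  · rintro p τ ⟨h1, -⟩
    rw [(hl.agree h1 (by simp; omega)).total]
  · rintro p hp τ ⟨h1, h2⟩ h43
    have hl' := hl.agree h1 (by simp; omega)
    obtain ⟨hk, hkp, hkp'⟩ := bitOwner_spec ℓ hp
    set k := bitOwner ℓ n p with hkdef
    have hkW : bitlen (k : ℤ) ≤ W := (bitlen_cast_mono hk.le).trans hnW
    have hpW : bitlen (p : ℤ) ≤ W := (bitlen_cast_mono hp.le).trans hDW
    have hoW : bitlen (bitOff ℓ k : ℤ) ≤ W := (bitlen_cast_mono (by omega)).trans hDW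
    refine ((Runs.set_evals (c := 6 * W + 20) (Q := fun υ => υ = τ.write 41 0 0 (k : ℤ))
      (.cell (.reg h43 hpW) .zero (hl'.owner p hp) hkW) (by omega) rfl).seq
      (fun τ' h => Runs.forTo (v := 42) (b := 0) (N := n) (W := W)
      (I := fun r υ => Agree [41, 42, 43, a] σ υ ∧ υ 43 0 0 = (p : ℤ) ∧ υ 41 0 0 = (k : ℤ) ∧
        (∀ r < n, ∀ q < p, υ a (r : ℤ) (q : ℤ) = (bitAt ℓ n (xs r) q : ℤ)) ∧
        ∀ i < r, υ a (i : ℤ) (p : ℤ) = (bitAt ℓ n (xs i) p : ℤ))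
      (f := fun _ => cs + 60 * (W + B)) ?_ ?_ hnW ?_ ?_)).mono ?_ ?_
    · rintro r υ y ⟨g1, g2, g3, g4, g5⟩
      refine ⟨g1.write (by simp) _ _ _, ?_⟩
      simp only [Store.write_of_ne _ (show 43 ≠ 42 by omega),
        Store.write_of_ne _ (show 41 ≠ 42 by omega), Store.write_of_ne _ (show a ≠ 42 by omega)]
      exact ⟨g2, g3, g4, g5⟩
    · rintro r υ ⟨g1, -⟩
      rw [g1 0 (by simp; omega), hn]
    · rintro r hr υ ⟨g1, g2, g3, g4, g5⟩ h42
      have hl'' := hl.agree g1 (by simp; omega)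
      have ex := hx υ g1 r hr k hk g3 h42
      have hrW : bitlen (r : ℤ) ≤ W := (bitlen_cast_mono hr.le).trans hnW
      refine Runs.assign_evals (.reg h42 hrW) (.reg g2 hpW) (.nat_rem_two (.nat_shr ex
        (.nat_sub (.reg g2 hpW) (.cell (.reg g3 hkW) .zero (hl''.off k hk) hoW) hkp)))
        (by omega) ⟨⟨g1.write (by simp) _ _ _, ?_, ?_, ?_, ?_⟩, ?_⟩
      · rw [Store.write_of_ne _ (by omega), g2]
      · rw [Store.write_of_ne _ (by omega), g3]
      · intro i hi q hq
        rw [Store.write_same, if_neg, g4 i hi q hq]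
        rintro ⟨-, h⟩
        have : q = p := by exact_mod_cast h
        omega
      · intro i hi
        rw [Store.write_same]
        split_ifs with h
        · have : i = r := by exact_mod_cast h.1
          rw [this, bitAt]
        · exact g5 i (lt_of_le_of_ne (by omega) fun h' => h ⟨by rw [h'], rfl⟩)
      · rw [Store.write_of_ne _ (by omega), h42]
    · rw [h]
      refine ⟨h1.write (by simp) _ _ _, ?_, Store.write_self _ _ _ _ _, ?_, by simp⟩
      · rw [Store.write_of_ne _ (by omega), h43]
      · rwa [Store.write_of_ne _ (by omega)]
    · simp only [Finset.sum_const, Finset.card_range, smul_eq_mul]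
      nlinarith
    · rintro υ ⟨g1, g2, g3, g4, g5⟩
      refine ⟨⟨g1, fun r hr q hq => ?_⟩, g2⟩
      rcases Nat.lt_succ_iff_lt_or_eq.1 hq with h | rfl
      · exact g4 r hr q h
      · exact g5 r hr
  · simp only [Finset.sum_const, Finset.card_range, smul_eq_mul]
    gcongr
    nlinarith

/-- Fills the array `31` with the windows of `L` digits (register `32`) of the numbers in the
array `30`. -/
def Prog.window (o : ℕ) : Prog :=
  .forTo 43 o (.seq (.set 41 (.cell (o + 1) (.reg 43) (.const 0)))
    (.seq (.set 36 (.shr (.cell 30 (.reg 41) (.const 0))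
      (.sub (.cell (o + 3) (.reg 41) (.const 0))
        (.sub (.reg 43) (.cell (o + 2) (.reg 41) (.const 0))))))
    (.assign 31 (.reg 43) (.const 0)
      (.sub (.reg 36) (.shl (.shr (.reg 36) (.reg 32)) (.reg 32))))))

/-- The remainder modulo `2 ^ L` is formed by two shifts and a subtraction, which have linear cost,
whereas a division would be charged a product of bitlengths. -/
theorem runs_window {o : ℕ} (ho : 7 < o) (ho' : o + 3 < 30) {n W B L : ℕ} {ℓ v : ℕ → ℕ}
    {σ : Store} (hl : Layout o σ n ℓ) (hv : ∀ k < n, σ 30 (k : ℤ) 0 = (v k : ℤ))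
    (hvB : ∀ k < n, bitlen (v k : ℤ) ≤ B) (hL : σ 32 0 0 = (L : ℤ)) (hLB : L ≤ B)
    (hLW : bitlen (L : ℤ) ≤ W)
    (hnW : bitlen (n : ℤ) ≤ W) (hDW : bitlen (bitOff ℓ n : ℤ) ≤ W) :
    Runs (.window o) σ (bitOff ℓ n * (200 * (W + B)) + 30 * W) fun τ =>
      Agree [41, 43, 36, 31] σ τ ∧
      ∀ p < bitOff ℓ n, τ 31 (p : ℤ) 0 = (windowAt ℓ n v L p : ℤ) := by
  have hW1 := (one_le_bitlen _).trans hnW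
  refine (Runs.forTo (v := 43) (b := o) (N := bitOff ℓ n) (W := W)
    (I := fun p τ => Agree [41, 43, 36, 31] σ τ ∧
      ∀ q < p, τ 31 (q : ℤ) 0 = (windowAt ℓ n v L q : ℤ))
    (f := fun _ => 170 * (W + B)) ?_ ?_ hDW ?_
    ⟨Agree.refl _ _, by simp⟩).mono ?_ fun _ h => h
  · rintro k τ x ⟨h1, h2⟩
    refine ⟨h1.write (by simp) _ _ _, ?_⟩
    rwa [Store.write_of_ne _ (by omega)]
  · rintro p τ ⟨h1, -⟩
    rw [(hl.agree h1 (by simp; omega)).total]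
  · rintro p hp τ ⟨h1, h2⟩ h43
    have hl' := hl.agree h1 (by simp; omega)
    obtain ⟨hk, hkp, hkp'⟩ := bitOwner_spec ℓ hp
    set k := bitOwner ℓ n p with hkdef
    have hkW : bitlen (k : ℤ) ≤ W := (bitlen_cast_mono hk.le).trans hnW
    have hpW : bitlen (p : ℤ) ≤ W := (bitlen_cast_mono hp.le).trans hDW
    have hoW : bitlen (bitOff ℓ k : ℤ) ≤ W := (bitlen_cast_mono (by omega)).trans hDW
    have hlW : bitlen (ℓ k : ℤ) ≤ W := by
      refine (bitlen_cast_mono ?_).trans hDW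
      have := bitOff_mono ℓ (show k + 1 ≤ n by omega)
      rw [bitOff_succ] at this
      omega
    have hB1 := (one_le_bitlen _).trans (hvB k hk)
    have e30 : τ 30 (k : ℤ) 0 = (v k : ℤ) := by rw [h1 30 (by simp), hv k hk]
    have e32 : τ 32 0 0 = (L : ℤ) := by rw [h1 32 (by simp), hL]
    set y := v k / 2 ^ (ℓ k - (p - bitOff ℓ k)) with hy
    have hyB : bitlen (y : ℤ) ≤ B := (bitlen_cast_mono (Nat.div_le_self _ _)).trans (hvB k hk)
    have hyB' : bitlen ((y / 2 ^ L * 2 ^ L : ℕ) : ℤ) ≤ B :=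
      (bitlen_cast_mono (Nat.div_mul_le_self _ _)).trans hyB
    refine ((Runs.set_evals (c := 6 * W + 20) (Q := fun υ => υ = τ.write 41 0 0 (k : ℤ))
      (.cell (.reg h43 hpW) .zero (hl'.owner p hp) hkW) (by omega) rfl).seq
      (c' := (60 * (W + B)) + 60 * (W + B)) ?_).mono (by omega) fun _ h => h
    rintro υ rfl
    refine (Runs.set_evals (c := 60 * (W + B)) (v := (y : ℤ)) (Q := fun υ => υ =
        (τ.write 41 0 0 (k : ℤ)).write 36 0 0 (y : ℤ))
      (.nat_shr (.cell (.reg (Store.write_self _ _ _ _ _) hkW) .zero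
          (by rw [Store.write_of_ne _ (by omega), e30]) (hvB k hk))
        (.nat_sub (.cell (.reg (Store.write_self _ _ _ _ _) hkW) .zero
            (by rw [Store.write_of_ne _ (by omega), hl'.len k hk]) hlW)
          (.nat_sub (.reg (by rw [Store.write_of_ne _ (by omega), h43]) hpW)
            (.cell (.reg (Store.write_self _ _ _ _ _) hkW) .zero
              (by rw [Store.write_of_ne _ (by omega), hl'.off k hk]) hoW) hkp) (by omega)))
      (by omega) rfl).seq ?_
    rintro υ rfl
    refine Runs.assign_evals (.reg (v := (p : ℤ)) ?_ hpW) .zero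
      (.nat_sub (.reg (Store.write_self _ _ _ _ _) hyB)
        (.nat_shl (.nat_shr (.reg (Store.write_self _ _ _ _ _) hyB) (.reg ?_ hLW))
          (.reg ?_ hLW) hyB') (Nat.div_mul_le_self _ _)) (by omega) ⟨⟨?_, ?_⟩, ?_⟩
    · rw [Store.write_of_ne _ (by omega), Store.write_of_ne _ (by omega), h43]
    · rw [Store.write_of_ne _ (by omega), Store.write_of_ne _ (by omega), e32]
    · rw [Store.write_of_ne _ (by omega), Store.write_of_ne _ (by omega), e32]
    · exact ((h1.write (by simp) _ _ _).write (by simp) _ _ _).write (by simp) _ _ _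
    · intro q hq
      rw [Store.write_same, Store.write_of_ne _ (by omega), Store.write_of_ne _ (by omega)]
      split_ifs with h
      · have : q = p := by exact_mod_cast h.1
        rw [this, windowAt, ← hkdef, ← hy]
        congr 1
        have := Nat.div_add_mod' y (2 ^ L)
        omega
      · exact h2 q (lt_of_le_of_ne (by omega) fun h' => h ⟨by rw [h'], rfl⟩)
    · rw [Store.write_of_ne _ (by omega), Store.write_of_ne _ (by omega),
        Store.write_of_ne _ (by omega), h43]
  · simp only [Finset.sum_const, Finset.card_range, smul_eq_mul]
    gcongr
    omega

/-- The scalar product of row `42` of the array `a` and the array `31`, in register `33`. -/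
def Prog.dot (a o : ℕ) : Prog :=
  .seq (.set 33 (.const 0))
    (.forTo 43 o (.set 33 (.add (.reg 33)
      (.mul (.cell a (.reg 42) (.reg 43)) (.cell 31 (.reg 43) (.const 0))))))

/-- One factor of every product is a single bit, so a multiplication is as cheap as an addition, and
the partial sums never exceed `D * 2 ^ L`. -/
theorem runs_dot {a o : ℕ} (ha : 13 < a) (ha' : a < 30) (ho : o < 30) {D W B L r : ℕ}
    {b w : ℕ → ℕ} {σ : Store} (hD : σ o 0 0 = (D : ℤ)) (hr : σ 42 0 0 = (r : ℤ))
    (hb : ∀ p < D, σ a (r : ℤ) (p : ℤ) = (b p : ℤ)) (hb1 : ∀ p < D, b p ≤ 1)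
    (hw : ∀ p < D, σ 31 (p : ℤ) 0 = (w p : ℤ)) (hwL : ∀ p < D, w p < 2 ^ L)
    (hB : D * 2 ^ L < 2 ^ B) (hB1 : 1 ≤ B) (hrW : bitlen (r : ℤ) ≤ W)
    (hDW : bitlen (D : ℤ) ≤ W) :
    Runs (.dot a o) σ (D * (100 * (W + B)) + 40 * W) fun τ =>
      Agree [33, 43] σ τ ∧ τ 33 0 0 = ((∑ p ∈ Finset.range D, b p * w p : ℕ) : ℤ) := by
  have hW1 := (one_le_bitlen _).trans hDW
  have hsum : ∀ k ≤ D, bitlen ((∑ p ∈ Finset.range k, b p * w p : ℕ) : ℤ) ≤ B := by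
    intro k hk
    refine bitlen_cast_le hB1 (lt_of_le_of_lt ?_ hB)
    have h1 : ∑ p ∈ Finset.range k, b p * w p ≤ ∑ _p ∈ Finset.range k, 2 ^ L := by
      refine Finset.sum_le_sum fun p hp => ?_
      have hp' : p < D := (Finset.mem_range.1 hp).trans_le hk
      have := Nat.mul_le_mul (hb1 p hp') (hwL p hp').le
      omega
    refine h1.trans ?_
    rw [Finset.sum_const, Finset.card_range, smul_eq_mul]
    gcongr
  refine ((Runs.set_evals (c := 10 * W) (v := 0) (Q := fun υ => υ = σ.write 33 0 0 0)
    .zero (by omega) rfl).seq (fun τ h => Runs.forTo (v := 43) (b := o) (N := D) (W := W)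
    (I := fun p τ => Agree [33, 43] σ τ ∧
      τ 33 0 0 = ((∑ p ∈ Finset.range p, b p * w p : ℕ) : ℤ))
    (f := fun _ => 70 * (W + B)) ?_ ?_ hDW ?_ ?_)).mono ?_ fun _ h => h
  · rintro k τ x ⟨h1, h2⟩
    refine ⟨h1.write (by simp) _ _ _, ?_⟩
    rwa [Store.write_of_ne _ (by omega)]
  · rintro p τ ⟨h1, -⟩
    rw [h1 o (by simp; omega), hD]
  · rintro p hp τ ⟨h1, h2⟩ h43
    have hpW : bitlen (p : ℤ) ≤ W := (bitlen_cast_mono hp.le).trans hDW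
    have h42 : τ 42 0 0 = (r : ℤ) := by rw [h1 42 (by simp), hr]
    have hba : bitlen (b p : ℤ) ≤ 1 := bitlen_cast_le le_rfl (by have := hb1 p hp; omega)
    have hwB : bitlen (w p : ℤ) ≤ B := by
      refine bitlen_cast_le hB1 ((hwL p hp).trans_le (le_trans ?_ hB.le))
      exact Nat.le_mul_of_pos_left _ (by omega)
    have hbwB : bitlen ((b p * w p : ℕ) : ℤ) ≤ B := by
      refine (bitlen_cast_mono ?_).trans hwB
      have := Nat.mul_le_mul_right (w p) (hb1 p hp)
      omega
    have hs := hsum (p + 1) hp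
    rw [Finset.sum_range_succ] at hs
    refine Runs.set_evals (.nat_add (.reg h2 (hsum p hp.le)) (.nat_mul
      (.cell (.reg h42 hrW) (.reg h43 hpW) (v := (b p : ℤ)) ?_ hba)
      (.cell (.reg h43 hpW) .zero (v := (w p : ℤ)) ?_ hwB) hbwB) hs) (by omega) ⟨⟨?_, ?_⟩, ?_⟩
    · rw [h1 a (by simp; omega), hb p hp]
    · rw [h1 31 (by simp), hw p hp]
    · exact h1.write (by simp) _ _ _
    · rw [Store.write_self, Finset.sum_range_succ]
    · rw [Store.write_of_ne _ (by omega), h43]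
  · rw [h]
    exact ⟨(Agree.refl _ _).write (by simp) _ _ _, by simp⟩
  · simp only [Finset.sum_const, Finset.card_range, smul_eq_mul]
    nlinarith

/-! ### Approximating the product of massager, inverse Smith form and Howell transform -/

/-- The memory holds the dimension, the moduli `s`, the layouts of the bits of residues modulo `s`
and modulo `h`, and the precision `g`. -/
structure Ready (σ : Store) (n g : ℕ) (s h : ℕ → ℕ) : Prop where
  dim : σ 0 0 0 = (n : ℤ)
  moduli : ∀ k < n, σ 3 (k : ℤ) (k : ℤ) = (s k : ℤ)
  layoutS : Layout 10 σ n (resBits s)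
  layoutH : Layout 20 σ n (resBits h)
  guard : σ 34 0 0 = (g : ℤ)

theorem Ready.agree {σ τ : Store} {n g : ℕ} {s h : ℕ → ℕ} (hr : Ready σ n g s h) {m : List ℕ}
    (hm : Agree m σ τ)
    (ho : ∀ a ∈ m, 3 < a ∧ (a < 10 ∨ 13 < a) ∧ (a < 20 ∨ 23 < a) ∧ a ≠ 34) :
    Ready τ n g s h where
  dim := by rw [hm 0 fun h => by have := ho _ h; omega, hr.dim]
  moduli := by rw [hm 3 fun h => by have := ho _ h; omega]; exact hr.moduli
  layoutS := hr.layoutS.agree hm fun a h => by have := ho _ h; omega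
  layoutH := hr.layoutH.agree hm fun a h => by have := ho _ h; omega
  guard := by rw [hm 34 fun h => by have := ho _ h; omega, hr.guard]

theorem resBits_le_bitOff (s : ℕ → ℕ) {k n : ℕ} (hk : k < n) :
    resBits s k ≤ bitOff (resBits s) n := by
  have := bitOff_mono (resBits s) (show k + 1 ≤ n by omega)
  rw [bitOff_succ] at this
  omega

theorem lt_two_pow_resBits {s : ℕ → ℕ} {k x : ℕ} (hx : x < s k) : x < 2 ^ resBits s k :=
  (Nat.le_sub_one_of_lt hx).trans_lt (Nat.lt_size_self _)

/-- The modulus itself may be a power of two, which needs one bit more than its residues. -/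
theorem bitlen_le_resBits {s : ℕ → ℕ} {k x : ℕ} (hx : x ≤ s k) (hs : 0 < s k) :
    bitlen (x : ℤ) ≤ resBits s k + 1 := by
  refine bitlen_cast_le (by omega) ?_
  have := lt_two_pow_resBits (s := s) (k := k) (x := s k - 1) (by omega)
  rw [pow_succ]
  omega

/-- The entry `(i, j)` of the array `50`, with the roles of `i` and `j` exchanged if `sw`. -/
def fracCell (sw : Bool) (σ : Store) (i j : ℤ) : ℤ := bif sw then σ 50 j i else σ 50 i j

/-- The array `50` holds at `(i, j)` a number of bounded size, which is an approximation of `z`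
if `G` holds. -/
def FracEntry (sw : Bool) (σ : Store) (g : ℕ) (e : ℕ → ℕ) (i j : ℕ) (z : ℚ) (G : Prop) : Prop :=
  ∃ t : ℕ, fracCell sw σ i j = (t : ℤ) ∧ t < 2 ^ (e i + e j + 2 * g) ∧
    (G → Approx 2 (e i + e j + g) z t)

/-- Computes the approximations whose precision is governed by the row in register `40`. The
expression `x` reads entry `41` of this row of the first factor, the array `a` holds the bits of
the second factor. -/
def Prog.stage (x : Expr) (a : ℕ) (sw : Bool) : Prog :=
  .forTo 40 0 (.branch (.cell 23 (.reg 40) (.const 0))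
    (.seq (.set 32 (.add (.add (.cell 23 (.reg 40) (.const 0)) (.cell 23 (.reg 40) (.const 0)))
        (.add (.reg 34) (.reg 34))))
      (.seq (.forTo 41 0 (.assign 30 (.reg 41) (.const 0)
          (.quo (.shl x (.add (.reg 32) (.cell 13 (.reg 41) (.const 0))))
            (.cell 3 (.reg 41) (.reg 41)))))
        (.seq (.window 10)
          (.forTo 42 0 (.branch
            (.sub (.add (.cell 23 (.reg 40) (.const 0)) (.const 1))
              (.cell 23 (.reg 42) (.const 0)))
            (.seq (.dot a 10)
              (.assign 50 (.reg (bif sw then 42 else 40)) (.reg (bif sw then 40 else 42))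
                (.shr (.reg 33) (.sub (.reg 32)
                  (.add (.add (.cell 23 (.reg 40) (.const 0)) (.cell 23 (.reg 42) (.const 0)))
                    (.reg 34))))))
            .skip)))))
    .skip)

/-- The arrays that `Prog.stage` changes. -/
abbrev stageArrays : List ℕ := [30, 31, 32, 33, 36, 40, 41, 42, 43, 50]

section Stage

variable {n W g : ℕ} {s h : ℕ → ℕ}

/-- The quotient for `k` has at most `L + resBits s k` bits and its divisor `resBits s k + 1`. The
charge for a division is their product, so the sum over `k` is linear in the total number of bits
plus `n`. -/
theorem runs_quotients {x : Expr} {σ : Store} {L : ℕ} {xs : ℕ → ℕ}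
    (hR : Ready σ n g s h) (hs : ∀ k < n, 0 < s k) (hxs : ∀ k < n, xs k < s k)
    (hL : σ 32 0 0 = (L : ℤ)) (hL1 : 1 ≤ L)
    (hx : ∀ τ, Agree [30, 41] σ τ → ∀ k < n, τ 41 0 0 = (k : ℤ) →
      Evals τ x (xs k : ℤ) (resBits s k + 1) (20 * W + resBits s k))
    (hnW : bitlen (n : ℤ) ≤ W) (hLW : bitlen ((L + bitOff (resBits s) n : ℕ) : ℤ) ≤ W) :
    Runs (.forTo 41 0 (.assign 30 (.reg 41) (.const 0)
          (.quo (.shl x (.add (.reg 32) (.cell 13 (.reg 41) (.const 0))))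
            (.cell 3 (.reg 41) (.reg 41))))) σ
      ((bitOff (resBits s) n + n) * (150 * (W + L + bitOff (resBits s) n)) + 30 * W) fun τ =>
      Agree [30, 41] σ τ ∧
        ∀ k < n, τ 30 (k : ℤ) 0 = ((xs k * 2 ^ (L + resBits s k) / s k : ℕ) : ℤ) := by
  have hW1 := (one_le_bitlen _).trans hnW
  refine (Runs.forTo (v := 41) (b := 0) (N := n) (W := W)
    (I := fun k τ => Agree [30, 41] σ τ ∧
      ∀ i < k, τ 30 (i : ℤ) 0 = ((xs i * 2 ^ (L + resBits s i) / s i : ℕ) : ℤ))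
    (f := fun k => (resBits s k + 1) * (120 * (W + L + bitOff (resBits s) n))) ?_ ?_ hnW ?_
    ⟨Agree.refl _ _, by simp⟩).mono ?_ fun _ h => h
  · rintro k τ x ⟨h1, h2⟩
    refine ⟨h1.write (by simp) _ _ _, ?_⟩
    rwa [Store.write_of_ne _ (by omega)]
  · rintro k τ ⟨h1, -⟩
    rw [h1 0 (by simp), hR.dim]
  · rintro k hk τ ⟨h1, h2⟩ h41
    have hR' := hR.agree h1 (by simp)
    have ex := hx τ h1 k hk h41
    have hℓD := resBits_le_bitOff s hk
    set ℓ := resBits s k with hℓ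
    set D := bitOff (resBits s) n with hD
    have hkW : bitlen (k : ℤ) ≤ W := (bitlen_cast_mono hk.le).trans hnW
    have hLW' : bitlen ((L + ℓ : ℕ) : ℤ) ≤ W := (bitlen_cast_mono (by omega)).trans hLW
    have hLW'' : bitlen (L : ℤ) ≤ W := (bitlen_cast_mono (by omega)).trans hLW
    have hℓW : bitlen (ℓ : ℤ) ≤ W := (bitlen_cast_mono (by omega)).trans hLW
    have hx2 : xs k < 2 ^ ℓ := lt_two_pow_resBits (hxs k hk)
    have hb1 : bitlen ((xs k * 2 ^ (L + ℓ) : ℕ) : ℤ) ≤ L + 2 * ℓ := by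
      refine bitlen_cast_le (by omega) ?_
      rw [show L + 2 * ℓ = ℓ + (L + ℓ) by ring, pow_add 2 ℓ]
      exact Nat.mul_lt_mul_of_pos_right hx2 (by positivity)
    have hb2 : bitlen ((xs k * 2 ^ (L + ℓ) / s k : ℕ) : ℤ) ≤ L + ℓ := by
      refine bitlen_cast_le (by omega) (Nat.div_lt_of_lt_mul ?_)
      exact Nat.mul_lt_mul_of_pos_right (hxs k hk) (by positivity)
    have hsb : bitlen (s k : ℤ) ≤ ℓ + 1 := bitlen_le_resBits le_rfl (hs k hk)
    have e32 : τ 32 0 0 = (L : ℤ) := by rw [h1 32 (by simp), hL]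
    have hcost : 100 * W + 10 * (L + 2 * ℓ + 1) + (L + ℓ) * (ℓ + 1) ≤
        (ℓ + 1) * (120 * (W + L + D)) := by nlinarith
    refine Runs.assign_evals (.reg h41 hkW) .zero (.nat_quo
      (ex.nat_shl (.nat_add (.reg e32 hLW'') (.cell (.reg h41 hkW) .zero
        (hR'.layoutS.len k hk) hℓW) hLW') hb1)
      (.cell (.reg h41 hkW) (.reg h41 hkW) (hR'.moduli k hk) hsb) hb2)
      (le_trans (by omega) hcost) ⟨⟨h1.write (by simp) _ _ _, ?_⟩, ?_⟩
    · intro i hi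
      rw [Store.write_same]
      split_ifs with h
      · have : i = k := by exact_mod_cast h.1
        rw [this]
      · exact h2 i (lt_of_le_of_ne (by omega) fun h' => h ⟨by rw [h'], rfl⟩)
    · rw [Store.write_of_ne _ (by omega), h41]
  · have : ∀ k ∈ Finset.range n, (resBits s k + 1) * (120 * (W + L + bitOff (resBits s) n)) +
        30 * W ≤ (resBits s k + 1) * (150 * (W + L + bitOff (resBits s) n)) := by
      intro k _
      nlinarith
    refine Nat.add_le_add_right ((Finset.sum_le_sum this).trans (le_of_eq ?_)) _
    rw [← Finset.sum_mul, Finset.sum_add_distrib]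
    simp [bitOff]

/-- The value that approximates entry `(r, r')`. -/
theorem approx_frac {L r r' : ℕ} {xs ys : ℕ → ℕ} (hs : ∀ k < n, 0 < s k)
    (hys : ∀ k < n, ys k < s k) (hg : 2 * bitOff (resBits s) n ≤ 2 ^ g)
    (hL : L = 2 * resBits h r + 2 * g) (hrr : resBits h r' ≤ resBits h r) :
    let t := (∑ p ∈ Finset.range (bitOff (resBits s) n), bitAt (resBits s) n ys p *
      windowAt (resBits s) n (fun k => xs k * 2 ^ (L + resBits s k) / s k) L p) /
        2 ^ (L - (resBits h r + resBits h r' + g))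
    t < 2 ^ (resBits h r + resBits h r' + 2 * g) ∧
      Approx 2 (resBits h r + resBits h r' + g)
        (∑ k ∈ Finset.range n, (ys k : ℚ) * ((xs k : ℚ) / s k)) t := by
  intro t
  constructor
  · refine Nat.div_lt_of_lt_mul ?_
    rw [← pow_add, show L - (resBits h r + resBits h r' + g) +
      (resBits h r + resBits h r' + 2 * g) = g + L by omega, pow_add]
    refine lt_of_le_of_lt (b := bitOff (resBits s) n * 2 ^ L) ?_ ?_
    · refine (Finset.sum_le_card_nsmul _ _ (2 ^ L) fun p _ => ?_).trans (by simp)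
      have := Nat.mul_le_mul (bitAt_le (resBits s) n ys p)
        (windowAt_lt (resBits s) n (fun k => xs k * 2 ^ (L + resBits s k) / s k) L p).le
      omega
    · refine Nat.mul_lt_mul_of_pos_right ?_ (by positivity)
      have : 0 < 2 ^ g := by positivity
      omega
  · have h1 := approx_windows (ℓ := resBits s) (n := n) (E := 1) (L := L)
      (z := fun k => (xs k : ℚ) / s k) (v := fun k => xs k * 2 ^ (L + resBits s k) / s k) (x := ys)
      (fun k hk _ => approx_div _ _ _ (hs k hk)) (fun k hk => lt_two_pow_resBits (hys k hk))
    set d := L - (resBits h r + resBits h r' + g) with hd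
    have hLd : L = resBits h r + resBits h r' + g + d := by omega
    have h2 := h1
    rw [show Approx (bitOff (resBits s) n * (1 + 1)) L = Approx (bitOff (resBits s) n * (1 + 1))
      (resBits h r + resBits h r' + g + d) by rw [← hLd]] at h2
    -- At least `g` digits are dropped, because `L` contains `2 * g` and `resBits h r' ≤ resBits h
    -- r`. They absorb the accumulated error, which is at most `2 ^ g`, to one unit; truncation adds
    -- the second.
    refine h2.shift (F := 1) ?_
    rw [one_mul, mul_comm]
    refine hg.trans (Nat.pow_le_pow_right (by norm_num) (by omega))

theorem fracCell_write (sw : Bool) (σ : Store) (i j i' j' v : ℤ) :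
    fracCell sw (σ.write 50 (bif sw then j else i) (bif sw then i else j) v) i' j' =
      if i' = i ∧ j' = j then v else fracCell sw σ i' j' := by
  cases sw <;> simp [fracCell, Store.write_same, and_comm]

theorem fracCell_agree {sw : Bool} {m : List ℕ} {σ τ : Store} (h : Agree m σ τ) (hm : 50 ∉ m) :
    fracCell sw τ = fracCell sw σ := by
  funext i j
  simp [fracCell, h 50 hm]

/-- `G` records which entries of the row are accurate already; this pass adds those with `resBits h
r' ≤ resBits h r`. Other entries are left untouched, so the size bound and earlier accuracy persist.
-/
theorem runs_stage_row {a : ℕ} (ha : 13 < a) (ha' : a < 20) {sw : Bool} {L r : ℕ}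
    {xs : ℕ → ℕ} {ys : ℕ → ℕ → ℕ} {G : ℕ → Prop} {σ : Store} (hR : Ready σ n g s h) (hr : r < n)
    (hs : ∀ k < n, 0 < s k) (hys : ∀ r < n, ∀ k < n, ys r k < s k)
    (h40 : σ 40 0 0 = (r : ℤ)) (hL : σ 32 0 0 = (L : ℤ)) (hLe : L = 2 * resBits h r + 2 * g)
    (hL1 : 1 ≤ L)
    (hg : 2 * bitOff (resBits s) n ≤ 2 ^ g) (hgW : g ≤ W)
    (hwin : ∀ p < bitOff (resBits s) n, σ 31 (p : ℤ) 0 = (windowAt (resBits s) n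
      (fun k => xs k * 2 ^ (L + resBits s k) / s k) L p : ℤ))
    (ha_bits : ∀ r < n, ∀ p < bitOff (resBits s) n,
      σ a (r : ℤ) (p : ℤ) = (bitAt (resBits s) n (ys r) p : ℤ))
    (hG : ∀ r' < n, FracEntry sw σ g (resBits h) r r'
      (∑ k ∈ Finset.range n, (ys r' k : ℚ) * ((xs k : ℚ) / s k)) (G r'))
    (hW : bitlen ((2 * (n + bitOff (resBits s) n + bitOff (resBits h) n + g + 1) : ℕ) : ℤ) ≤ W) :
    Runs (.forTo 42 0 (.branch
            (.sub (.add (.cell 23 (.reg 40) (.const 0)) (.const 1))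
              (.cell 23 (.reg 42) (.const 0)))
            (.seq (.dot a 10)
              (.assign 50 (.reg (bif sw then 42 else 40)) (.reg (bif sw then 40 else 42))
                (.shr (.reg 33) (.sub (.reg 32)
                  (.add (.add (.cell 23 (.reg 40) (.const 0)) (.cell 23 (.reg 42) (.const 0)))
                    (.reg 34))))))
            .skip)) σ
      (n * ((bitOff (resBits s) n + 1) * (400 * (W + L))) + 30 * W) fun τ =>
      Agree [33, 42, 43, 50] σ τ ∧
      (∀ i j : ℕ, i ≠ r → fracCell sw τ i j = fracCell sw σ i j) ∧
      ∀ r' < n, FracEntry sw τ g (resBits h) r r'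
        (∑ k ∈ Finset.range n, (ys r' k : ℚ) * ((xs k : ℚ) / s k))
          (G r' ∨ resBits h r' ≤ resBits h r) := by
  have hnW : bitlen (n : ℤ) ≤ W := (bitlen_cast_mono (by omega)).trans hW
  have hW1 := (one_le_bitlen _).trans hnW
  have hDW : bitlen (bitOff (resBits s) n : ℤ) ≤ W := (bitlen_cast_mono (by omega)).trans hW
  have her := resBits_le_bitOff h hr
  set e := resBits h with he
  set D := bitOff (resBits s) n with hD
  refine (Runs.forTo (v := 42) (b := 0) (N := n) (W := W)
    (I := fun j τ => Agree [33, 42, 43, 50] σ τ ∧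
      (∀ i j : ℕ, i ≠ r → fracCell sw τ i j = fracCell sw σ i j) ∧
      ∀ r' < n, FracEntry sw τ g e r r'
        (∑ k ∈ Finset.range n, (ys r' k : ℚ) * ((xs k : ℚ) / s k)) (G r' ∨ r' < j ∧ e r' ≤ e r))
    (f := fun _ => (D + 1) * (370 * (W + L))) ?_ ?_ hnW ?_
    ⟨Agree.refl _ _, fun _ _ _ => rfl, by simpa using hG⟩).mono ?_ ?_
  · rintro j τ y ⟨h1, h2, h3⟩
    have hc : fracCell sw (τ.write 42 0 0 y) = fracCell sw τ :=
      fracCell_agree ((Agree.refl [42] τ).write (by simp) _ _ _) (by simp)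
    refine ⟨h1.write (by simp) _ _ _, by rwa [hc], fun r' hr' => ?_⟩
    obtain ⟨t, ht⟩ := h3 r' hr'
    exact ⟨t, by rwa [hc]⟩
  · rintro k τ ⟨h1, -⟩
    rw [h1 0 (by simp), hR.dim]
  · rintro j hj τ ⟨h1, h2, h3⟩ h42
    have hR' := hR.agree h1 (by simp)
    have hej := resBits_le_bitOff h hj
    rw [← he] at hej
    have hjW : bitlen (j : ℤ) ≤ W := (bitlen_cast_mono hj.le).trans hnW
    have hrW : bitlen (r : ℤ) ≤ W := (bitlen_cast_mono hr.le).trans hnW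
    have herW : bitlen ((e r + 1 : ℕ) : ℤ) ≤ W := (bitlen_cast_mono (by omega)).trans hW
    have herW' : bitlen (e r : ℤ) ≤ W := (bitlen_cast_mono (by omega)).trans herW
    have hejW : bitlen (e j : ℤ) ≤ W := (bitlen_cast_mono (by omega)).trans hW
    have hgW' : bitlen (g : ℤ) ≤ W := (bitlen_cast_mono (by omega)).trans hW
    have hLW : bitlen (L : ℤ) ≤ W := (bitlen_cast_mono (by omega)).trans hW
    have hsW : bitlen ((e r + e j : ℕ) : ℤ) ≤ W := (bitlen_cast_mono (by omega)).trans hW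
    have hsgW : bitlen ((e r + e j + g : ℕ) : ℤ) ≤ W := (bitlen_cast_mono (by omega)).trans hW
    have g40 : τ 40 0 0 = (r : ℤ) := by rw [h1 40 (by simp), h40]
    -- The tested difference may be negative, but its absolute value is bounded by one of the two
    -- lengths.
    have hdiffW : bitlen (((e r + 1 : ℕ) : ℤ) - (e j : ℤ)) ≤ W := by
      rcases le_total (e j) (e r + 1) with hle | hle
      · rw [← Int.ofNat_sub hle]
        exact (bitlen_cast_mono (Nat.sub_le _ _)).trans herW
      · have h5 : (((e r + 1 : ℕ) : ℤ) - (e j : ℤ)) = -((e j - (e r + 1) : ℕ) : ℤ) := by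
          rw [Int.ofNat_sub hle]; ring
        have h6 := (bitlen_cast_mono (Nat.sub_le (e j) (e r + 1))).trans hejW
        rw [h5]
        unfold bitlen at h6 ⊢
        rwa [Int.natAbs_neg]
    refine Runs.branch_evals (d := D * (100 * (W + (L + W))) + 40 * W + (60 * W + 30 + 10 * (L + W)))
      (Evals.sub (.nat_add (.cell (.reg g40 hrW) .zero (hR'.layoutH.len r hr) herW') .one herW)
        (.cell (.reg h42 hjW) .zero (hR'.layoutH.len j hj) hejW) hdiffW) ?_ ?_ ?_
    · nlinarith
    · intro hpos
      have hle : e j ≤ e r := by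
        have h5 : (0 : ℤ) < ((e r + 1 : ℕ) : ℤ) - (e j : ℤ) := hpos
        omega
      have hvals := approx_frac (h := h) (L := L) (r := r) (r' := j) (xs := xs) (ys := ys j) hs
        (hys j hj) hg hLe hle
      rw [← he, ← hD] at hvals
      obtain ⟨hv1, hv2⟩ := hvals
      have hDL : D * 2 ^ L < 2 ^ (L + W) := by
        have h5 : D < 2 ^ W := by
          have h6 : 2 ^ g ≤ 2 ^ W := Nat.pow_le_pow_right (by norm_num) hgW
          have : 0 < 2 ^ g := by positivity
          omega
        rw [pow_add, mul_comm]
        exact Nat.mul_lt_mul_of_pos_left h5 (by positivity)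
      refine (runs_dot (a := a) (o := 10) ha (by omega) (by omega) (D := D) (W := W) (B := L + W)
        (L := L) (r := j) (w := windowAt (resBits s) n
          (fun k => xs k * 2 ^ (L + resBits s k) / s k) L) hR'.layoutS.total h42
        (b := bitAt (resBits s) n (ys j)) ?_ (fun p _ => bitAt_le _ _ _ p) ?_
        (fun p _ => windowAt_lt _ _ _ _ _) hDL (by omega) hjW hDW).seq ?_
      · intro p hp
        rw [h1 a (by simp; omega), ha_bits j hj p hp]
      · intro p hp
        rw [h1 31 (by simp), hwin p hp]
      rintro υ ⟨f1, f2⟩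
      set acc := ∑ p ∈ Finset.range D, bitAt (resBits s) n (ys j) p *
        windowAt (resBits s) n (fun k => xs k * 2 ^ (L + resBits s k) / s k) L p with hacc
      have haccB : bitlen (acc : ℤ) ≤ L + W := by
        refine bitlen_cast_le (by omega) (lt_of_le_of_lt ?_ hDL)
        refine (Finset.sum_le_card_nsmul _ _ (2 ^ L) fun p _ => ?_).trans (by simp)
        have := Nat.mul_le_mul (bitAt_le (resBits s) n (ys j) p)
          (windowAt_lt (resBits s) n (fun k => xs k * 2 ^ (L + resBits s k) / s k) L p).le
        omega
      have f40 : υ 40 0 0 = (r : ℤ) := by rw [f1 40 (by simp), g40]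
      have f42 : υ 42 0 0 = (j : ℤ) := by rw [f1 42 (by simp), h42]
      have f32 : υ 32 0 0 = (L : ℤ) := by rw [f1 32 (by simp), h1 32 (by simp), hL]
      have hR'' := hR'.agree f1 (by simp)
      have hfc : fracCell sw υ = fracCell sw τ := fracCell_agree f1 (by simp)
      refine Runs.assign_evals (vi := bif sw then (j : ℤ) else r)
        (vj := bif sw then (r : ℤ) else j) (bi := W) (ci := 4 + W) (bj := W) (cj := 4 + W) ?_ ?_
        (.nat_shr (.reg f2 haccB) (.nat_sub (.reg f32 hLW) (.nat_add (.nat_add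
          (.cell (.reg f40 hrW) .zero (hR''.layoutH.len r hr) herW')
          (.cell (.reg f42 hjW) .zero (hR''.layoutH.len j hj) hejW) hsW)
          (.reg hR''.guard hgW') hsgW) (by rw [← he]; omega))) (by omega) ⟨⟨?_, ?_, ?_⟩, ?_⟩
      · cases sw
        · exact .reg f40 hrW
        · exact .reg f42 hjW
      · cases sw
        · exact .reg f42 hjW
        · exact .reg f40 hrW
      · refine (h1.trans f1 ?_).write (by simp) _ _ _
        simp
      · intro i i' hi
        rw [fracCell_write, if_neg, hfc, h2 i i' hi]
        rintro ⟨h5, -⟩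
        exact hi (by exact_mod_cast h5)
      · intro r' hr'
        by_cases hrj : r' = j
        · subst hrj
          refine ⟨_, by rw [fracCell_write, if_pos ⟨rfl, rfl⟩], hv1, fun _ => hv2⟩
        · obtain ⟨t, t1, t2, t3⟩ := h3 r' hr'
          refine ⟨t, ?_, t2, ?_⟩
          · rw [fracCell_write, if_neg, hfc, t1]
            rintro ⟨-, h5⟩
            exact hrj (by exact_mod_cast h5)
          · rintro (h5 | ⟨h5, h6⟩)
            · exact t3 (Or.inl h5)
            · exact t3 (Or.inr ⟨by omega, h6⟩)
      · rw [Store.write_of_ne _ (by omega), f42]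
    · intro hneg
      have hlt : ¬ e j ≤ e r := by
        have h5 : ¬ (0 : ℤ) < ((e r + 1 : ℕ) : ℤ) - (e j : ℤ) := hneg
        omega
      refine Runs.skip (by omega) ⟨⟨h1, h2, fun r' hr' => ?_⟩, h42⟩
      obtain ⟨t, t1, t2, t3⟩ := h3 r' hr'
      refine ⟨t, t1, t2, ?_⟩
      rintro (h5 | ⟨h5, h6⟩)
      · exact t3 (Or.inl h5)
      · refine t3 (Or.inr ⟨lt_of_le_of_ne (by omega) ?_, h6⟩)
        rintro rfl
        exact hlt h6
  · simp only [Finset.sum_const, Finset.card_range, smul_eq_mul]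
    gcongr
    nlinarith
  · rintro τ ⟨h1, h2, h3⟩
    refine ⟨h1, h2, fun r' hr' => ?_⟩
    obtain ⟨t, t1, t2, t3⟩ := h3 r' hr'
    exact ⟨t, t1, t2, fun h => t3 (h.imp_right fun h => ⟨hr', h⟩)⟩

/-- Row `r` treats only partners of length at most `e_r`, so precision `2 e_r + 2 g` is enough for
all of them and a scalar product costs in proportion to `e_r`, not to the largest length. The sum
over `r` is then controlled by the sum of the `e_r`. Rows with `e_r = 0` are skipped. -/
theorem runs_stage {x : Expr} {a : ℕ} (ha : 13 < a) (ha' : a < 20) {sw : Bool}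
    {xs ys : ℕ → ℕ → ℕ} {G : ℕ → ℕ → Prop} {σ : Store} (hR : Ready σ n g s h)
    (hs : ∀ k < n, 0 < s k) (hxs : ∀ r < n, ∀ k < n, xs r k < s k)
    (hys : ∀ r < n, ∀ k < n, ys r k < s k)
    (hx : ∀ τ, Agree stageArrays σ τ → ∀ r < n, ∀ k < n, τ 40 0 0 = (r : ℤ) →
      τ 41 0 0 = (k : ℤ) → Evals τ x (xs r k : ℤ) (resBits s k + 1) (20 * W + resBits s k))
    (hg : 2 * bitOff (resBits s) n ≤ 2 ^ g) (hgW : g ≤ W)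
    (ha_bits : ∀ r < n, ∀ p < bitOff (resBits s) n,
      σ a (r : ℤ) (p : ℤ) = (bitAt (resBits s) n (ys r) p : ℤ))
    (hG : ∀ i < n, ∀ j < n, FracEntry sw σ g (resBits h) i j
      (∑ k ∈ Finset.range n, (ys j k : ℚ) * ((xs i k : ℚ) / s k)) (G i j))
    (hW : bitlen ((2 * (n + bitOff (resBits s) n + bitOff (resBits h) n + g + 1) : ℕ) : ℤ) ≤ W) :
    Runs (.stage x a sw) σ
      (∑ r ∈ Finset.range n, (60 * W + if 0 < resBits h r then
        3000 * ((bitOff (resBits s) n + n) * (W + resBits h r + bitOff (resBits s) n) +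
          n * (bitOff (resBits s) n + 1) * (W + resBits h r)) else 0) + 30 * W) fun τ =>
      Agree stageArrays σ τ ∧
      ∀ i < n, ∀ j < n, FracEntry sw τ g (resBits h) i j
        (∑ k ∈ Finset.range n, (ys j k : ℚ) * ((xs i k : ℚ) / s k))
          (G i j ∨ 0 < resBits h i ∧ resBits h j ≤ resBits h i) := by
  have hnW : bitlen (n : ℤ) ≤ W := (bitlen_cast_mono (by omega)).trans hW
  have hW1 := (one_le_bitlen _).trans hnW
  have hDW : bitlen (bitOff (resBits s) n : ℤ) ≤ W := (bitlen_cast_mono (by omega)).trans hW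
  refine (Runs.forTo (v := 40) (b := 0) (N := n) (W := W)
    (I := fun r τ => Agree stageArrays σ τ ∧
      ∀ i < n, ∀ j < n, FracEntry sw τ g (resBits h) i j
        (∑ k ∈ Finset.range n, (ys j k : ℚ) * ((xs i k : ℚ) / s k))
          (G i j ∨ i < r ∧ 0 < resBits h i ∧ resBits h j ≤ resBits h i))
    (f := fun r => 30 * W + if 0 < resBits h r then
        3000 * ((bitOff (resBits s) n + n) * (W + resBits h r + bitOff (resBits s) n) +
          n * (bitOff (resBits s) n + 1) * (W + resBits h r)) else 0) ?_ ?_ hnW ?_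
    ⟨Agree.refl _ _, by simpa using hG⟩).mono ?_ ?_
  · rintro j τ y ⟨h1, h2⟩
    have hc : fracCell sw (τ.write 40 0 0 y) = fracCell sw τ :=
      fracCell_agree ((Agree.refl [40] τ).write (by simp) _ _ _) (by simp)
    refine ⟨h1.write (by simp) _ _ _, fun i hi j hj => ?_⟩
    obtain ⟨t, ht⟩ := h2 i hi j hj
    exact ⟨t, by rwa [hc]⟩
  · rintro k τ ⟨h1, -⟩
    rw [h1 0 (by simp), hR.dim]
  · rintro r hr τ ⟨h1, h2⟩ h40
    have hR' := hR.agree h1 (by simp)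
    have her := resBits_le_bitOff h hr
    have hrW : bitlen (r : ℤ) ≤ W := (bitlen_cast_mono hr.le).trans hnW
    have herW : bitlen (resBits h r : ℤ) ≤ W := (bitlen_cast_mono (by omega)).trans hW
    have eer : Evals τ (.cell 23 (.reg 40) (.const 0)) (resBits h r : ℤ) W _ :=
      .cell (.reg h40 hrW) .zero (hR'.layoutH.len r hr) herW
    refine Runs.branch_evals (d := 1 + if 0 < resBits h r then
        3000 * ((bitOff (resBits s) n + n) * (W + resBits h r + bitOff (resBits s) n) +
          n * (bitOff (resBits s) n + 1) * (W + resBits h r)) else 0) eer (by omega) ?_ ?_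
    · intro hpos
      have hpos' : 0 < resBits h r := by exact_mod_cast hpos
      rw [if_pos hpos']
      set e := resBits h r with he
      set D := bitOff (resBits s) n with hD
      obtain ⟨L, hL⟩ : ∃ L, L = 2 * e + 2 * g := ⟨_, rfl⟩
      have hgW' : bitlen (g : ℤ) ≤ W := (bitlen_cast_mono (by omega)).trans hW
      have heeW : bitlen ((e + e : ℕ) : ℤ) ≤ W := (bitlen_cast_mono (by omega)).trans hW
      have hggW : bitlen ((g + g : ℕ) : ℤ) ≤ W := (bitlen_cast_mono (by omega)).trans hW
      have hLW : bitlen (L : ℤ) ≤ W := (bitlen_cast_mono (by omega)).trans hW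
      have hLW' : bitlen ((e + e + (g + g) : ℕ) : ℤ) ≤ W :=
        (bitlen_cast_mono (by omega)).trans hLW
      have hLDW : bitlen ((L + D : ℕ) : ℤ) ≤ W := (bitlen_cast_mono (by omega)).trans hW
      refine ((Runs.set_evals (c := 60 * W) (v := ((e + e + (g + g) : ℕ) : ℤ))
        (Q := fun υ => υ = τ.write 32 0 0 (L : ℤ))
        (.nat_add (.nat_add eer eer heeW)
          (.nat_add (.reg hR'.guard hgW') (.reg hR'.guard hgW') hggW) hLW') (by omega)
          (by rw [hL]; congr 2; omega)).seq
        (c' := ((D + n) * (150 * (W + L + D)) + 30 * W) + ((D * (200 * (W + (L + D))) + 30 * W) +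
          (n * ((D + 1) * (400 * (W + L))) + 30 * W))) ?_).mono ?_ fun _ h => h
      · rintro υ rfl
        have g1 : Agree stageArrays σ (τ.write 32 0 0 (L : ℤ)) := h1.write (by simp) _ _ _
        have g40 : (τ.write 32 0 0 (L : ℤ)) 40 0 0 = (r : ℤ) := by
          rw [Store.write_of_ne _ (by omega), h40]
        refine (runs_quotients (L := L) (xs := xs r) (hR.agree g1 (by simp)) hs (hxs r hr)
          (Store.write_self _ _ _ _ _) (by omega) ?_ hnW hLDW).seq ?_
        · intro υ hυ k hk hυ41
          refine hx υ (g1.trans hυ (by simp)) r hr k hk ?_ hυ41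
          rw [hυ 40 (by simp), g40]
        rintro υ ⟨hυ, hυ30⟩
        have g2 : Agree stageArrays σ υ := g1.trans hυ (by simp)
        have hR2 := hR.agree g2 (by simp)
        have g2L : υ 32 0 0 = (L : ℤ) := by rw [hυ 32 (by simp), Store.write_self]
        refine (runs_window (o := 10) (by omega) (by omega) (B := L + D) (L := L)
          hR2.layoutS hυ30 ?_ g2L (by omega) hLW hnW hDW).seq ?_
        · intro k hk
          have := resBits_le_bitOff s hk
          refine bitlen_cast_le (by omega) (Nat.div_lt_of_lt_mul ?_)
          refine lt_of_lt_of_le (Nat.mul_lt_mul_of_pos_right (hxs r hr k hk) (by positivity)) ?_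
          exact Nat.mul_le_mul_left _ (Nat.pow_le_pow_right (by norm_num) (by omega))
        rintro φ ⟨hφ, hφ31⟩
        have g3 : Agree stageArrays σ φ := g2.trans hφ (by simp)
        have hc3 : fracCell sw φ = fracCell sw τ := by
          rw [fracCell_agree hφ (by simp), fracCell_agree hυ (by simp)]
          exact fracCell_agree ((Agree.refl [32] τ).write (by simp) _ _ _) (by simp)
        refine (runs_stage_row (a := a) ha ha' (sw := sw) (L := L) (r := r) (xs := xs r) (ys := ys)
          (G := fun j => G r j ∨ r < r ∧ 0 < resBits h r ∧ resBits h j ≤ resBits h r)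
          (hR.agree g3 (by simp)) hr hs hys ?_ ?_ hL (by omega) hg hgW hφ31 ?_ ?_ hW).mono
          le_rfl ?_
        · rw [hφ 40 (by simp), hυ 40 (by simp), g40]
        · rw [hφ 32 (by simp), g2L]
        · intro i hi p hp
          rw [g3 a (by simp; omega), ha_bits i hi p hp]
        · intro j hj
          obtain ⟨t, ht⟩ := h2 r hr j hj
          exact ⟨t, by rwa [hc3]⟩
        rintro ψ ⟨hψ, hψ1, hψ2⟩
        refine ⟨⟨g3.trans hψ (by simp), fun i hi j hj => ?_⟩, ?_⟩
        · by_cases hir : i = r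
          · subst hir
            obtain ⟨t, t1, t2, t3⟩ := hψ2 j hj
            refine ⟨t, t1, t2, ?_⟩
            rintro (h5 | ⟨h5, h6⟩)
            · exact t3 (Or.inl (Or.inl h5))
            · exact t3 (Or.inr h6.2)
          · obtain ⟨t, t1, t2, t3⟩ := h2 i hi j hj
            refine ⟨t, ?_, t2, ?_⟩
            · rw [hψ1 i j hir, hc3, t1]
            · rintro (h5 | ⟨h5, h6⟩)
              · exact t3 (Or.inl h5)
              · exact t3 (Or.inr ⟨by omega, h6⟩)
        · rw [hψ 40 (by simp), hφ 40 (by simp), hυ 40 (by simp), g40]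
      · have hLW2 : L ≤ 2 * e + 2 * W := by omega
        have b1 : (D + n) * (150 * (W + L + D)) ≤ (D + n) * (450 * (W + e + D)) :=
          Nat.mul_le_mul_left _ (by omega)
        have b2 : D * (200 * (W + (L + D))) ≤ (D + n) * (600 * (W + e + D)) :=
          Nat.mul_le_mul (by omega) (by omega)
        have b3 : n * ((D + 1) * (400 * (W + L))) ≤ n * ((D + 1) * (1200 * (W + e))) :=
          Nat.mul_le_mul_left _ (Nat.mul_le_mul_left _ (by omega))
        have b4 : W ≤ (D + n) * (W + e + D) := by
          refine le_trans (by omega) (Nat.le_mul_of_pos_left (W + e + D) (show 0 < D + n by omega))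
        nlinarith
    · intro hneg
      have hz : ¬ 0 < resBits h r := by exact_mod_cast hneg
      rw [if_neg hz]
      refine Runs.skip (by omega) ⟨⟨h1, fun i hi j hj => ?_⟩, h40⟩
      obtain ⟨t, t1, t2, t3⟩ := h2 i hi j hj
      refine ⟨t, t1, t2, ?_⟩
      rintro (h5 | ⟨h5, h6⟩)
      · exact t3 (Or.inl h5)
      · refine t3 (Or.inr ⟨lt_of_le_of_ne (by omega) ?_, h6⟩)
        rintro rfl
        exact hz h6.1
  · refine Nat.add_le_add_right (Finset.sum_le_sum fun r _ => ?_) _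
    omega
  · rintro τ ⟨h1, h2⟩
    refine ⟨h1, fun i hi j hj => ?_⟩
    obtain ⟨t, t1, t2, t3⟩ := h2 i hi j hj
    exact ⟨t, t1, t2, fun h => t3 (h.imp_right fun h => ⟨hi, h⟩)⟩

end Stage

/-! ### Computing the entries of the Hermite form -/

theorem bitlen_mono {a b : ℤ} (h : a.natAbs ≤ b.natAbs) : bitlen a ≤ bitlen b := by
  unfold bitlen
  have := Nat.log_mono_right (b := 2) h
  omega

theorem bitlen_ediv_le (a b : ℤ) : bitlen (a / b) ≤ bitlen a :=
  bitlen_mono (Int.natAbs_ediv_le_natAbs a b)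

/-- Computes the entry in row `42` and column `40` of the Hermite form, and its bits. -/
def Prog.entry : Prog :=
  .seq (.dot 24 20)
    (.seq (.set 33 (.add (.reg 33) (.shr
        (.mul (.cell 5 (.reg 42) (.const 0)) (.cell 50 (.reg 42) (.reg 40)))
        (.cell 23 (.reg 42) (.const 0)))))
      (.seq (.set 37 (.rem (.shr (.mul (.sub (.const 0) (.reg 33)) (.cell 5 (.reg 40) (.const 0)))
          (.reg 32)) (.cell 5 (.reg 40) (.const 0))))
        (.seq (.assign 7 (.reg 42) (.reg 40) (.reg 37))
          (.forTo 43 44 (.assign 24 (.reg 42)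
            (.add (.cell 22 (.reg 40) (.const 0)) (.reg 43))
            (.rem (.shr (.reg 37) (.reg 43)) (.const 2)))))))

theorem Agree.mono {m m' : List ℕ} {σ τ : Store} (h : Agree m σ τ) (hm : ∀ a ∈ m, a ∈ m') :
    Agree m' σ τ :=
  fun a ha => h a fun ha' => ha (hm a ha')

section Entry

variable {n W g : ℕ} {s h : ℕ → ℕ}

/-- Block `j` of row `i` consists precisely of the bits of entry `(i, j)`, so overwriting these
positions is a `Function.update` of the row. -/
theorem runs_entry_bits {i j x : ℕ} {row : ℕ → ℕ} {σ : Store}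
    (hR : Ready σ n g s h) (hj : j < n)
    (h40 : σ 40 0 0 = (j : ℤ)) (h42 : σ 42 0 0 = (i : ℤ)) (h44 : σ 44 0 0 = (resBits h j : ℤ))
    (h37 : σ 37 0 0 = (x : ℤ)) (hxb : bitlen (x : ℤ) ≤ resBits h j + 1)
    (hbits : ∀ p < bitOff (resBits h) n, σ 24 (i : ℤ) (p : ℤ) = (bitAt (resBits h) n row p : ℤ))
    (hiW : bitlen (i : ℤ) ≤ W) (hjW : bitlen (j : ℤ) ≤ W)
    (hDW : bitlen (bitOff (resBits h) n : ℤ) ≤ W) :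
    Runs (.forTo 43 44 (.assign 24 (.reg 42)
            (.add (.cell 22 (.reg 40) (.const 0)) (.reg 43))
            (.rem (.shr (.reg 37) (.reg 43)) (.const 2)))) σ
      (resBits h j * (100 * W + 20 * resBits h j) + 30 * W) fun τ =>
      Agree [24, 43] σ τ ∧ (∀ a b : ℤ, a ≠ i → τ 24 a b = σ 24 a b) ∧
      ∀ p < bitOff (resBits h) n,
        τ 24 (i : ℤ) (p : ℤ) = (bitAt (resBits h) n (Function.update row j x) p : ℤ) := by
  have hW1 := (one_le_bitlen _).trans hDW
  have hoj : bitOff (resBits h) j + resBits h j ≤ bitOff (resBits h) n := by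
    rw [← bitOff_succ]; exact bitOff_mono _ hj
  set e := resBits h with he
  set D := bitOff e n with hD
  have hejW : bitlen (e j : ℤ) ≤ W := (bitlen_cast_mono (by omega)).trans hDW
  have hoffW : bitlen (bitOff e j : ℤ) ≤ W := (bitlen_cast_mono (by omega)).trans hDW
  refine (Runs.forTo (v := 43) (b := 44) (N := e j) (W := W)
      (I := fun t φ => Agree [24, 43] σ φ ∧
        (∀ a b : ℤ, a ≠ i → φ 24 a b = σ 24 a b) ∧
        ∀ p < D, φ 24 (i : ℤ) (p : ℤ) =
          if bitOff e j ≤ p ∧ p < bitOff e j + t then (bitAt e n (Function.update row j x) p : ℤ)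
          else (bitAt e n row p : ℤ))
      (f := fun _ => 60 * W + 10 * e j) ?_ ?_ hejW ?_ ⟨Agree.refl _ _, fun _ _ _ => rfl, ?_⟩).mono
      ?_ ?_
  · rintro t φ y ⟨f1, f4, f5⟩
    refine ⟨f1.write (by simp) _ _ _, ?_⟩
    simp only [Store.write_of_ne _ (show 24 ≠ 43 by omega)]
    exact ⟨f4, f5⟩
  · rintro t φ ⟨f1, -⟩
    rw [f1 44 (by simp), h44]
  · rintro t ht φ ⟨f1, f4, f5⟩ h43
    have hR2 := hR.agree f1 (by simp)
    have f42 : φ 42 0 0 = (i : ℤ) := by rw [f1 42 (by simp), h42]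
    have f40 : φ 40 0 0 = (j : ℤ) := by rw [f1 40 (by simp), h40]
    have f37 : φ 37 0 0 = (x : ℤ) := by rw [f1 37 (by simp), h37]
    have htW : bitlen (t : ℤ) ≤ W := (bitlen_cast_mono ht.le).trans hejW
    have hotW : bitlen ((bitOff e j + t : ℕ) : ℤ) ≤ W := (bitlen_cast_mono (by omega)).trans hDW
    refine Runs.assign_evals (.reg f42 hiW) (.nat_add (.cell (.reg f40 hjW) .zero
      (hR2.layoutH.off j hj) hoffW) (.reg h43 htW) hotW)
      (.nat_rem_two (.nat_shr (.reg f37 hxb) (.reg h43 htW))) (by omega)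
      ⟨⟨f1.write (by simp) _ _ _, ?_, ?_⟩, ?_⟩
    · intro a b hab
      rw [Store.write_same, if_neg (fun h => hab h.1), f4 a b hab]
    · intro p hp
      rw [Store.write_same]
      by_cases hpt : p = bitOff e j + t
      · subst hpt
        rw [if_pos ⟨rfl, rfl⟩, if_pos (by omega), bitAt, bitOwner_add e hj ht,
          Nat.add_sub_cancel_left, Function.update_self]
      · rw [if_neg (fun h => hpt (by exact_mod_cast h.2)), f5 p hp]
        by_cases hc : bitOff e j ≤ p ∧ p < bitOff e j + t
        · rw [if_pos hc, if_pos ⟨hc.1, by omega⟩]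
        · rw [if_neg hc, if_neg (by omega)]
    · rw [Store.write_of_ne _ (by omega), h43]
  · intro p hp
    rw [if_neg (by omega), hbits p hp]
  · simp only [Finset.sum_const, Finset.card_range, smul_eq_mul]
    exact Nat.add_le_add_right (Nat.mul_le_mul_left _ (by omega)) _
  · rintro φ ⟨f1, f4, f5⟩
    refine ⟨f1, f4, fun p hp => ?_⟩
    rw [f5 p hp]
    split_ifs with hp'
    · rfl
    · have hne : bitOwner e n p ≠ j := by
        intro heq
        obtain ⟨-, b2, b3⟩ := bitOwner_spec e hp
        rw [heq] at b2 b3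
        exact hp' ⟨b2, b3⟩
      rw [bitAt, bitAt, Function.update_of_ne hne]

/-- Here `a` and `b` are the lengths for `h i` and `h j`, and `c` is the bound for the numerator.
The mixed terms `a * b` must go into `(a + 1) * (a + b + W)`, whose sum over the rows is bounded
through the total of the lengths `a`. -/
theorem entry_cost_le {D W L a b c : ℕ} (hL : L ≤ b + W) (hW : 1 ≤ W) (hb : b ≤ D)
    (hc : c = a + b + 2 * W + 1) :
    D * (100 * (W + (L + W))) + 40 * W +
      (((a + 1) * (a + b + 2 * W) + 20 * (a + b + 2 * W) + 60 * W) +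
        ((c * (b + 1) + (c + b) * (b + 1) + 20 * (c + b) + 60 * W) +
          ((30 * W + 10 * b) + (b * (100 * W + 20 * b) + 30 * W)))) ≤
      1000 * ((D + 1) * (W + b) + (a + 1) * (a + b + W)) := by
  have b1 : D * (100 * (W + (L + W))) ≤ (D + 1) * (300 * (W + b)) :=
    Nat.mul_le_mul (by omega) (by omega)
  have b2 : (a + 1) * (a + b + 2 * W) ≤ (a + 1) * (2 * (a + b + W)) :=
    Nat.mul_le_mul_left _ (by omega)
  have b3 : (c + b) * (b + 1) ≤ 3 * (a * (a + b + W)) +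
      3 * (b * (W + b)) + 3 * (W + b) + 3 * a := by
    rw [hc]
    nlinarith [Nat.zero_le (a * a), Nat.zero_le (a * b), Nat.mul_le_mul_left a hW,
      Nat.mul_le_mul_left b hW]
  have b4 : b * (W + b) ≤ (D + 1) * (W + b) := Nat.mul_le_mul_right _ (by omega)
  have b5 : W + b ≤ (D + 1) * (W + b) := Nat.le_mul_of_pos_left _ (by omega)
  have b6 : c * (b + 1) ≤ (c + b) * (b + 1) := Nat.mul_le_mul_right _ (by omega)
  have b7 : b * (100 * W + 20 * b) ≤ 100 * (b * (W + b)) := by nlinarith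
  have b8 : (a + 1) * (a + b + W) = a * (a + b + W) + (a + b + W) := by ring
  have b9 : (D + 1) * (300 * (W + b)) = 300 * ((D + 1) * (W + b)) := by ring
  have b10 : (a + 1) * (2 * (a + b + W)) = 2 * ((a + 1) * (a + b + W)) := by ring
  omega

/-- The scalar product covers the entries strictly between the diagonal and column `j`. The diagonal
term is multiplied out separately, since `h i` may equal `2 ^ resBits h i` and then does not fit
into its block; the shift by `resBits h i` brings it to the same `L` digits. -/
theorem runs_entry {i j L x : ℕ} {v row : ℕ → ℕ} {z : ℕ → ℚ} {σ : Store}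
    (hR : Ready σ n g s h) (hij : i < j) (hj : j < n) (hh : ∀ k < n, 0 < h k)
    (h5 : ∀ k < n, σ 5 (k : ℤ) 0 = (h k : ℤ))
    (h40 : σ 40 0 0 = (j : ℤ)) (h42 : σ 42 0 0 = (i : ℤ)) (h44 : σ 44 0 0 = (resBits h j : ℤ))
    (hL : σ 32 0 0 = (L : ℤ)) (hLe : L = resBits h j + g)
    (hwin : ∀ p < bitOff (resBits h) n,
      σ 31 (p : ℤ) 0 = (windowAt (resBits h) n v L p : ℤ))
    (hbits : ∀ p < bitOff (resBits h) n, σ 24 (i : ℤ) (p : ℤ) = (bitAt (resBits h) n row p : ℤ))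
    (hrow : ∀ k < n, row k < 2 ^ resBits h k)
    (h50 : σ 50 (i : ℤ) (j : ℤ) = (v i : ℤ)) (hv : v i < 2 ^ (resBits h i + resBits h j + 2 * g))
    (hvz : ∀ k < n, Approx 2 (L + resBits h k) (z k) (v k))
    (hx : x < h j) (hint : ∃ y : ℤ, (h i : ℚ) * z i + ∑ k ∈ Finset.range n, (row k : ℚ) * z k +
      (x : ℚ) / h j = y)
    (hg : 3 * (bitOff (resBits h) n + 1) < 2 ^ g) (hgW : g ≤ W)
    (hW : bitlen ((2 * (n + bitOff (resBits s) n + bitOff (resBits h) n + g + 1) : ℕ) : ℤ) ≤ W) :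
    Runs .entry σ (1000 * ((bitOff (resBits h) n + 1) * (W + resBits h j) +
        (resBits h i + 1) * (resBits h i + resBits h j + W))) fun τ =>
      Agree [7, 24, 33, 37, 43] σ τ ∧
      (∀ a b : ℤ, τ 7 a b = if a = i ∧ b = j then (x : ℤ) else σ 7 a b) ∧
      (∀ a b : ℤ, a ≠ i → τ 24 a b = σ 24 a b) ∧
      ∀ p < bitOff (resBits h) n,
        τ 24 (i : ℤ) (p : ℤ) = (bitAt (resBits h) n (Function.update row j x) p : ℤ) := by
  have hi : i < n := hij.trans hj
  have hnW : bitlen (n : ℤ) ≤ W := (bitlen_cast_mono (by omega)).trans hW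
  have hW1 := (one_le_bitlen _).trans hnW
  have hDW : bitlen (bitOff (resBits h) n : ℤ) ≤ W := (bitlen_cast_mono (by omega)).trans hW
  have hei := resBits_le_bitOff h hi
  have hej := resBits_le_bitOff h hj
  have hoj : bitOff (resBits h) j + resBits h j ≤ bitOff (resBits h) n := by
    rw [← bitOff_succ]; exact bitOff_mono _ hj
  have hhi : bitlen (h i : ℤ) ≤ resBits h i + 1 := bitlen_le_resBits le_rfl (hh i hi)
  have hhj : bitlen (h j : ℤ) ≤ resBits h j + 1 := bitlen_le_resBits le_rfl (hh j hj)
  have hxb : bitlen (x : ℤ) ≤ resBits h j + 1 := bitlen_le_resBits hx.le (hh j hj)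
  have hhi2 : h i ≤ 2 ^ resBits h i := by
    have := lt_two_pow_resBits (s := h) (k := i) (x := h i - 1) (by have := hh i hi; omega)
    omega
  have hhj2 : h j ≤ 2 ^ resBits h j := by
    have := lt_two_pow_resBits (s := h) (k := j) (x := h j - 1) (by have := hh j hj; omega)
    omega
  set e := resBits h with he
  set D := bitOff e n with hD
  have hiW : bitlen (i : ℤ) ≤ W := (bitlen_cast_mono hi.le).trans hnW
  have hjW : bitlen (j : ℤ) ≤ W := (bitlen_cast_mono hj.le).trans hnW
  have heiW : bitlen (e i : ℤ) ≤ W := (bitlen_cast_mono (by omega)).trans hW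
  have hejW : bitlen (e j : ℤ) ≤ W := (bitlen_cast_mono (by omega)).trans hW
  have hLW : bitlen (L : ℤ) ≤ W := (bitlen_cast_mono (by omega)).trans hW
  have hoffW : bitlen (bitOff e j : ℤ) ≤ W := (bitlen_cast_mono (by omega)).trans hDW
  have hD2 : D < 2 ^ W := by
    have h6 : 2 ^ g ≤ 2 ^ W := Nat.pow_le_pow_right (by norm_num) hgW
    omega
  have hDL : D * 2 ^ L < 2 ^ (L + W) := by
    rw [pow_add, mul_comm]
    exact Nat.mul_lt_mul_of_pos_left hD2 (by positivity)
  set acc := ∑ p ∈ Finset.range D, bitAt e n row p * windowAt e n v L p with hacc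
  have hacc2 : acc < 2 ^ (L + W) := by
    refine lt_of_le_of_lt ?_ hDL
    refine (Finset.sum_le_card_nsmul _ _ (2 ^ L) fun p _ => ?_).trans (by simp)
    have := Nat.mul_le_mul (bitAt_le e n row p) (windowAt_lt e n v L p).le
    omega
  have haccB : bitlen (acc : ℤ) ≤ L + W := bitlen_cast_le (by omega) hacc2
  set q := h i * v i / 2 ^ e i with hq
  have hqv : q ≤ v i := by
    rw [hq]
    exact Nat.div_le_of_le_mul (Nat.mul_le_mul_right _ hhi2)
  have hvB : bitlen (v i : ℤ) ≤ e i + e j + 2 * W :=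
    bitlen_cast_le (by omega) (hv.trans_le (Nat.pow_le_pow_right (by norm_num) (by omega)))
  have hhvB : bitlen ((h i * v i : ℕ) : ℤ) ≤ 2 * e i + e j + 2 * W := by
    refine bitlen_cast_le (by omega) ?_
    calc h i * v i < 2 ^ e i * 2 ^ (e i + e j + 2 * g) :=
          Nat.mul_lt_mul_of_le_of_lt hhi2 hv (by positivity)
      _ = 2 ^ (2 * e i + e j + 2 * g) := by rw [← pow_add]; congr 1; ring
      _ ≤ _ := Nat.pow_le_pow_right (by norm_num) (by omega)
  set bA := e i + e j + 2 * W + 1 with hbA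
  have hA2 : acc + q < 2 ^ bA := by
    have h6 : acc < 2 ^ (e i + e j + 2 * W) :=
      hacc2.trans_le (Nat.pow_le_pow_right (by norm_num) (by omega))
    have h7 : q < 2 ^ (e i + e j + 2 * W) :=
      (hqv.trans_lt hv).trans_le (Nat.pow_le_pow_right (by norm_num) (by omega))
    rw [hbA, pow_succ]
    omega
  have hAB : bitlen ((acc + q : ℕ) : ℤ) ≤ bA := bitlen_cast_le (by omega) hA2
  -- Each entry of the column has error 2, and the cut adds 1: that gives 3 units for each of the
  -- `D` windows and 3 for the diagonal term.
  have happ : Approx (D * 3 + 3) L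
      ((h i : ℚ) * z i + ∑ k ∈ Finset.range n, (row k : ℚ) * z k) (acc + q) := by
    have h6 := approx_windows (ℓ := e) (n := n) (E := 2) (L := L) (z := z) (v := v) (x := row)
      (fun k hk _ => hvz k hk) hrow
    have h7 : Approx (2 + 1) L ((h i : ℚ) * z i) q :=
      ((hvz i hi).nat_mul (h i)).shift (F := 2) (by rw [mul_comm]; gcongr)
    rw [add_comm ((h i : ℚ) * z i)]
    exact h6.add h7
  -- From `3 * (D + 1) < 2 ^ g` and `h j ≤ 2 ^ e j`, the error times `h j` is below `2 ^ L`, which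
  -- is what `Approx.recover` requires.
  have hrec : (0 - ((acc + q : ℕ) : ℤ)) * (h j : ℤ) / 2 ^ L % (h j : ℤ) = (x : ℤ) := by
    rw [zero_sub]
    refine happ.recover ?_ hx hint
    rw [hLe, pow_add, mul_comm]
    exact Nat.mul_lt_mul_of_le_of_lt hhj2 (by omega) (by positivity)
  have hnegB : bitlen (0 - ((acc + q : ℕ) : ℤ)) ≤ bA :=
    (bitlen_mono (by rw [zero_sub, Int.natAbs_neg])).trans hAB
  have hprodB : bitlen ((0 - ((acc + q : ℕ) : ℤ)) * (h j : ℤ)) ≤ bA + e j := by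
    refine bitlen_le (by omega) ?_
    rw [zero_sub, Int.natAbs_mul, Int.natAbs_neg, Int.natAbs_natCast, Int.natAbs_natCast, pow_add]
    exact Nat.mul_lt_mul_of_lt_of_le hA2 hhj2 (by positivity)
  have hshB := (bitlen_ediv_le ((0 - ((acc + q : ℕ) : ℤ)) * (h j : ℤ)) (2 ^ L)).trans hprodB
  have hquB := (bitlen_ediv_le ((0 - ((acc + q : ℕ) : ℤ)) * (h j : ℤ) / 2 ^ L) (h j)).trans hshB
  refine ((runs_dot (a := 24) (o := 20) (by omega) (by omega) (by omega) (D := D) (W := W)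
    (B := L + W) (L := L) (r := i) (w := windowAt e n v L) (b := bitAt e n row)
    hR.layoutH.total h42 hbits (fun p _ => bitAt_le _ _ _ p) hwin
    (fun p _ => windowAt_lt _ _ _ _ _) hDL (by omega) hiW hDW).seq
    (c' := (((e i + 1) * (e i + e j + 2 * W) + 20 * (e i + e j + 2 * W) + 60 * W) +
      ((bA * (e j + 1) + (bA + e j) * (e j + 1) + 20 * (bA + e j) + 60 * W) +
        ((30 * W + 10 * e j) + (e j * (100 * W + 20 * e j) + 30 * W))))) ?_).mono ?_ fun _ h => h
  · rintro τ ⟨h1, h33⟩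
    have t42 : τ 42 0 0 = (i : ℤ) := by rw [h1 42 (by simp), h42]
    have t40 : τ 40 0 0 = (j : ℤ) := by rw [h1 40 (by simp), h40]
    have t5 : τ 5 = σ 5 := h1 5 (by simp)
    have hR1 := hR.agree h1 (by simp)
    refine (Runs.set_evals (v := ((acc + q : ℕ) : ℤ))
      (Q := fun υ => υ = τ.write 33 0 0 ((acc + q : ℕ) : ℤ))
      (.nat_add (.reg h33 haccB) (.nat_shr (.nat_mul
        (.cell (.reg t42 hiW) .zero (by rw [t5, h5 i hi]) hhi)
        (.cell (.reg t42 hiW) (.reg t40 hjW) (by rw [h1 50 (by simp), h50]) hvB) hhvB)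
        (.cell (.reg t42 hiW) .zero (hR1.layoutH.len i hi) heiW)) hAB) ?_ rfl).seq ?_
    · have : (e i + 1) * (e i + e j + 2 * W) = (e i + 1) * (e i + e j + 2 * W) := rfl
      omega
    rintro υ rfl
    refine (Runs.set_evals (v := (x : ℤ)) (b := e j + 1)
      (ce := bA * (e j + 1) + (bA + e j) * (e j + 1) + 10 * (bA + e j) + 40 * W)
      (Q := fun υ => υ = (τ.write 33 0 0 ((acc + q : ℕ) : ℤ)).write 37 0 0 (x : ℤ))
      ?_ (by omega) rfl).seq ?_
    · rw [← hrec]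
      refine (Evals.rem (Evals.shr (Evals.mul (Evals.zero.sub (.reg (Store.write_self _ _ _ _ _) hAB)
        hnegB) (.cell (.reg (v := (j : ℤ)) ?_ hjW) .zero (v := (h j : ℤ)) ?_ hhj) hprodB)
        (.reg (v := (L : ℤ)) ?_ hLW) hshB)
        (.cell (.reg (v := (j : ℤ)) ?_ hjW) .zero (v := (h j : ℤ)) ?_ hhj) hquB
        (by rw [hrec]; exact hxb)).mono (by omega)
      · rw [Store.write_of_ne _ (by omega), t40]
      · rw [Store.write_of_ne _ (by omega), t5, h5 j hj]
      · rw [Store.write_of_ne _ (by omega), h1 32 (by simp), hL]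
      · rw [Store.write_of_ne _ (by omega), t40]
      · rw [Store.write_of_ne _ (by omega), t5, h5 j hj]
    rintro υ rfl
    obtain ⟨υ, hυ⟩ : ∃ υ, υ = (τ.write 33 0 0 ((acc + q : ℕ) : ℤ)).write 37 0 0 (x : ℤ) := ⟨_, rfl⟩
    have u1 : Agree [33, 37, 43] σ υ := by
      rw [hυ]
      exact ((h1.mono (by simp)).write (by simp) _ _ _).write (by simp) _ _ _
    have u42 : υ 42 0 0 = (i : ℤ) := by rw [u1 42 (by simp), h42]
    have u40 : υ 40 0 0 = (j : ℤ) := by rw [u1 40 (by simp), h40]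
    have u37 : υ 37 0 0 = (x : ℤ) := by rw [hυ, Store.write_self]
    have u7 : υ 7 = σ 7 := u1 7 (by simp)
    have u24 : υ 24 = σ 24 := u1 24 (by simp)
    rw [← hυ]
    refine (Runs.assign_evals (Q := fun φ => φ = υ.write 7 (i : ℤ) (j : ℤ) (x : ℤ))
      (.reg u42 hiW) (.reg u40 hjW) (.reg u37 hxb) (by omega) rfl).seq ?_
    rintro φ rfl
    have w1 : Agree [7, 24, 33, 37, 43] σ (υ.write 7 (i : ℤ) (j : ℤ) (x : ℤ)) :=
      (u1.mono (by simp)).write (by simp) _ _ _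
    refine (runs_entry_bits (i := i) (j := j) (x := x) (row := row) (hR.agree w1 (by simp)) hj
      (by rw [w1 40 (by simp), h40]) (by rw [w1 42 (by simp), h42])
      (by rw [w1 44 (by simp), h44]) (by rw [Store.write_of_ne _ (by omega), u37]) hxb ?_ hiW hjW
      hDW).mono le_rfl ?_
    · intro p hp
      rw [Store.write_of_ne _ (by omega), u24, hbits p hp]
    · rintro φ ⟨f1, f4, f5⟩
      refine ⟨w1.trans f1 (by simp), fun a b => ?_, fun a b hab => ?_, f5⟩
      · rw [f1 7 (by simp), Store.write_same, u7]
      · rw [f4 a b hab, Store.write_of_ne _ (by omega), u24]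
  · exact entry_cost_le (by omega) hW1 hej hbA

end Entry

/-- The part strictly between the diagonal and column `c` of row `r`. -/
def partialRow (H : ℕ → ℕ → ℕ) (r c m : ℕ) : ℕ := if r < m ∧ m < c then H r m else 0

theorem update_partialRow (H : ℕ → ℕ → ℕ) {r c : ℕ} (hrc : r < c) :
    Function.update (partialRow H r c) c (H r c) = partialRow H r (c + 1) := by
  funext m
  by_cases hm : m = c
  · subst hm
    simp [partialRow, hrc]
  · rw [Function.update_of_ne hm, partialRow, partialRow]
    have : (r < m ∧ m < c) ↔ (r < m ∧ m < c + 1) := by omega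
    simp only [this]

theorem partialRow_of_le (H : ℕ → ℕ → ℕ) {r c : ℕ} (hrc : c ≤ r + 1) : partialRow H r c = 0 := by
  funext m
  rw [partialRow, if_neg (by omega), Pi.zero_apply]

theorem bitAt_zero (ℓ : ℕ → ℕ) (n p : ℕ) : bitAt ℓ n 0 p = 0 := by simp [bitAt]

/-- Computes the entries above the diagonal in column `40` of the Hermite form. -/
def Prog.column : Prog :=
  .seq (.set 32 (.add (.cell 23 (.reg 40) (.const 0)) (.reg 34)))
    (.seq (.set 44 (.cell 23 (.reg 40) (.const 0)))
      (.seq (.forTo 41 0 (.assign 30 (.reg 41) (.const 0) (.cell 50 (.reg 41) (.reg 40))))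
        (.seq (.window 20) (.forTo 42 40 .entry))))

/-- The arrays that `Prog.column` changes. -/
abbrev columnArrays : List ℕ := [7, 24, 30, 31, 32, 33, 36, 37, 41, 42, 43, 44]

section Column

variable {n W g : ℕ} {s h : ℕ → ℕ}

theorem runs_load_column {j B : ℕ} {v : ℕ → ℕ} {σ : Store} (hn : σ 0 0 0 = (n : ℤ)) (hj : j < n)
    (h40 : σ 40 0 0 = (j : ℤ)) (hv50 : ∀ m < n, σ 50 (m : ℤ) (j : ℤ) = (v m : ℤ))
    (hvB : ∀ m < n, bitlen (v m : ℤ) ≤ B) (hnW : bitlen (n : ℤ) ≤ W) :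
    Runs (.forTo 41 0 (.assign 30 (.reg 41) (.const 0) (.cell 50 (.reg 41) (.reg 40)))) σ
      (n * (60 * (W + B)) + 30 * W) fun τ =>
      Agree [30, 41] σ τ ∧ ∀ m < n, τ 30 (m : ℤ) 0 = (v m : ℤ) := by
  have hW1 := (one_le_bitlen _).trans hnW
  refine (Runs.forTo (v := 41) (b := 0) (N := n) (W := W)
    (I := fun k τ => Agree [30, 41] σ τ ∧ ∀ m < k, τ 30 (m : ℤ) 0 = (v m : ℤ))
    (f := fun _ => 30 * (W + B)) ?_ ?_ hnW ?_ ⟨Agree.refl _ _, by simp⟩).mono ?_ fun _ h => h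
  · rintro k τ x ⟨h1, h2⟩
    refine ⟨h1.write (by simp) _ _ _, ?_⟩
    rwa [Store.write_of_ne _ (by omega)]
  · rintro k τ ⟨h1, -⟩
    rw [h1 0 (by simp), hn]
  · rintro k hk τ ⟨h1, h2⟩ h41
    have hkW : bitlen (k : ℤ) ≤ W := (bitlen_cast_mono hk.le).trans hnW
    have hjW : bitlen (j : ℤ) ≤ W := (bitlen_cast_mono hj.le).trans hnW
    have t40 : τ 40 0 0 = (j : ℤ) := by rw [h1 40 (by simp), h40]
    refine Runs.assign_evals (.reg h41 hkW) .zero (.cell (.reg h41 hkW) (.reg t40 hjW)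
      (by rw [h1 50 (by simp), hv50 k hk]) (hvB k hk)) (by omega)
      ⟨⟨h1.write (by simp) _ _ _, ?_⟩, ?_⟩
    · intro i hi
      rw [Store.write_same]
      split_ifs with h
      · have : i = k := by exact_mod_cast h.1
        rw [this]
      · exact h2 i (lt_of_le_of_ne (by omega) fun h' => h ⟨by rw [h'], rfl⟩)
    · rw [Store.write_of_ne _ (by omega), h41]
  · simp only [Finset.sum_const, Finset.card_range, smul_eq_mul]
    exact Nat.add_le_add_right (Nat.mul_le_mul_left _ (by omega)) _

theorem column_cost_le {D W b j S : ℕ} (hW : 1 ≤ W) (hj : j < n) (hS : S ≤ D) :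
    60 * W + (60 * W + ((n * (60 * (W + (b + D + 2 * W))) + 30 * W) +
      ((D * (200 * (W + (b + D + 2 * W))) + 30 * W) +
      (j * (1000 * ((D + 1) * (W + b))) + (S + j) * (1000 * (D + b + W)) + j * (30 * W) +
        30 * W)))) ≤
      3000 * ((D + n) * (W + b + D) + n * (D + 1) * (W + b)) := by
  have b1 : n * (60 * (W + (b + D + 2 * W))) ≤ (D + n) * (180 * (W + b + D)) :=
    Nat.mul_le_mul (by omega) (by omega)
  have b2 : D * (200 * (W + (b + D + 2 * W))) ≤ (D + n) * (600 * (W + b + D)) :=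
    Nat.mul_le_mul (by omega) (by omega)
  have b3 : j * (1000 * ((D + 1) * (W + b))) ≤ n * (1000 * ((D + 1) * (W + b))) :=
    Nat.mul_le_mul_right _ (by omega)
  have b4 : (S + j) * (1000 * (D + b + W)) ≤ (D + n) * (1000 * (W + b + D)) :=
    Nat.mul_le_mul (by omega) (by omega)
  have b5 : j * (30 * W) ≤ (D + n) * (30 * (W + b + D)) :=
    Nat.mul_le_mul (by omega) (by omega)
  have b6 : W + b + D ≤ (D + n) * (W + b + D) := Nat.le_mul_of_pos_left _ (by omega)
  nlinarith

/-- The windows depend only on the column and are formed once, with `L = e_j + g` digits; the rows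
differ only in their bits. Row `i` reads its own entries left of column `j`, so the rows of a column
are independent of each other. -/
theorem runs_column {j : ℕ} {H : ℕ → ℕ → ℕ} {v : ℕ → ℕ} {z : ℕ → ℚ} {σ : Store}
    (hR : Ready σ n g s h) (hj : j < n) (hh : ∀ k < n, 0 < h k)
    (h5 : ∀ k < n, σ 5 (k : ℤ) 0 = (h k : ℤ)) (h40 : σ 40 0 0 = (j : ℤ))
    (hH : ∀ i k, i < k → k < n → H i k < h k)
    (hbits : ∀ r < n, ∀ p < bitOff (resBits h) n,
      σ 24 (r : ℤ) (p : ℤ) = (bitAt (resBits h) n (partialRow H r j) p : ℤ))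
    (h50 : ∀ m < n, σ 50 (m : ℤ) (j : ℤ) = (v m : ℤ))
    (hv : ∀ m < n, v m < 2 ^ (resBits h m + resBits h j + 2 * g))
    (hvz : ∀ m < n, Approx 2 (resBits h m + resBits h j + g) (z m) (v m))
    (hint : ∀ i < j, ∃ y : ℤ, (h i : ℚ) * z i +
      ∑ k ∈ Finset.range n, (partialRow H i j k : ℚ) * z k + (H i j : ℚ) / h j = y)
    (hg : 3 * (bitOff (resBits h) n + 1) < 2 ^ g) (hgW : g ≤ W)
    (hW : bitlen ((2 * (n + bitOff (resBits s) n + bitOff (resBits h) n + g + 1) : ℕ) : ℤ) ≤ W) :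
    Runs .column σ (3000 * ((bitOff (resBits h) n + n) *
        (W + resBits h j + bitOff (resBits h) n) +
          n * (bitOff (resBits h) n + 1) * (W + resBits h j))) fun τ =>
      Agree columnArrays σ τ ∧
      (∀ r c : ℕ, τ 7 (r : ℤ) (c : ℤ) =
        if r < j ∧ c = j then (H r j : ℤ) else σ 7 (r : ℤ) (c : ℤ)) ∧
      ∀ r < n, ∀ p < bitOff (resBits h) n,
        τ 24 (r : ℤ) (p : ℤ) = (bitAt (resBits h) n (partialRow H r (j + 1)) p : ℤ) := by
  have hnW : bitlen (n : ℤ) ≤ W := (bitlen_cast_mono (by omega)).trans hW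
  have hW1 := (one_le_bitlen _).trans hnW
  have hDW : bitlen (bitOff (resBits h) n : ℤ) ≤ W := (bitlen_cast_mono (by omega)).trans hW
  have hej := resBits_le_bitOff h hj
  have hjW : bitlen (j : ℤ) ≤ W := (bitlen_cast_mono hj.le).trans hnW
  set e := resBits h with he
  set D := bitOff e n with hD
  have hejW : bitlen (e j : ℤ) ≤ W := (bitlen_cast_mono (by omega)).trans hW
  have hgW' : bitlen (g : ℤ) ≤ W := (bitlen_cast_mono (by omega)).trans hW
  obtain ⟨L, hL⟩ : ∃ L, L = e j + g := ⟨_, rfl⟩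
  have hLW : bitlen (L : ℤ) ≤ W := (bitlen_cast_mono (by omega)).trans hW
  have hvB : ∀ m < n, bitlen (v m : ℤ) ≤ e j + D + 2 * W := fun m hm => by
    have h1 : e m ≤ D := resBits_le_bitOff h hm
    have h2 := hv m hm
    exact bitlen_cast_le (by omega) ((hv m hm).trans_le
      (Nat.pow_le_pow_right (by norm_num) (by omega)))
  have hrow : ∀ i k, k < n → partialRow H i j k < 2 ^ e k := by
    intro i k hk
    unfold partialRow
    split_ifs with hik
    · exact lt_two_pow_resBits (hH i k hik.1 hk)
    · positivity
  refine ((Runs.set_evals (c := 60 * W) (Q := fun τ => τ = σ.write 32 0 0 (L : ℤ))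
    (.nat_add (b := W) (.cell (.reg h40 hjW) .zero (hR.layoutH.len j hj) hejW) (.reg hR.guard hgW')
      ((bitlen_cast_mono hL.ge).trans hLW)) (by omega) (by rw [hL])).seq (c' := 60 * W +
      ((n * (60 * (W + (e j + D + 2 * W))) + 30 * W) +
      ((D * (200 * (W + (e j + D + 2 * W))) + 30 * W) +
      (j * (1000 * ((D + 1) * (W + e j))) + (bitOff e j + j) * (1000 * (D + e j + W)) +
        j * (30 * W) + 30 * W)))) ?_).mono
    (column_cost_le hW1 hj (bitOff_mono e hj.le)) fun _ h => h
  rintro τ rfl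
  have f1 : Agree columnArrays σ (σ.write 32 0 0 (L : ℤ)) :=
    (Agree.refl _ _).write (by simp) _ _ _
  have hR1 := hR.agree f1 (by simp)
  have f40 : (σ.write 32 0 0 (L : ℤ)) 40 0 0 = (j : ℤ) := by rw [f1 40 (by simp), h40]
  refine (Runs.set_evals (c := 60 * W)
    (Q := fun τ => τ = (σ.write 32 0 0 (L : ℤ)).write 44 0 0 (e j : ℤ))
    (.cell (.reg f40 hjW) .zero (hR1.layoutH.len j hj) hejW) (by omega) rfl).seq ?_
  rintro τ rfl
  obtain ⟨τ, hτ⟩ : ∃ τ, τ = (σ.write 32 0 0 (L : ℤ)).write 44 0 0 (e j : ℤ) := ⟨_, rfl⟩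
  rw [← hτ]
  have g1 : Agree [32, 44] σ τ := by
    rw [hτ]
    exact ((Agree.refl _ _).write (by simp) _ _ _).write (by simp) _ _ _
  have g32 : τ 32 0 0 = (L : ℤ) := by
    rw [hτ, Store.write_of_ne _ (by omega), Store.write_self]
  have g44 : τ 44 0 0 = (e j : ℤ) := by rw [hτ, Store.write_self]
  clear hτ
  refine (runs_load_column (W := W) (n := n) (j := j) (B := e j + D + 2 * W) (v := v)
    (hR.agree g1 (by simp)).dim hj (by rw [g1 40 (by simp), h40])
    (by rw [g1 50 (by simp)]; exact h50) hvB hnW).seq ?_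
  rintro υ ⟨u1, u30⟩
  have u2 : Agree columnArrays σ υ := (g1.mono (by simp)).trans u1 (by simp)
  refine (runs_window (o := 20) (by omega) (by omega) (B := e j + D + 2 * W) (L := L) (W := W)
    (hR.agree u2 (by simp)).layoutH u30 hvB (by rw [u1 32 (by simp), g32]) (by omega)
    hLW hnW hDW).seq ?_
  rintro φ ⟨w1, w31⟩
  have w2 : Agree [30, 31, 32, 36, 41, 43, 44] σ φ :=
    ((g1.mono (by simp)).trans u1 (by simp)).trans w1 (by simp)
  have w32 : φ 32 0 0 = (L : ℤ) := by rw [w1 32 (by simp), u1 32 (by simp), g32]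
  have w44 : φ 44 0 0 = (e j : ℤ) := by rw [w1 44 (by simp), u1 44 (by simp), g44]
  refine (Runs.forTo (v := 42) (b := 40) (N := j) (W := W)
    (I := fun i τ => Agree [7, 24, 33, 37, 42, 43] φ τ ∧
      (∀ r c : ℕ, τ 7 (r : ℤ) (c : ℤ) =
        if r < i ∧ c = j then (H r j : ℤ) else σ 7 (r : ℤ) (c : ℤ)) ∧
      ∀ r < n, ∀ p < D, τ 24 (r : ℤ) (p : ℤ) =
        (bitAt e n (partialRow H r (if r < i then j + 1 else j)) p : ℤ))
    (f := fun i => 1000 * ((D + 1) * (W + e j) + (e i + 1) * (e i + e j + W))) ?_ ?_ hjW ?_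
    ⟨Agree.refl _ _, ?_, ?_⟩).mono ?_ ?_
  · rintro i τ y ⟨t1, t2, t3⟩
    refine ⟨t1.write (by simp) _ _ _, ?_⟩
    simp only [Store.write_of_ne _ (show 7 ≠ 42 by omega),
      Store.write_of_ne _ (show 24 ≠ 42 by omega)]
    exact ⟨t2, t3⟩
  · rintro i τ ⟨t1, -⟩
    rw [t1 40 (by simp), w2 40 (by simp), h40]
  · rintro i hi τ ⟨t1, t2, t3⟩ h42
    have t4 : Agree columnArrays σ τ := (w2.mono (by simp)).trans t1 (by simp)
    refine (runs_entry (i := i) (j := j) (L := L) (x := H i j) (v := v) (row := partialRow H i j)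
      (z := z) (hR.agree t4 (by simp)) hi hj hh (by rw [t4 5 (by simp)]; exact h5)
      (by rw [t4 40 (by simp), h40]) h42 (by rw [t1 44 (by simp), w44])
      (by rw [t1 32 (by simp), w32]) hL (by rw [t1 31 (by simp)]; exact w31) ?_ (hrow i)
      (by rw [t4 50 (by simp), h50 i (hi.trans hj)]) (hv i (hi.trans hj)) ?_ (hH i j hi hj)
      (hint i hi) hg hgW hW).mono le_rfl ?_
    · intro p hp
      rw [t3 i (hi.trans hj) p hp, if_neg (lt_irrefl i)]
    · intro k hk
      have := hvz k hk
      rwa [show L + resBits h k = resBits h k + e j + g by omega]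
    · rintro ψ ⟨x1, x2, x3, x4⟩
      refine ⟨⟨t1.trans x1 (by simp), fun r c => ?_, fun r hr p hp => ?_⟩, ?_⟩
      · rw [x2]
        by_cases hrc : r = i ∧ c = j
        · rw [if_pos ⟨by rw [hrc.1], by rw [hrc.2]⟩, if_pos ⟨by omega, hrc.2⟩, hrc.1]
        · rw [if_neg (fun h => hrc ⟨by exact_mod_cast h.1, by exact_mod_cast h.2⟩), t2]
          by_cases hc : r < i ∧ c = j
          · rw [if_pos hc, if_pos ⟨by omega, hc.2⟩]
          · rw [if_neg hc, if_neg (by omega)]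
      · by_cases hri : r = i
        · subst hri
          rw [if_pos (by omega), x4 p hp, update_partialRow H hi]
        · rw [x3 _ _ (by exact_mod_cast hri), t3 r hr p hp]
          by_cases hr' : r < i
          · rw [if_pos hr', if_pos (by omega)]
          · rw [if_neg hr', if_neg (by omega)]
      · rw [x1 42 (by simp), h42]
  · intro r c
    rw [if_neg (by omega), w2 7 (by simp)]
  · intro r hr p hp
    rw [if_neg (by omega), w2 24 (by simp), hbits r hr p hp]
  · have h6 : ∑ i ∈ Finset.range j, (1000 * ((D + 1) * (W + e j) + (e i + 1) * (e i + e j + W)) +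
        30 * W) ≤ ∑ i ∈ Finset.range j, (1000 * ((D + 1) * (W + e j)) +
          (e i + 1) * (1000 * (D + e j + W)) + 30 * W) := by
      refine Finset.sum_le_sum fun i hi => ?_
      have hin : i < n := (Finset.mem_range.1 hi).trans hj
      have h7 : e i ≤ D := resBits_le_bitOff h hin
      have h8 : (e i + 1) * (e i + e j + W) ≤ (e i + 1) * (D + e j + W) :=
        Nat.mul_le_mul_left _ (by omega)
      have h9 : (e i + 1) * (1000 * (D + e j + W)) = 1000 * ((e i + 1) * (D + e j + W)) := by ring
      omega
    refine Nat.add_le_add_right (h6.trans (le_of_eq ?_)) _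
    rw [Finset.sum_add_distrib, Finset.sum_add_distrib,
      ← Finset.sum_mul (s := Finset.range j) (f := fun i => e i + 1), Finset.sum_add_distrib]
    simp [bitOff]
  · rintro ψ ⟨x1, x2, x3⟩
    refine ⟨(w2.mono (by simp)).trans x1 (by simp), x2, fun r hr p hp => ?_⟩
    rw [x3 r hr p hp]
    by_cases hrj : r < j
    · rw [if_pos hrj]
    -- For rows from `j` downwards there is nothing to the right of the diagonal up to column `j`,
    -- so both partial rows are zero.
    · rw [if_neg hrj, partialRow_of_le H (by omega), partialRow_of_le H (by omega)]

/-- Computes the Hermite form from its diagonal and the array `50`. -/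
def Prog.triangle : Prog :=
  .forTo 40 0 (.seq (.assign 7 (.reg 40) (.reg 40) (.cell 5 (.reg 40) (.const 0)))
    (.branch (.cell 23 (.reg 40) (.const 0)) .column .skip))

/-- The upper triangular matrix with diagonal `h` and the entries of `H` above the diagonal. -/
def triangleEntry (H : ℕ → ℕ → ℕ) (h : ℕ → ℕ) (r c : ℕ) : ℕ :=
  if r < c then H r c else if r = c then h c else 0

/-- If `h j = 1`, the entries above the diagonal are zero and block `j` is empty, so the column is
finished once its diagonal entry is written. Only columns of positive length call `Prog.column`, and
only for them must the fractions be accurate. -/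
theorem runs_triangle {H : ℕ → ℕ → ℕ} {z : ℕ → ℕ → ℚ} {σ : Store}
    (hR : Ready σ n g s h) (hh : ∀ k < n, 0 < h k)
    (h5 : ∀ k < n, σ 5 (k : ℤ) 0 = (h k : ℤ))
    (hH : ∀ i k, i < k → k < n → H i k < h k)
    (h7 : ∀ r c : ℕ, σ 7 (r : ℤ) (c : ℤ) = 0) (h24 : ∀ r p : ℕ, σ 24 (r : ℤ) (p : ℤ) = 0)
    (h50 : ∀ i < n, ∀ j < n, FracEntry false σ g (resBits h) i j (z i j) (0 < resBits h j))
    (hint : ∀ i j, i < j → j < n → ∃ y : ℤ, (h i : ℚ) * z i j +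
      ∑ k ∈ Finset.range n, (partialRow H i j k : ℚ) * z k j + (H i j : ℚ) / h j = y)
    (hg : 3 * (bitOff (resBits h) n + 1) < 2 ^ g) (hgW : g ≤ W)
    (hW : bitlen ((2 * (n + bitOff (resBits s) n + bitOff (resBits h) n + g + 1) : ℕ) : ℤ) ≤ W) :
    Runs .triangle σ (∑ j ∈ Finset.range n, (100 * W + 2 * resBits h j + if 0 < resBits h j then
        3000 * ((bitOff (resBits h) n + n) * (W + resBits h j + bitOff (resBits h) n) +
          n * (bitOff (resBits h) n + 1) * (W + resBits h j)) else 0) + 30 * W) fun τ =>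
      ∀ r < n, ∀ c < n, τ 7 (r : ℤ) (c : ℤ) = (triangleEntry H h r c : ℤ) := by
  have hnW : bitlen (n : ℤ) ≤ W := (bitlen_cast_mono (by omega)).trans hW
  have hW1 := (one_le_bitlen _).trans hnW
  refine (Runs.forTo (v := 40) (b := 0) (N := n) (W := W)
    (I := fun j τ => Agree (40 :: columnArrays) σ τ ∧
      (∀ r < n, ∀ c < n, τ 7 (r : ℤ) (c : ℤ) = if c < j then (triangleEntry H h r c : ℤ) else 0) ∧
      ∀ r < n, ∀ p < bitOff (resBits h) n,
        τ 24 (r : ℤ) (p : ℤ) = (bitAt (resBits h) n (partialRow H r j) p : ℤ))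
    (f := fun j => 70 * W + 2 * resBits h j + if 0 < resBits h j then
        3000 * ((bitOff (resBits h) n + n) * (W + resBits h j + bitOff (resBits h) n) +
          n * (bitOff (resBits h) n + 1) * (W + resBits h j)) else 0) ?_ ?_ hnW ?_
    ⟨Agree.refl _ _, ?_, ?_⟩).mono ?_ ?_
  · rintro j τ y ⟨h1, h2, h3⟩
    refine ⟨h1.write (by simp) _ _ _, ?_⟩
    simp only [Store.write_of_ne _ (show 7 ≠ 40 by omega),
      Store.write_of_ne _ (show 24 ≠ 40 by omega)]
    exact ⟨h2, h3⟩
  · rintro k τ ⟨h1, -⟩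
    rw [h1 0 (by simp), hR.dim]
  · rintro j hj τ ⟨h1, h2, h3⟩ h40
    have hjW : bitlen (j : ℤ) ≤ W := (bitlen_cast_mono hj.le).trans hnW
    have hej := resBits_le_bitOff h hj
    have hejW : bitlen (resBits h j : ℤ) ≤ W := (bitlen_cast_mono (by omega)).trans hW
    have hhb : bitlen (h j : ℤ) ≤ resBits h j + 1 := bitlen_le_resBits le_rfl (hh j hj)
    refine ((Runs.assign_evals (c := 40 * W + 2 * resBits h j)
      (Q := fun υ => υ = τ.write 7 (j : ℤ) (j : ℤ) (h j : ℤ))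
      (.reg h40 hjW) (.reg h40 hjW) (.cell (.reg h40 hjW) .zero
        (by rw [h1 5 (by simp), h5 j hj]) hhb) (by omega) rfl).seq (c' := 30 * W +
        if 0 < resBits h j then
        3000 * ((bitOff (resBits h) n + n) * (W + resBits h j + bitOff (resBits h) n) +
          n * (bitOff (resBits h) n + 1) * (W + resBits h j)) else 0) ?_).mono
      (by omega) fun _ h => h
    rintro υ rfl
    have g1 : Agree (40 :: columnArrays) σ (τ.write 7 (j : ℤ) (j : ℤ) (h j : ℤ)) :=
      h1.write (by simp) _ _ _
    have hR1 := hR.agree g1 (by simp)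
    have g40 : (τ.write 7 (j : ℤ) (j : ℤ) (h j : ℤ)) 40 0 0 = (j : ℤ) := by
      rw [Store.write_of_ne _ (by omega), h40]
    have g24 : (τ.write 7 (j : ℤ) (j : ℤ) (h j : ℤ)) 24 = τ 24 :=
      Store.write_of_ne _ (by omega) _ _ _
    have g7 : ∀ r < n, ∀ c < n, (τ.write 7 (j : ℤ) (j : ℤ) (h j : ℤ)) 7 (r : ℤ) (c : ℤ) =
        if c < j ∨ c = j ∧ j ≤ r then (triangleEntry H h r c : ℤ) else 0 := by
      intro r hr c hc
      rw [Store.write_same]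
      by_cases hrc : r = j ∧ c = j
      · rw [if_pos ⟨by rw [hrc.1], by rw [hrc.2]⟩, if_pos (Or.inr ⟨hrc.2, hrc.1.ge⟩), hrc.1, hrc.2]
        simp [triangleEntry]
      · rw [if_neg (fun h => hrc ⟨by exact_mod_cast h.1, by exact_mod_cast h.2⟩), h2 r hr c hc]
        by_cases hcj : c < j
        · rw [if_pos hcj, if_pos (Or.inl hcj)]
        · rw [if_neg hcj]
          split_ifs with h'
          · have h8 : c = j ∧ j ≤ r := h'.resolve_left hcj
            have h9 : ¬ r < c ∧ ¬ r = c := by omega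
            simp [triangleEntry, h9.1, h9.2]
          · rfl
    refine Runs.branch_evals (d := 1 + if 0 < resBits h j then
        3000 * ((bitOff (resBits h) n + n) * (W + resBits h j + bitOff (resBits h) n) +
          n * (bitOff (resBits h) n + 1) * (W + resBits h j)) else 0)
      (.cell (.reg g40 hjW) .zero (hR1.layoutH.len j hj) hejW) (by omega) ?_ ?_
    · intro hpos
      have hpos' : 0 < resBits h j := by exact_mod_cast hpos
      rw [if_pos hpos']
      have hvex : ∀ m, ∃ t : ℕ, m < n → (σ 50 (m : ℤ) (j : ℤ) = (t : ℤ) ∧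
          t < 2 ^ (resBits h m + resBits h j + 2 * g) ∧
          Approx 2 (resBits h m + resBits h j + g) (z m j) t) := by
        intro m
        by_cases hm : m < n
        · obtain ⟨t, t1, t2, t3⟩ := h50 m hm j hj
          exact ⟨t, fun _ => ⟨t1, t2, t3 hpos'⟩⟩
        · exact ⟨0, fun h => absurd h hm⟩
      choose v hv using hvex
      refine (runs_column (n := n) (W := W) (H := H) (j := j) (v := v) (z := fun m => z m j) hR1
        hj hh (by rw [g1 5 (by simp)]; exact h5) g40 hH (by rw [g24]; exact h3)
        (fun m hm => by rw [g1 50 (by simp)]; exact (hv m hm).1) (fun m hm => (hv m hm).2.1)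
        (fun m hm => (hv m hm).2.2) (fun i hi => hint i j hi hj) hg hgW hW).mono (by omega) ?_
      rintro ψ ⟨x1, x2, x3⟩
      refine ⟨⟨g1.trans x1 (by simp), fun r hr c hc => ?_, x3⟩, by rw [x1 40 (by simp), g40]⟩
      rw [x2, g7 r hr c hc]
      by_cases hrc : r < j ∧ c = j
      · rw [if_pos hrc, if_pos (by omega), hrc.2, triangleEntry, if_pos hrc.1]
      · rw [if_neg hrc]
        by_cases hc' : c < j + 1
        · rw [if_pos hc', if_pos (by omega)]
        · rw [if_neg hc', if_neg (by omega)]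
    · intro hneg
      have hz : ¬ 0 < resBits h j := by exact_mod_cast hneg
      rw [if_neg hz]
      have hh1 : ∀ i < j, H i j = 0 := by
        intro i hi
        have := lt_two_pow_resBits (hH i j hi hj)
        rw [show resBits h j = 0 by omega] at this
        omega
      refine Runs.skip (by omega) ⟨⟨g1, fun r hr c hc => ?_, fun r hr p hp => ?_⟩, g40⟩
      · rw [g7 r hr c hc]
        by_cases hc' : c < j + 1
        · rw [if_pos hc']
          by_cases hrc : r < j ∧ c = j
          · rw [if_neg (by omega), hrc.2, triangleEntry, if_pos hrc.1, hh1 r hrc.1]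
            rfl
          · rw [if_pos (by omega)]
        · rw [if_neg hc', if_neg (by omega)]
      · rw [g24, h3 r hr p hp]
        by_cases hrj : r < j
        · rw [← update_partialRow H hrj, hh1 r hrj]
          congr 2
          funext m
          by_cases hm : m = j
          · subst hm
            simp [partialRow]
          · rw [Function.update_of_ne hm]
        · rw [partialRow_of_le H (by omega), partialRow_of_le H (by omega)]
  · intro r _ c _
    rw [if_neg (by omega), h7]
  · intro r _ p _
    rw [partialRow_of_le H (by omega), bitAt_zero, h24]
    rfl
  · refine Nat.add_le_add_right (Finset.sum_le_sum fun r _ => ?_) _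
    omega
  · rintro τ ⟨-, h2, -⟩ r hr c hc
    rw [h2 r hr c hc, if_pos hc]

end Column

/-- The input consists of the matrices `m`, `u` with the moduli `s` and of the diagonal `h`. -/
structure InputCells (σ : Store) (n : ℕ) (m u : ℕ → ℕ → ℕ) (s h : ℕ → ℕ) : Prop where
  dim : σ 0 0 0 = (n : ℤ)
  massager : ∀ i < n, ∀ k < n, σ 2 (i : ℤ) (k : ℤ) = (m i k : ℤ)
  moduli : ∀ k < n, σ 3 (k : ℤ) (k : ℤ) = (s k : ℤ)
  transform : ∀ k < n, ∀ j < n, σ 4 (k : ℤ) (j : ℤ) = (u k j : ℤ)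
  diagonal : ∀ k < n, σ 5 (k : ℤ) 0 = (h k : ℤ)
  zero : ∀ a, 7 ≤ a → ∀ i j, σ a i j = 0

/-- The number of guard bits for residues with a total of `d` bits. -/
def guardBits (d : ℕ) : ℕ := (d + 1 + (d + 1) + (d + 1 + (d + 1))).size

/-- Lays out the bit positions and computes the number of guard bits. -/
def Prog.prepare : Prog :=
  .seq (.layout 10 (.cell 3 (.reg 41) (.reg 41)))
    (.seq (.layout 20 (.cell 5 (.reg 41) (.const 0)))
      (.seq (.set 35 (.add (.add (.reg 10) (.reg 20)) (.const 1)))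
        (.seq (.set 35 (.add (.reg 35) (.reg 35)))
          (.seq (.set 35 (.add (.reg 35) (.reg 35)))
            (.seq (.set 41 (.const 0)) (.halve 38 34))))))

/-- The arrays that `Prog.prepare` changes. -/
abbrev prepareArrays : List ℕ := [10, 11, 12, 13, 20, 21, 22, 23, 34, 35, 38, 41]

/-! ### Assembling the program: preparation, fractions, triangle -/

section Program

variable {n W g : ℕ} {s h : ℕ → ℕ} {m u : ℕ → ℕ → ℕ}

theorem lt_two_pow_guardBits (d : ℕ) : 4 * (d + 1) < 2 ^ guardBits d := by
  have := Nat.lt_size_self (d + 1 + (d + 1) + (d + 1 + (d + 1)))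
  unfold guardBits
  omega

/-- The number of guard bits is the bitlength of `4 * (D + D' + 1)`, obtained by doubling twice and
counting halvings; the cells of array 38 are a by-product. -/
theorem runs_prepare {σ : Store} (hI : InputCells σ n m u s h) (hs : ∀ k < n, 0 < s k)
    (hh : ∀ k < n, 0 < h k) (hg : g = guardBits (bitOff (resBits s) n + bitOff (resBits h) n))
    (hgW : g ≤ W)
    (hW : bitlen ((2 * (n + bitOff (resBits s) n + bitOff (resBits h) n + g + 1) : ℕ) : ℤ) ≤ W) :
    Runs .prepare σ (500 * (((bitOff (resBits s) n + bitOff (resBits h) n + 1) + n) *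
      (W + (bitOff (resBits s) n + bitOff (resBits h) n + 1))) + 100 * (W * W) + 200 * W) fun τ =>
      Agree prepareArrays σ τ ∧ Ready τ n g s h := by
  have hnW : bitlen (n : ℤ) ≤ W := (bitlen_cast_mono (by omega)).trans hW
  have hW1 := (one_le_bitlen _).trans hnW
  set D := bitOff (resBits s) n with hD
  set D' := bitOff (resBits h) n with hD'
  have hDW : bitlen (D : ℤ) ≤ W := (bitlen_cast_mono (by omega)).trans hW
  have hDW' : bitlen (D' : ℤ) ≤ W := (bitlen_cast_mono (by omega)).trans hW
  have hgW' : bitlen (g : ℤ) ≤ W := (bitlen_cast_mono (by omega)).trans hW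
  have hxg := lt_two_pow_guardBits (D + D')
  rw [← hg] at hxg
  have hg1 : 1 ≤ g := Nat.one_le_iff_ne_zero.2 fun h0 => by rw [h0] at hxg; omega
  have hxW : ∀ y : ℕ, y ≤ 4 * (D + D' + 1) → bitlen (y : ℤ) ≤ W := fun y hy =>
    (bitlen_cast_le hg1 (hy.trans_lt hxg)).trans hgW
  have hkW : ∀ k < n, bitlen (k : ℤ) ≤ W := fun k hk => (bitlen_cast_mono hk.le).trans hnW
  refine ((runs_layout (o := 10) (by omega) (by omega) (W := W) (B := D + 1)
    (cs := 20 * W + (D + 1)) (s := s) hI.dim (hI.zero 10 (by omega) 0 0) hs ?_ hnW hDW).seq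
    (c' := (D' * (30 * (W + (D' + 1))) + n * ((20 * W + (D' + 1)) + 100 * (W + (D' + 1))) + 30 * W)
      + (30 * W + (20 * W + (20 * W + (10 + (g * (30 * (W + W)) + 10 * W)))))) ?_).mono ?_
      fun _ h => h
  · intro τ h1 k hk h41
    exact (Evals.cell (.reg h41 (hkW k hk)) (.reg h41 (hkW k hk))
      (by rw [h1 3 (by simp), hI.moduli k hk])
      ((bitlen_le_resBits le_rfl (hs k hk)).trans
        (Nat.add_le_add_right (resBits_le_bitOff s hk) 1))).mono (by omega)
  · rintro τ ⟨h1, h2⟩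
    refine (runs_layout (o := 20) (by omega) (by omega) (W := W) (B := D' + 1)
      (cs := 20 * W + (D' + 1)) (s := h) (by rw [h1 0 (by simp), hI.dim])
      (by rw [h1 20 (by simp)]; exact hI.zero 20 (by omega) 0 0) hh ?_ hnW hDW').seq ?_
    · intro υ h3 k hk h41
      exact (Evals.cell (.reg h41 (hkW k hk)) .zero
        (by rw [h3 5 (by simp), h1 5 (by simp), hI.diagonal k hk])
        ((bitlen_le_resBits le_rfl (hh k hk)).trans
          (Nat.add_le_add_right (resBits_le_bitOff h hk) 1))).mono (by omega)
    rintro υ ⟨h3, h4⟩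
    have h5 : Agree prepareArrays σ υ := (h1.mono (by simp)).trans h3 (by simp)
    have h6 : Layout 10 υ n (resBits s) := h2.agree h3 (by simp)
    refine (Runs.set_evals (c := 30 * W)
      (Q := fun τ => τ = υ.write 35 0 0 ((D + D' + 1 : ℕ) : ℤ))
      (.nat_add (b := W) (.nat_add (.reg h6.total hDW) (.reg h4.total hDW') (hxW (D + D') (by omega)))
        .one (hxW (D + D' + 1) (by omega))) (by omega) rfl).seq ?_
    rintro _ rfl
    refine (Runs.set_evals (c := 20 * W)
      (Q := fun τ => τ = (υ.write 35 0 0 ((D + D' + 1 : ℕ) : ℤ)).write 35 0 0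
        ((D + D' + 1 + (D + D' + 1) : ℕ) : ℤ))
      (.nat_add (b := W) (.reg (v := ((D + D' + 1 : ℕ) : ℤ)) (Store.write_self _ _ _ _ _)
        (hxW _ (by omega)))
        (.reg (v := ((D + D' + 1 : ℕ) : ℤ)) (Store.write_self _ _ _ _ _) (hxW _ (by omega)))
        (hxW _ (by omega))) (by omega) rfl).seq ?_
    rintro _ rfl
    refine (Runs.set_evals (c := 20 * W)
      (Q := fun τ => Agree prepareArrays σ τ ∧ Layout 10 τ n (resBits s) ∧
        Layout 20 τ n (resBits h) ∧ τ 34 0 0 = 0 ∧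
        τ 35 0 0 = ((D + D' + 1 + (D + D' + 1) + (D + D' + 1 + (D + D' + 1)) : ℕ) : ℤ))
      (.nat_add (b := W) (.reg (v := ((D + D' + 1 + (D + D' + 1) : ℕ) : ℤ))
        (Store.write_self _ _ _ _ _) (hxW _ (by omega)))
        (.reg (v := ((D + D' + 1 + (D + D' + 1) : ℕ) : ℤ)) (Store.write_self _ _ _ _ _)
          (hxW _ (by omega)))
        (hxW _ (by omega))) (by omega) ⟨?_, ?_, ?_, ?_, ?_⟩).seq ?_
    · exact ((h5.write (by simp) _ _ _).write (by simp) _ _ _).write (by simp) _ _ _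
    · exact h6.agree (m := [35]) ((((Agree.refl _ _).write (by simp) _ _ _).write
        (by simp) _ _ _).write (by simp) _ _ _) (by simp)
    · exact h4.agree (m := [35]) ((((Agree.refl _ _).write (by simp) _ _ _).write
        (by simp) _ _ _).write (by simp) _ _ _) (by simp)
    · rw [Store.write_of_ne _ (by omega), Store.write_of_ne _ (by omega),
        Store.write_of_ne _ (by omega), h3 34 (by simp), h1 34 (by simp), hI.zero 34 (by omega)]
    · rw [Store.write_self]
    rintro φ ⟨f1, f2, f3, f4, f5⟩
    refine (Runs.set_evals (c := 10) (Q := fun τ => τ = φ.write 41 0 0 0) .zero (by omega) rfl).seq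
      ?_
    rintro _ rfl
    refine (runs_halve (kk := 38) (d := 34) (W := W) (B := W) (p := 0) (k := 0)
      (x := D + D' + 1 + (D + D' + 1) + (D + D' + 1 + (D + D' + 1)))
      (by omega) (by omega) (by omega) (by omega) (by omega)
      (by rw [Store.write_of_ne _ (by omega), f5])
      (by rw [Store.write_of_ne _ (by omega), f4]; rfl) (by rw [Store.write_self]; rfl)
      (by rw [zero_add]; exact (congrArg (fun y : ℕ => bitlen (y : ℤ)) hg.symm).trans_le hgW')
      (hxW 0 (by omega)) (hxW _ (by omega))).mono ?_ ?_
    · rw [hg]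
      exact le_rfl
    · rintro ψ ⟨g1, g2, -, -⟩
      have g3 : Agree [34, 35, 38, 41] φ ψ :=
        ((Agree.refl _ _).write (by simp) 0 0 0).trans g1 (by simp)
      have g4 : Agree prepareArrays σ ψ := f1.trans g3 (by simp)
      refine ⟨g4, ⟨by rw [g4 0 (by simp), hI.dim], ?_, f2.agree g3 (by simp),
        f3.agree g3 (by simp), ?_⟩⟩
      · rw [g4 3 (by simp)]
        exact hI.moduli
      · rw [g2, zero_add, hg]
        rfl
  · have b1 : D * (30 * (W + (D + 1))) ≤ (D + D' + 1 + n) * (30 * (W + (D + D' + 1))) :=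
      Nat.mul_le_mul (by omega) (by omega)
    have b2 : D' * (30 * (W + (D' + 1))) ≤ (D + D' + 1 + n) * (30 * (W + (D + D' + 1))) :=
      Nat.mul_le_mul (by omega) (by omega)
    have b3 : n * ((20 * W + (D + 1)) + 100 * (W + (D + 1))) ≤
        (D + D' + 1 + n) * (120 * (W + (D + D' + 1))) := Nat.mul_le_mul (by omega) (by omega)
    have b4 : n * ((20 * W + (D' + 1)) + 100 * (W + (D' + 1))) ≤
        (D + D' + 1 + n) * (120 * (W + (D + D' + 1))) := Nat.mul_le_mul (by omega) (by omega)
    have b5 : g * (30 * (W + W)) ≤ W * (30 * (W + W)) := Nat.mul_le_mul_right _ hgW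
    nlinarith

/-- Computes approximations of the entries of the product of the massager, the inverse of the
Smith form and the Howell transform. -/
def Prog.fractions : Prog :=
  .seq (.bits 14 (.cell 2 (.reg 42) (.reg 41)))
    (.seq (.bits 15 (.cell 4 (.reg 41) (.reg 42)))
      (.seq (.stage (.cell 4 (.reg 41) (.reg 40)) 14 true)
        (.stage (.cell 2 (.reg 40) (.reg 41)) 15 false)))

/-- The arrays that `Prog.fractions` changes. -/
abbrev fractionsArrays : List ℕ := 14 :: 15 :: stageArrays

theorem FracEntry.swap {σ : Store} {e : ℕ → ℕ} {i j : ℕ} {z : ℚ} {G : Prop}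
    (hf : FracEntry true σ g e i j z G) : FracEntry false σ g e j i z G := by
  obtain ⟨t, h1, h2, h3⟩ := hf
  rw [add_comm (e i)] at h2 h3
  exact ⟨t, h1, h2, h3⟩

theorem FracEntry.mono {sw : Bool} {σ : Store} {e : ℕ → ℕ} {i j : ℕ} {z : ℚ} {G G' : Prop}
    (hf : FracEntry sw σ g e i j z G) (hG : G' → G) : FracEntry sw σ g e i j z G' := by
  obtain ⟨t, h1, h2, h3⟩ := hf
  exact ⟨t, h1, h2, fun h => h3 (hG h)⟩

/-- The first stage expands column `j` of the transform over the moduli and settles the pairs with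
`0 < e_j` and `e_i ≤ e_j`. The second expands row `i` of the massager and settles those with `0 <
e_i` and `e_j ≤ e_i`. Together they cover all pairs with `0 < e_j`. -/
theorem runs_fractions {σ : Store} (hR : Ready σ n g s h) (hs : ∀ k < n, 0 < s k)
    (hm : ∀ i < n, ∀ k < n, m i k < s k) (hu : ∀ k < n, ∀ j < n, u k j < s k)
    (h2 : ∀ i < n, ∀ k < n, σ 2 (i : ℤ) (k : ℤ) = (m i k : ℤ))
    (h4 : ∀ k < n, ∀ j < n, σ 4 (k : ℤ) (j : ℤ) = (u k j : ℤ))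
    (h50 : ∀ i j, σ 50 i j = 0)
    (hg : 2 * bitOff (resBits s) n ≤ 2 ^ g) (hgW : g ≤ W)
    (hW : bitlen ((2 * (n + bitOff (resBits s) n + bitOff (resBits h) n + g + 1) : ℕ) : ℤ) ≤ W) :
    Runs .fractions σ (2 * (bitOff (resBits s) n * ((n + 1) *
        (250 * (W + (bitOff (resBits s) n + 1)))) + 30 * W) +
      2 * (∑ r ∈ Finset.range n, (60 * W + if 0 < resBits h r then
        3000 * ((bitOff (resBits s) n + n) * (W + resBits h r + bitOff (resBits s) n) +
          n * (bitOff (resBits s) n + 1) * (W + resBits h r)) else 0) + 30 * W)) fun τ =>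
      Agree fractionsArrays σ τ ∧ ∀ i < n, ∀ j < n, FracEntry false τ g (resBits h) i j
        (∑ k ∈ Finset.range n, (m i k : ℚ) * u k j / s k) (0 < resBits h j) := by
  have hnW : bitlen (n : ℤ) ≤ W := (bitlen_cast_mono (by omega)).trans hW
  have hW1 := (one_le_bitlen _).trans hnW
  have hDW : bitlen (bitOff (resBits s) n : ℤ) ≤ W := (bitlen_cast_mono (by omega)).trans hW
  have hkW : ∀ k < n, bitlen (k : ℤ) ≤ W := fun k hk => (bitlen_cast_mono hk.le).trans hnW
  have hmb : ∀ i < n, ∀ k < n, bitlen (m i k : ℤ) ≤ resBits s k + 1 := fun i hi k hk =>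
    bitlen_le_resBits (hm i hi k hk).le (hs k hk)
  have hub : ∀ k < n, ∀ j < n, bitlen (u k j : ℤ) ≤ resBits s k + 1 := fun k hk j hj =>
    bitlen_le_resBits (hu k hk j hj).le (hs k hk)
  have hrb : ∀ k < n, resBits s k ≤ bitOff (resBits s) n := fun k hk => resBits_le_bitOff s hk
  set D := bitOff (resBits s) n with hD
  set E := ∑ r ∈ Finset.range n, (60 * W + if 0 < resBits h r then
        3000 * ((D + n) * (W + resBits h r + D) + n * (D + 1) * (W + resBits h r)) else 0) with hE
  have hbc : D * ((n + 1) * ((20 * W + (D + 1)) + 200 * (W + (D + 1)))) + 30 * W ≤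
      D * ((n + 1) * (250 * (W + (D + 1)))) + 30 * W := by
    refine Nat.add_le_add_right (Nat.mul_le_mul_left _ (Nat.mul_le_mul_left _ ?_)) _
    omega
  refine ((runs_bits (a := 14) (by omega) (by omega) (W := W) (B := D + 1)
    (cs := 20 * W + (D + 1)) (xs := m) hR.dim hR.layoutS ?_ hnW hDW).seq
    (c' := (D * ((n + 1) * ((20 * W + (D + 1)) + 200 * (W + (D + 1)))) + 30 * W) +
      ((E + 30 * W) + (E + 30 * W))) ?_).mono (by rw [← hD]; omega) fun _ h => h
  · intro τ h1 r hr k hk h41 h42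
    exact (Evals.cell (.reg h42 (hkW r hr)) (.reg h41 (hkW k hk))
      (by rw [h1 2 (by simp), h2 r hr k hk])
      ((hmb r hr k hk).trans (Nat.add_le_add_right (hrb k hk) 1))).mono (by omega)
  rintro τ ⟨t1, t14⟩
  have hR1 := hR.agree t1 (by simp)
  refine (runs_bits (a := 15) (by omega) (by omega) (W := W) (B := D + 1)
    (cs := 20 * W + (D + 1)) (xs := fun r k => u k r) hR1.dim hR1.layoutS ?_ hnW hDW).seq ?_
  · intro υ h1 r hr k hk h41 h42
    exact (Evals.cell (.reg h41 (hkW k hk)) (.reg h42 (hkW r hr))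
      (by rw [h1 4 (by simp), t1 4 (by simp), h4 k hk r hr])
      ((hub k hk r hr).trans (Nat.add_le_add_right (hrb k hk) 1))).mono (by omega)
  rintro υ ⟨u1, u15⟩
  have hR2 := hR1.agree u1 (by simp)
  have hsu : Agree [14, 15, 41, 42, 43] σ υ := (t1.mono (by simp)).trans u1 (by simp)
  refine (runs_stage (a := 14) (by omega) (by omega) (sw := true) (xs := fun r k => u k r)
    (ys := m) (G := fun _ _ => False) (W := W) hR2 hs (fun r hr k hk => hu k hk r hr) hm ?_ hg hgW
    (by rw [u1 14 (by simp)]; exact t14) ?_ hW).seq ?_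
  · intro φ h1 r hr k hk h40 h41
    exact (Evals.cell (.reg h41 (hkW k hk)) (.reg h40 (hkW r hr))
      (by rw [h1 4 (by simp), hsu 4 (by simp), h4 k hk r hr]) (hub k hk r hr)).mono (by omega)
  · intro i _ j _
    refine ⟨0, ?_, by positivity, False.elim⟩
    simp [fracCell, hsu 50, h50]
  rintro φ ⟨f1, f2⟩
  have hR3 := hR2.agree f1 (by simp)
  have hz : ∀ i j, ∑ k ∈ Finset.range n, (m i k : ℚ) * ((u k j : ℚ) / s k) =
      ∑ k ∈ Finset.range n, (u k j : ℚ) * ((m i k : ℚ) / s k) := fun i j =>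
    Finset.sum_congr rfl fun k _ => by ring
  refine (runs_stage (a := 15) (by omega) (by omega) (sw := false) (xs := m)
    (ys := fun r k => u k r)
    (G := fun i j => False ∨ 0 < resBits h j ∧ resBits h i ≤ resBits h j) (W := W) hR3 hs hm
    (fun r hr k hk => hu k hk r hr) ?_ hg hgW (by rw [f1 15 (by simp)]; exact u15) ?_ hW).mono
    le_rfl ?_
  · intro ψ h1 r hr k hk h40 h41
    exact (Evals.cell (.reg h40 (hkW r hr)) (.reg h41 (hkW k hk))
      (by rw [h1 2 (by simp), f1 2 (by simp), hsu 2 (by simp), h2 r hr k hk])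
      (hmb r hr k hk)).mono (by omega)
  · intro i hi j hj
    have := (f2 j hj i hi).swap
    rwa [hz] at this
  · rintro ψ ⟨p1, p2⟩
    refine ⟨((hsu.mono (by simp)).trans f1 (by simp)).trans p1 (by simp), fun i hi j hj => ?_⟩
    have := (p2 i hi j hj).mono (G' := 0 < resBits h j) (by omega)
    rwa [show ∑ k ∈ Finset.range n, (m i k : ℚ) * u k j / s k =
      ∑ k ∈ Finset.range n, (u k j : ℚ) * ((m i k : ℚ) / s k) from
        Finset.sum_congr rfl fun k _ => by ring]

/-- Computes the Hermite form from its diagonal, the Smith form, a reduced Smith massager and a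
Howell transform. -/
def Prog.hermite : Prog := .seq .prepare (.seq .fractions .triangle)

theorem runs_hermite {H : ℕ → ℕ → ℕ} {σ : Store} (hI : InputCells σ n m u s h)
    (hs : ∀ k < n, 0 < s k) (hh : ∀ k < n, 0 < h k)
    (hm : ∀ i < n, ∀ k < n, m i k < s k) (hu : ∀ k < n, ∀ j < n, u k j < s k)
    (hH : ∀ i k, i < k → k < n → H i k < h k)
    (hint : ∀ i j, i < j → j < n → ∃ y : ℤ,
      (h i : ℚ) * (∑ k ∈ Finset.range n, (m i k : ℚ) * u k j / s k) +
      ∑ l ∈ Finset.range n, (partialRow H i j l : ℚ) *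
        (∑ k ∈ Finset.range n, (m l k : ℚ) * u k j / s k) + (H i j : ℚ) / h j = y)
    (hg : g = guardBits (bitOff (resBits s) n + bitOff (resBits h) n)) (hgW : g ≤ W)
    (hW : bitlen ((2 * (n + bitOff (resBits s) n + bitOff (resBits h) n + g + 1) : ℕ) : ℤ) ≤ W) :
    Runs .hermite σ ((500 * (((bitOff (resBits s) n + bitOff (resBits h) n + 1) + n) *
      (W + (bitOff (resBits s) n + bitOff (resBits h) n + 1))) + 100 * (W * W) + 200 * W) +
      ((2 * (bitOff (resBits s) n * ((n + 1) *
        (250 * (W + (bitOff (resBits s) n + 1)))) + 30 * W) +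
      2 * (∑ r ∈ Finset.range n, (60 * W + if 0 < resBits h r then
        3000 * ((bitOff (resBits s) n + n) * (W + resBits h r + bitOff (resBits s) n) +
          n * (bitOff (resBits s) n + 1) * (W + resBits h r)) else 0) + 30 * W)) +
      (∑ j ∈ Finset.range n, (100 * W + 2 * resBits h j + if 0 < resBits h j then
        3000 * ((bitOff (resBits h) n + n) * (W + resBits h j + bitOff (resBits h) n) +
          n * (bitOff (resBits h) n + 1) * (W + resBits h j)) else 0) + 30 * W))) fun τ =>
      ∀ r < n, ∀ c < n, τ 7 (r : ℤ) (c : ℤ) = (triangleEntry H h r c : ℤ) := by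
  have hxg := lt_two_pow_guardBits (bitOff (resBits s) n + bitOff (resBits h) n)
  rw [← hg] at hxg
  refine (runs_prepare hI hs hh hg hgW hW).seq ?_
  rintro τ ⟨h1, hR⟩
  refine (runs_fractions hR hs hm hu (by rw [h1 2 (by simp)]; exact hI.massager)
    (by rw [h1 4 (by simp)]; exact hI.transform)
    (by rw [h1 50 (by simp)]; exact hI.zero 50 (by omega)) (by omega) hgW hW).seq ?_
  rintro υ ⟨h2, h3⟩
  have h4 : ∀ a, a ∉ prepareArrays → a ∉ fractionsArrays → υ a = σ a := fun a ha ha' => by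
    rw [h2 a ha', h1 a ha]
  refine runs_triangle (z := fun i j => ∑ k ∈ Finset.range n, (m i k : ℚ) * u k j / s k)
    (hR.agree h2 (by simp)) hh ?_ hH ?_ ?_ h3 hint (by omega) hgW hW
  · rw [h4 5 (by simp) (by simp)]
    exact hI.diagonal
  · intro r c
    rw [h4 7 (by simp) (by simp), hI.zero 7 le_rfl]
  · intro r c
    rw [h4 24 (by simp) (by simp), hI.zero 24 (by omega)]

end Program

/-! ### The total number of bit operations -/

section Cost

variable {n W X Q : ℕ} {e : ℕ → ℕ}

theorem card_filter_pos_le (e : ℕ → ℕ) (n : ℕ) :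
    ((Finset.range n).filter fun r => 0 < e r).card ≤ bitOff e n := by
  rw [Finset.card_eq_sum_ones, bitOff, Finset.sum_filter]
  refine Finset.sum_le_sum fun r _ => ?_
  split_ifs with h
  · exact h
  · omega

/-- The part of a row's cost that is free of `e r` is paid `Q - 1` times, where `Q - 1` is at most
`n` and at most `X`. The part proportional to `e r` has coefficient of order `n * X` and sums to
order `n * X ^ 2`. -/
theorem sum_rows_le {A : ℕ} (hA : A + 1 ≤ X) (hX : bitOff e n + 1 ≤ X)
    (hQ : ((Finset.range n).filter fun r => 0 < e r).card + 1 = Q) :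
    ∑ r ∈ Finset.range n, (if 0 < e r then
      3000 * ((A + n) * (W + e r + A) + n * (A + 1) * (W + e r)) else 0) ≤
      15000 * (n * X ^ 2 + n * X * Q * W) := by
  have hqX := card_filter_pos_le e n
  have hqn : ((Finset.range n).filter fun r => 0 < e r).card ≤ n :=
    (Finset.card_filter_le _ _).trans (Finset.card_range n).le
  set q := ((Finset.range n).filter fun r => 0 < e r).card with hq
  have h1 : ∑ r ∈ Finset.range n, (if 0 < e r then
      3000 * ((A + n) * (W + e r + A) + n * (A + 1) * (W + e r)) else 0) ≤
      ∑ r ∈ Finset.range n, ((if 0 < e r then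
        3000 * ((X + n) * (W + 2 * X) + n * X * W) else 0) + 3000 * (n * X) * e r) := by
    refine Finset.sum_le_sum fun r hr => ?_
    have her : e r ≤ bitOff e n := by
      have := bitOff_mono e (show r + 1 ≤ n from Finset.mem_range.1 hr)
      rw [bitOff_succ] at this
      omega
    split_ifs with h
    · have b1 : (A + n) * (W + e r + A) ≤ (X + n) * (W + 2 * X) :=
        Nat.mul_le_mul (by omega) (by omega)
      have b2 : n * (A + 1) * (W + e r) ≤ n * X * (W + e r) :=
        Nat.mul_le_mul_right _ (Nat.mul_le_mul_left _ hA)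
      nlinarith
    · omega
  have h2 : ∑ r ∈ Finset.range n, ((if 0 < e r then
        3000 * ((X + n) * (W + 2 * X) + n * X * W) else 0) + 3000 * (n * X) * e r) =
      q * (3000 * ((X + n) * (W + 2 * X) + n * X * W)) + 3000 * (n * X) * bitOff e n := by
    rw [Finset.sum_add_distrib, ← Finset.sum_filter, Finset.sum_const, smul_eq_mul,
      ← Finset.mul_sum, bitOff]
  rw [h2] at h1
  refine h1.trans ?_
  have c1 : q * (X * W) ≤ n * X * Q * W := by
    calc q * (X * W) ≤ (n * Q) * (X * W) := Nat.mul_le_mul_right _ (by nlinarith)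
      _ = n * X * Q * W := by ring
  have c2 : q * (n * W) ≤ n * X * Q * W := by
    calc q * (n * W) ≤ (X * Q) * (n * W) := Nat.mul_le_mul_right _ (by nlinarith)
      _ = n * X * Q * W := by ring
  have c3 : q * (X * X) ≤ n * X ^ 2 := by
    calc q * (X * X) ≤ n * (X * X) := Nat.mul_le_mul_right _ hqn
      _ = n * X ^ 2 := by ring
  have c4 : q * (n * X) ≤ n * X ^ 2 := by
    calc q * (n * X) ≤ X * (n * X) := Nat.mul_le_mul_right _ (by omega)
      _ = n * X ^ 2 := by ring
  have c5 : q * (n * X * W) ≤ n * X * Q * W := by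
    calc q * (n * X * W) ≤ Q * (n * X * W) := Nat.mul_le_mul_right _ (by omega)
      _ = n * X * Q * W := by ring
  have c6 : n * X * bitOff e n ≤ n * X ^ 2 := by
    calc n * X * bitOff e n ≤ n * X * X := Nat.mul_le_mul_left _ (by omega)
      _ = n * X ^ 2 := by ring
  have c7 : q * (3000 * ((X + n) * (W + 2 * X) + n * X * W)) =
      3000 * (q * (X * W) + q * (n * W) + 2 * (q * (X * X)) + 2 * (q * (n * X)) +
        q * (n * X * W)) := by ring
  have c8 : 3000 * (n * X) * bitOff e n = 3000 * (n * X * bitOff e n) := by ring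
  omega

/-- The crude bound `hWX` is there for the term `W * W`, which arises from counting the guard bits;
everything else is dominated term by term. -/
theorem hermite_cost_le {D D' : ℕ} (hX : X = D + D' + 1) (hD' : D' = bitOff e n)
    (hQ : ((Finset.range n).filter fun r => 0 < e r).card + 1 = Q) (hn : 1 ≤ n)
    (hWX : W ≤ 16 * (n * X)) :
    (500 * ((D + D' + 1 + n) * (W + (D + D' + 1))) + 100 * (W * W) + 200 * W) +
      ((2 * (D * ((n + 1) * (250 * (W + (D + 1)))) + 30 * W) +
      2 * (∑ r ∈ Finset.range n, (60 * W + if 0 < e r then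
        3000 * ((D + n) * (W + e r + D) + n * (D + 1) * (W + e r)) else 0) + 30 * W)) +
      (∑ j ∈ Finset.range n, (100 * W + 2 * e j + if 0 < e j then
        3000 * ((D' + n) * (W + e j + D') + n * (D' + 1) * (W + e j)) else 0) + 30 * W)) ≤
      100000 * (n * X ^ 2 + n * X * Q * W) := by
  have hX1 : 1 ≤ X := by omega
  have hQ1 : 1 ≤ Q := by omega
  have s1 := sum_rows_le (W := W) (A := D) (by omega) (show bitOff e n + 1 ≤ X by omega) hQ
  have s2 := sum_rows_le (W := W) (A := D') (by omega) (show bitOff e n + 1 ≤ X by omega) hQ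
  have e1 : ∑ j ∈ Finset.range n, 2 * e j = 2 * D' := by rw [← Finset.mul_sum, hD', bitOff]
  simp only [Finset.sum_add_distrib, Finset.sum_const, Finset.card_range, smul_eq_mul, e1]
  set T := n * X * Q * W with hT
  have t1 : n * X * W ≤ T := by
    calc n * X * W = n * X * 1 * W := by ring
      _ ≤ T := Nat.mul_le_mul_right _ (Nat.mul_le_mul_left _ hQ1)
  have t2 : n * W ≤ T := le_trans (Nat.mul_le_mul_right _ (Nat.le_mul_of_pos_right _ hX1)) t1
  have t3 : X * W ≤ T := le_trans (Nat.mul_le_mul_right _ (Nat.le_mul_of_pos_left _ hn)) t1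
  have t4 : W ≤ T := (Nat.le_mul_of_pos_left _ hn).trans t2
  have t5 : W * W ≤ 16 * T := by
    calc W * W ≤ 16 * (n * X) * W := Nat.mul_le_mul_right _ hWX
      _ = 16 * (n * X * W) := by ring
      _ ≤ 16 * T := by omega
  have r1 : X * X ≤ n * X ^ 2 := by
    rw [sq]
    exact Nat.le_mul_of_pos_left _ hn
  have r2 : n * X ≤ n * X ^ 2 := by
    rw [sq]
    exact Nat.mul_le_mul_left _ (Nat.le_mul_of_pos_left _ hX1)
  have r3 : X ≤ X * X := Nat.le_mul_of_pos_left _ hX1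
  have a1 : D * ((n + 1) * (250 * (W + (D + 1)))) ≤ X * ((n + n) * (250 * (W + X))) :=
    Nat.mul_le_mul (by omega) (Nat.mul_le_mul (by omega) (by omega))
  have a2 : X * ((n + n) * (250 * (W + X))) = 500 * (n * X * W) + 500 * (n * X ^ 2) := by ring
  have a3 : (D + D' + 1 + n) * (W + (D + D' + 1)) = X * W + n * W + X * X + n * X := by
    rw [hX]
    ring
  have a4 : n * (60 * W) = 60 * (n * W) := by ring
  have a5 : n * (100 * W) = 100 * (n * W) := by ring
  rw [a3, a4, a5]
  omega

end Cost

/-! ### The bound in terms of the determinant -/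

theorem one_le_plog (x : ℝ) : 1 ≤ plog x := le_max_left _ _

theorem logb_le_plog (x : ℝ) : Real.logb 2 x ≤ plog x := le_max_right _ _

/-- A positive length `ℓ` means `2 ^ (ℓ - 1) < s`, so `2 ^ ℓ ≤ (2 ^ (ℓ - 1) + 1) ^ 2 ≤ s ^ 2`. A
modulus 1 has length 0. Thus the total length is at most `2 log₂` of the product, with no extra term
`n` from rounding up. -/
theorem two_pow_resBits_le (s : ℕ → ℕ) {k : ℕ} (hs : 0 < s k) : 2 ^ resBits s k ≤ s k ^ 2 := by
  unfold resBits
  rcases Nat.eq_zero_or_pos (s k - 1).size with h0 | hpos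
  · rw [h0]
    exact Nat.one_le_pow _ _ hs
  · obtain ⟨b, hb⟩ : ∃ b, (s k - 1).size = b + 1 := ⟨(s k - 1).size - 1, by omega⟩
    have h1 : 2 ^ b ≤ s k - 1 := Nat.lt_size.1 (by omega)
    have h2 : 1 ≤ 2 ^ b := Nat.one_le_two_pow
    have h3 := Nat.pow_le_pow_left (show 2 ^ b + 1 ≤ s k by omega) 2
    rw [hb, pow_succ]
    refine le_trans ?_ h3
    nlinarith

theorem two_pow_bitOff_le {s : ℕ → ℕ} {n : ℕ} (hs : ∀ k < n, 0 < s k) :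
    2 ^ bitOff (resBits s) n ≤ (∏ k ∈ Finset.range n, s k) ^ 2 := by
  rw [bitOff, ← Finset.prod_pow_eq_pow_sum, ← Finset.prod_pow]
  exact Finset.prod_le_prod' fun k hk => two_pow_resBits_le s (hs k (Finset.mem_range.1 hk))

theorem bitOff_le_plog {s : ℕ → ℕ} {n : ℕ} (hs : ∀ k < n, 0 < s k) {d : ℝ}
    (hd : ((∏ k ∈ Finset.range n, s k : ℕ) : ℝ) = d) :
    (bitOff (resBits s) n : ℝ) ≤ 2 * plog d := by
  have hpos : 0 < ∏ k ∈ Finset.range n, s k :=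
    Finset.prod_pos fun k hk => hs k (Finset.mem_range.1 hk)
  have h1 : ((2 : ℝ)) ^ (bitOff (resBits s) n) ≤ d ^ 2 := by
    rw [← hd]
    exact_mod_cast two_pow_bitOff_le hs
  have hd0 : 0 < d := by
    rw [← hd]
    exact_mod_cast hpos
  have h2 := Real.logb_le_logb_of_le (b := 2) (by norm_num) (by positivity) h1
  rw [Real.logb_pow, Real.logb_pow, Real.logb_self_eq_one (by norm_num)] at h2
  have h3 := logb_le_plog d
  push_cast at h2
  linarith

theorem guardBits_le {d : ℕ} {D : ℝ} (hD : 1 ≤ D) (hd : (d : ℝ) + 1 ≤ 5 * D) :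
    (guardBits d : ℝ) ≤ 7 * plog D := by
  have h0 : 0 < guardBits d := Nat.size_pos.2 (by omega)
  obtain ⟨b, hb⟩ : ∃ b, guardBits d = b + 1 := ⟨guardBits d - 1, by omega⟩
  have h1 : 2 ^ b ≤ 4 * (d + 1) := by
    have : 2 ^ b ≤ d + 1 + (d + 1) + (d + 1 + (d + 1)) :=
      Nat.lt_size.1 (show b < guardBits d by omega)
    omega
  -- Here `4 * (d + 1) ≤ 20 * D`, rounded up to `2 ^ 5 * D`; with the extra bit this makes `6 + log₂
  -- D`.
  have h2 : (2 : ℝ) ^ b ≤ 2 ^ 5 * D := by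
    have : ((2 ^ b : ℕ) : ℝ) ≤ ((4 * (d + 1) : ℕ) : ℝ) := by exact_mod_cast h1
    push_cast at this
    linarith
  have h3 := Real.logb_le_logb_of_le (b := 2) (by norm_num) (by positivity) h2
  rw [Real.logb_mul (by norm_num) (by linarith), Real.logb_pow, Real.logb_pow,
    Real.logb_self_eq_one (by norm_num)] at h3
  have h4 := logb_le_plog D
  have h5 := one_le_plog D
  rw [hb]
  push_cast at h3 ⊢
  linarith

theorem sq_le_two_mul_two_pow (k : ℕ) : k ^ 2 ≤ 2 * 2 ^ k := by
  induction k with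
  | zero => norm_num
  | succ k ih =>
    rcases le_or_gt k 2 with h | h
    · interval_cases k <;> norm_num
    · rw [pow_succ 2 k]
      nlinarith

theorem two_pow_bitlen_le {n : ℕ} (hn : 0 < n) : 2 ^ bitlen (n : ℤ) ≤ 2 * n := by
  have := Nat.pow_log_le_self 2 hn.ne'
  rw [bitlen, Int.natAbs_natCast, pow_add]
  omega

theorem bitlen_le_plog {n : ℕ} {D : ℝ} (hn : 0 < n) (hD : 1 ≤ D) (h : (n : ℝ) ≤ D ^ 2) :
    (bitlen (n : ℤ) : ℝ) ≤ 3 * plog D := by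
  have h1 : (2 : ℝ) ^ bitlen (n : ℤ) ≤ 2 * D ^ 2 := by
    have : ((2 ^ bitlen (n : ℤ) : ℕ) : ℝ) ≤ ((2 * n : ℕ) : ℝ) := by
      exact_mod_cast two_pow_bitlen_le hn
    push_cast at this
    linarith
  have h2 := Real.logb_le_logb_of_le (b := 2) (by norm_num) (by positivity) h1
  rw [Real.logb_mul (by norm_num) (by positivity), Real.logb_pow, Real.logb_pow,
    Real.logb_self_eq_one (by norm_num)] at h2
  have h3 := logb_le_plog D
  have h4 := one_le_plog D
  push_cast at h2
  linarith

/-- This trades `log n` for `log D`. If `n ≤ D ^ 2`, then `log n = O(log D)` and `Q ≤ 2 n` suffices.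
Otherwise `D ≤ √n`, while the bitlength of `n` is at most `2 √n`, so `Q ≤ 5 D` gives `Q log n =
O(n)`. -/
theorem mul_bitlen_le {n Q : ℕ} {D : ℝ} (hn : 0 < n) (hD : 1 ≤ D) (hQn : Q ≤ 2 * n)
    (hQD : (Q : ℝ) ≤ 5 * D) : (Q : ℝ) * bitlen (n : ℤ) ≤ 10 * (n * plog D) := by
  have hn0 : (0 : ℝ) < n := by exact_mod_cast hn
  have hp := one_le_plog D
  have hQn' : (Q : ℝ) ≤ 2 * n := by exact_mod_cast hQn
  have hL0 : (0 : ℝ) ≤ bitlen (n : ℤ) := Nat.cast_nonneg _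
  rcases le_total ((n : ℝ)) (D ^ 2) with h | h
  · calc (Q : ℝ) * bitlen (n : ℤ) ≤ (2 * n) * (3 * plog D) :=
        mul_le_mul hQn' (bitlen_le_plog hn hD h) hL0 (by positivity)
      _ ≤ 10 * (n * plog D) := by nlinarith [mul_nonneg hn0.le (zero_le_one.trans hp)]
  · have h1 : ((bitlen (n : ℤ) : ℕ) : ℝ) ^ 2 ≤ 4 * n := by
      have h2 := sq_le_two_mul_two_pow (bitlen (n : ℤ))
      have h3 := two_pow_bitlen_le hn
      have h4 : bitlen (n : ℤ) ^ 2 ≤ 4 * n := by omega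
      exact_mod_cast h4
    have h2 : D * bitlen (n : ℤ) ≤ 2 * n := by
      refine abs_le_of_sq_le_sq' ?_ (by positivity) |>.2
      calc (D * (bitlen (n : ℤ) : ℝ)) ^ 2 = D ^ 2 * (bitlen (n : ℤ) : ℝ) ^ 2 := by ring
        _ ≤ (n : ℝ) * (4 * n) := mul_le_mul h h1 (by positivity) hn0.le
        _ = (2 * (n : ℝ)) ^ 2 := by ring
    calc (Q : ℝ) * bitlen (n : ℤ) ≤ 5 * D * bitlen (n : ℤ) := mul_le_mul_of_nonneg_right hQD hL0
      _ ≤ 10 * n := by linarith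
      _ ≤ 10 * (n * plog D) := by nlinarith

/-- A bound for the bitlengths of all addresses. -/
def addressBits (n d g : ℕ) : ℕ := bitlen ((2 * (n + d + g + 1) : ℕ) : ℤ) + g

theorem addressBits_le (n d : ℕ) :
    addressBits n d (guardBits d) ≤ bitlen (n : ℤ) + 2 * guardBits d + 3 := by
  have h1 := lt_two_pow_guardBits d
  have h2 := lt_two_pow_bitlen n
  have h3 : guardBits d < 2 ^ guardBits d := Nat.lt_two_pow_self
  have h4 : bitlen ((2 * (n + d + guardBits d + 1) : ℕ) : ℤ) ≤ bitlen (n : ℤ) + guardBits d + 3 := by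
    refine bitlen_cast_le (by omega) ?_
    rw [pow_add, pow_add]
    have h5 : 1 ≤ 2 ^ bitlen (n : ℤ) := Nat.one_le_two_pow
    have h6 : 1 ≤ 2 ^ guardBits d := Nat.one_le_two_pow
    nlinarith
  unfold addressBits
  omega

theorem addressBits_le_mul {n : ℕ} (hn : 1 ≤ n) (d : ℕ) :
    addressBits n d (guardBits d) ≤ 16 * (n * (d + 1)) := by
  have h1 := addressBits_le n d
  have h2 : bitlen (n : ℤ) ≤ n := bitlen_cast_le hn Nat.lt_two_pow_self
  have h3 : guardBits d ≤ 4 * (d + 1) := by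
    refine Nat.size_le.2 (lt_of_le_of_lt ?_ (Nat.lt_two_pow_self (n := 4 * (d + 1))))
    omega
  have h4 : n ≤ n * (d + 1) := Nat.le_mul_of_pos_right _ (by omega)
  have h5 : d + 1 ≤ n * (d + 1) := Nat.le_mul_of_pos_left _ hn
  omega

theorem total_cost_le {n Q d : ℕ} {D : ℝ} (hn : 0 < n) (hD : 1 ≤ D) (hQn : Q ≤ 2 * n)
    (hQd : Q ≤ d + 1) (hd : (d : ℝ) + 1 ≤ 5 * D) :
    ((100000 * (n * (d + 1) ^ 2 + n * (d + 1) * Q * addressBits n d (guardBits d)) : ℕ) : ℝ) ≤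
      100000000 * (n * D ^ 2 + n ^ 2 * D * plog D) := by
  have hn0 : (0 : ℝ) < n := by exact_mod_cast hn
  have hp := one_le_plog D
  have hQn' : (Q : ℝ) ≤ 2 * n := by exact_mod_cast hQn
  have hQd' : (Q : ℝ) ≤ d + 1 := by exact_mod_cast hQd
  have hQL := mul_bitlen_le hn hD hQn (hQd'.trans hd)
  have hg := guardBits_le hD hd
  have hW : (addressBits n d (guardBits d) : ℝ) ≤ bitlen (n : ℤ) + 2 * guardBits d + 3 := by
    exact_mod_cast addressBits_le n d
  -- The 17 is `2 * 7 + 3`, from two copies of the guard bits and the additive 3, which is at most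
  -- `3 * plog D`.
  have h1 : (Q : ℝ) * addressBits n d (guardBits d) ≤ 50 * (n * plog D) := by
    calc (Q : ℝ) * addressBits n d (guardBits d) ≤ Q * (bitlen (n : ℤ) + 17 * plog D) :=
          mul_le_mul_of_nonneg_left (by linarith) (Nat.cast_nonneg _)
      _ = Q * bitlen (n : ℤ) + Q * (17 * plog D) := by ring
      _ ≤ 10 * (n * plog D) + 2 * n * (17 * plog D) :=
          add_le_add hQL (mul_le_mul_of_nonneg_right hQn' (by positivity))
      _ ≤ 50 * (n * plog D) := by nlinarith [mul_nonneg hn0.le (zero_le_one.trans hp)]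
  have h2 : (n : ℝ) * (d + 1) ^ 2 ≤ 25 * (n * D ^ 2) := by
    calc (n : ℝ) * (d + 1) ^ 2 ≤ n * (5 * D) ^ 2 := by gcongr
      _ = 25 * (n * D ^ 2) := by ring
  have h3 : (n : ℝ) * (d + 1) * Q * addressBits n d (guardBits d) ≤
      250 * (n ^ 2 * D * plog D) := by
    calc (n : ℝ) * (d + 1) * Q * addressBits n d (guardBits d)
        = (n * (d + 1)) * (Q * addressBits n d (guardBits d)) := by ring
      _ ≤ (n * (5 * D)) * (50 * (n * plog D)) := by gcongr
      _ = 250 * (n ^ 2 * D * plog D) := by ring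
  have h4 : 0 ≤ (n : ℝ) * D ^ 2 := by positivity
  have h5 : 0 ≤ (n : ℝ) ^ 2 * D * plog D := by positivity
  push_cast
  linarith

/-! ### The matrices of the input -/

/-- The entries of a matrix as natural numbers, padded with zeros. -/
def natEntry {n k : ℕ} (A : Matrix (Fin n) (Fin k) ℤ) (i j : ℕ) : ℕ := (matrixCells A i j).toNat

theorem matrixCells_fin {n k : ℕ} (A : Matrix (Fin n) (Fin k) ℤ) (i : Fin n) (j : Fin k) :
    matrixCells A ((i : ℕ) : ℤ) ((j : ℕ) : ℤ) = A i j := by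
  have : ((0 : ℤ) ≤ (i : ℕ) ∧ ((i : ℕ) : ℤ) < n) ∧ (0 : ℤ) ≤ (j : ℕ) ∧ ((j : ℕ) : ℤ) < k := by omega
  simp [matrixCells]

theorem natEntry_fin {n k : ℕ} {A : Matrix (Fin n) (Fin k) ℤ} {i : Fin n} {j : Fin k}
    (h : 0 ≤ A i j) : (natEntry A i j : ℤ) = A i j := by
  rw [natEntry, matrixCells_fin, Int.toNat_of_nonneg h]

theorem natEntry_lt {n k l : ℕ} {A : Matrix (Fin n) (Fin k) ℤ} {B : Matrix (Fin n) (Fin l) ℤ}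
    {i i' : Fin n} {j : Fin k} {j' : Fin l} (h : 0 ≤ A i j ∧ A i j < B i' j') :
    natEntry A i j < natEntry B i' j' := by
  have h1 := natEntry_fin h.1
  have h2 := natEntry_fin (h.1.trans h.2.le)
  omega

theorem inputCells_inputStore {n : ℕ} {A M S U : Matrix (Fin n) (Fin n) ℤ} {h : Fin n → ℤ} {p : ℕ}
    (hM : ∀ i j, 0 ≤ M i j) (hS : ∀ i, 0 ≤ S i i) (hU : ∀ i j, 0 ≤ U i j) (hh : ∀ i, 0 ≤ h i) :
    InputCells (inputStore A M S U h p) n (natEntry M) (natEntry U) (fun k => natEntry S k k)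
      (fun k => natEntry (Matrix.of fun (i : Fin n) (_ : Fin 1) => h i) k 0) where
  dim := matrixCells_fin (Matrix.of fun _ _ : Fin 1 => (n : ℤ)) 0 0
  massager i hi k hk :=
    (matrixCells_fin M ⟨i, hi⟩ ⟨k, hk⟩).trans (natEntry_fin (hM ⟨i, hi⟩ ⟨k, hk⟩)).symm
  moduli k hk := (matrixCells_fin S ⟨k, hk⟩ ⟨k, hk⟩).trans (natEntry_fin (hS ⟨k, hk⟩)).symm
  transform k hk j hj :=
    (matrixCells_fin U ⟨k, hk⟩ ⟨j, hj⟩).trans (natEntry_fin (hU ⟨k, hk⟩ ⟨j, hj⟩)).symm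
  diagonal k hk :=
    (matrixCells_fin (Matrix.of fun (i : Fin n) (_ : Fin 1) => h i) ⟨k, hk⟩ 0).trans
      (natEntry_fin (A := Matrix.of fun (i : Fin n) (_ : Fin 1) => h i) (i := ⟨k, hk⟩) (j := 0)
        (hh ⟨k, hk⟩)).symm
  zero a ha i j := by
    obtain ⟨b, rfl⟩ := Nat.exists_eq_add_of_le' ha
    rfl

theorem natEntry_relation {n : ℕ} {A M S U H : Matrix (Fin n) (Fin n) ℤ} (hA : IsSmithForm A S)
    (hM : IsReducedSmithMassager A S M) (hU : IsHowellTransform S M U) (hH : IsHermiteForm A H)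
    {i j : ℕ} (hij : i < j) (hj : j < n) :
    ∃ y : ℤ, (natEntry H i i : ℚ) *
      (∑ k ∈ Finset.range n, (natEntry M i k : ℚ) * natEntry U k j / natEntry S k k) +
      ∑ l ∈ Finset.range n, (partialRow (natEntry H) i j l : ℚ) *
        (∑ k ∈ Finset.range n, (natEntry M l k : ℚ) * natEntry U k j / natEntry S k k) +
      (natEntry H i j : ℚ) / natEntry H j j = y := by
  have cast : ∀ (B : Matrix (Fin n) (Fin n) ℤ) (a b : Fin n), 0 ≤ B a b →
      (natEntry B a b : ℚ) = B a b := fun B a b h => by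
    exact_mod_cast congrArg (Int.cast : ℤ → ℚ) (natEntry_fin h)
  have hz : ∀ a b : Fin n,
      ∑ k ∈ Finset.range n, (natEntry M a k : ℚ) * natEntry U k b / natEntry S k k =
        massagerFraction S M U a b := fun a b => by
    rw [Finset.sum_range, massagerFraction]
    refine Finset.sum_congr rfl fun k _ => ?_
    rw [cast M _ _ (hM.reduced a k).1, cast U _ _ (hU.reduced k b).1, cast S _ _ (hA.diag_pos k).le]
  obtain ⟨y, hy⟩ := hU.relation hA hM hH (i := ⟨i, hij.trans hj⟩) (j := ⟨j, hj⟩) hij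
  refine ⟨y, ?_⟩
  rw [← hy]
  refine congrArg₂ _ (congrArg₂ _ (congrArg₂ _ (cast H ⟨i, hij.trans hj⟩ ⟨i, hij.trans hj⟩
    (hH.diag_pos _).le) (hz ⟨i, hij.trans hj⟩ ⟨j, hj⟩)) ?_) (congrArg₂ _
    (cast H ⟨i, hij.trans hj⟩ ⟨j, hj⟩ (hH.reduced _ _ hij).1) (cast H ⟨j, hj⟩ ⟨j, hj⟩
    (hH.diag_pos _).le))
  refine (Finset.sum_range _).trans (Finset.sum_congr rfl fun l _ => congrArg₂ _ ?_
    (hz l ⟨j, hj⟩))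
  have hl : (i < (l : ℕ) ∧ (l : ℕ) < j) ↔ ((⟨i, hij.trans hj⟩ : Fin n) < l ∧ l < ⟨j, hj⟩) := Iff.rfl
  unfold partialRow
  by_cases h : i < (l : ℕ) ∧ (l : ℕ) < j
  · rw [if_pos h, if_pos (hl.1 h)]
    exact cast H ⟨i, hij.trans hj⟩ l (hH.reduced _ _ h.1).1
  · rw [if_neg h, if_neg (fun h' => h (hl.2 h')), Nat.cast_zero]

theorem triangleEntry_natEntry {n : ℕ} {A H : Matrix (Fin n) (Fin n) ℤ} (hH : IsHermiteForm A H)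
    (r c : Fin n) :
    (triangleEntry (natEntry H) (fun k => natEntry H k k) r c : ℤ) = H r c := by
  unfold triangleEntry
  rcases lt_trichotomy r c with h | h | h
  · rw [if_pos (show (r : ℕ) < c from h), natEntry_fin (hH.reduced r c h).1]
  · subst h
    rw [if_neg (lt_irrefl _), if_pos rfl, natEntry_fin (hH.diag_pos r).le]
  · rw [if_neg (show ¬ (r : ℕ) < c from not_lt.2 (le_of_lt h)),
      if_neg (show ¬ (r : ℕ) = c from fun h' => (ne_of_gt h) (Fin.ext h')), hH.upper r c h]
    rfl

/-! ### The main theorem -/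

theorem mainTheorem8 :
    ∃ P : Prog, ∀ c : ℝ, ∃ C : ℝ,
      ∀ (n : ℕ) (A M S U : Matrix (Fin n) (Fin n) ℤ) (h : Fin n → ℤ) (p : ℕ),
        0 < n → A.det ≠ 0 →
        IsSmithForm A S →
        IsReducedSmithMassager A S M →
        IsHowellTransform S M U →
        IsHermiteDiagonal A h →
        p.Prime → IsCoprime (p : ℤ) (lastInvariant S) →
        plog p ≤ c * plog (plog S.det) →
        ∃ (t : ℕ) (τ : Store),
          P.Exec (inputStore A M S U h p) t τ ∧
          IsHermiteForm A (outputMatrix n τ) ∧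
          (t : ℝ) ≤ C * (n * plog S.det ^ 2 + n ^ 2 * plog S.det * plog (plog S.det)) := by
  refine ⟨.hermite, fun _ => ⟨100000000, fun n A M S U h p hn _ hS hM hU hh _ _ _ => ?_⟩⟩
  obtain ⟨H, hH, hdiag⟩ := hh
  have hI := inputCells_inputStore (A := A) (p := p) (h := h) (fun i j => (hM.reduced i j).1)
    (fun i => (hS.diag_pos i).le) (fun i j => (hU.reduced i j).1)
    (fun i => by rw [hdiag]; exact (hH.diag_pos i).le)
  obtain ⟨s, hs⟩ : ∃ s : ℕ → ℕ, s = fun k => natEntry S k k := ⟨_, rfl⟩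
  obtain ⟨e, he⟩ : ∃ e : ℕ → ℕ, e = fun k => natEntry H k k := ⟨_, rfl⟩
  have hI' : InputCells (inputStore A M S U h p) n (natEntry M) (natEntry U) s e := by
    refine { hI with moduli := hs ▸ hI.moduli, diagonal := fun k hk => ?_ }
    rw [hI.diagonal k hk, he]
    exact (natEntry_fin (A := Matrix.of fun (i : Fin n) (_ : Fin 1) => h i) (i := ⟨k, hk⟩) (j := 0)
      (by rw [Matrix.of_apply, hdiag]; exact (hH.diag_pos _).le)).trans ((hdiag ⟨k, hk⟩).trans
        (natEntry_fin (A := H) (i := ⟨k, hk⟩) (j := ⟨k, hk⟩) (hH.diag_pos _).le).symm)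
  have hsk : ∀ k : Fin n, (s k : ℤ) = S k k := fun k => by
    rw [hs]
    exact natEntry_fin (hS.diag_pos k).le
  have hek : ∀ k : Fin n, (e k : ℤ) = H k k := fun k => by
    rw [he]
    exact natEntry_fin (hH.diag_pos k).le
  have hspos : ∀ k < n, 0 < s k := fun k hk => by
    have h1 := hsk ⟨k, hk⟩
    have h2 := hS.diag_pos ⟨k, hk⟩
    rw [← h1] at h2
    exact_mod_cast h2
  have hepos : ∀ k < n, 0 < e k := fun k hk => by
    have h1 := hek ⟨k, hk⟩
    have h2 := hH.diag_pos ⟨k, hk⟩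
    rw [← h1] at h2
    exact_mod_cast h2
  have hdets : ((∏ k ∈ Finset.range n, s k : ℕ) : ℝ) = S.det := by
    have : ((∏ k ∈ Finset.range n, s k : ℕ) : ℤ) = S.det := by
      rw [hS.det_eq, Finset.prod_range, Nat.cast_prod]
      exact Finset.prod_congr rfl fun k _ => hsk k
    exact_mod_cast congrArg (Int.cast : ℤ → ℝ) this
  have hdete : ((∏ k ∈ Finset.range n, e k : ℕ) : ℝ) = S.det := by
    have : ((∏ k ∈ Finset.range n, e k : ℕ) : ℤ) = S.det := by
      rw [hS.det_eq, ← hH.prod_diag hS, Finset.prod_range, Nat.cast_prod]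
      exact Finset.prod_congr rfl fun k _ => hek k
    exact_mod_cast congrArg (Int.cast : ℤ → ℝ) this
  have b1 := bitOff_le_plog hspos hdets
  have b2 := bitOff_le_plog hepos hdete
  obtain ⟨d, hd⟩ : ∃ d, d = bitOff (resBits s) n + bitOff (resBits e) n := ⟨_, rfl⟩
  have hD := one_le_plog (S.det : ℝ)
  -- Both the moduli and the Hermite diagonal have product `S.det`, so each layout has at most `2 *
  -- plog S.det` bits; the remaining 1 is at most `plog S.det`.
  have hd5 : (d : ℝ) + 1 ≤ 5 * plog S.det := by
    rw [hd, Nat.cast_add]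
    linarith
  have hW : bitlen ((2 * (n + bitOff (resBits s) n + bitOff (resBits e) n + guardBits d + 1) : ℕ)
      : ℤ) ≤ addressBits n d (guardBits d) := by
    rw [addressBits, hd, ← add_assoc n]
    exact Nat.le_add_right _ _
  obtain ⟨t, τ, h1, h2, h3⟩ := runs_hermite (H := natEntry H) hI' hspos hepos
    (fun i hi k hk => by
      rw [hs]
      exact natEntry_lt (hM.reduced ⟨i, hi⟩ ⟨k, hk⟩))
    (fun k hk j hj => by
      rw [hs]
      exact natEntry_lt (hU.reduced ⟨k, hk⟩ ⟨j, hj⟩))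
    (fun i k hik hk => by
      rw [he]
      exact natEntry_lt (hH.reduced ⟨i, hik.trans hk⟩ ⟨k, hk⟩ hik))
    (fun i j hij hj => by
      rw [hs, he]
      exact natEntry_relation hS hM hU hH hij hj)
    (congrArg guardBits hd) (Nat.le_add_left _ _) hW
  refine ⟨t, τ, h1, ?_, ?_⟩
  · have : outputMatrix n τ = H := by
      ext r c
      rw [outputMatrix, Matrix.of_apply, h3 r r.2 c c.2, he]
      exact triangleEntry_natEntry hH r c
    rwa [this]
  · have hq := card_filter_pos_le (resBits e) n
    have hq' : ((Finset.range n).filter fun r => 0 < resBits e r).card ≤ n :=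
      (Finset.card_filter_le _ _).trans (Finset.card_range n).le
    have h4 := h2.trans (hermite_cost_le (X := d + 1) (by omega) rfl rfl hn
      (addressBits_le_mul hn d))
    exact (Nat.cast_le.2 h4).trans (total_cost_le hn hD (by omega) (by omega) hd5)
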